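/- Fix integers $N,p\ge 0$, $\theta_0\in\{1,-1\}$ and signs $\theta^1,\dots,\theta^N\in\{1,-1\}$ with $\theta^a\theta^{N+1-a}=\theta_0$ for all $a$. All algebras are over $\mathbb C$. **The algebra $\mathcal W_p(N)$.** Put $e_-=\sum_k E_{k+1,k}$ and $e_+=\sum_{k=1}^{p-1}k(p-k)E_{k,k+1}$ in $gl(p)$. For $0\le j\le p-1$, $-j\le m\le j$, let $M_{jj}=(e_+)^j$, $M_{j,m-1}=[e_-,M_{jm}]$, and $J^{ab}_{jm}=E^{ab}\otimes M_{jm}$ ($1\le a,b\le N$); these form a basis of $gl(Np)$. The symmetric algebra of a Lie algebra (polynomials in its elements) carries the Poisson bracket that extends the Lie bracket. For a finite family of constraints $\varphi_\alpha$ in a Poisson algebra with ideal $I=(\varphi_\alpha)$, the matrix of constraints is $C_{\alpha\beta}=\{\varphi_\alpha,\varphi_\beta\}$ mod $I$; if it is invertible (second class constraints), the Dirac bracket on the quotient by $I$ is $\{X,Y\}_*=\{X,Y\}-\sum_{\alpha,\beta}\{X,\varphi_\alpha\}(C^{-1})^{\alpha\beta}\{\varphi_\beta,Y\}$. $\mathcal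 W_p(N)$ is the quotient of the symmetric algebra of $gl(Np)$ by the constraints $J^{ab}_{jm}=0$ for $m<j$, except $J^{ab}_{1,-1}=\delta^{ab}$, with its Dirac bracket; it is generated by $W^{ab}_j=J^{ab}_{jj}$. **Folding.** $\tau(J^{ab}_{jm})=(-1)^{j+1}\theta^a\theta^b J^{N+1-b,N+1-a}_{jm}$ defines an automorphism of $gl(Np)$ and of $\mathcal W_p(N)$. Let $gl(Np)^\tau$ be its fixed points, $N.sl(p)$ the subalgebra generated by the $J_{jm}^{aa}$ with $j\ge1$, $[N.sl(p)]^\tau=N.sl(p)\cap gl(Np)^\tau$, and $\mathcal W_p(N)^\tau=\mathcal W_p(N)/\mathcal J$, where $\mathcal J$ is the ideal generated by all $W^{ab}_j-\tau(W^{ab}_j)$. **Reduction.** For a matrix Lie algebra $\mathfrak g$, a subalgebra $\mathfrak h$ whose principal $sl(2)$ has nilpotents $e,f$, and an invariant form $(x,y)=\kappa\,\mathrm{tr}(xy)$, $\kappa\neq0$, let $\mathcal W(\mathfrak g,\mathfrak h)$ be the quotient of the symmetric algebra of $\mathfrak g$ by the constraints $x=(e,x)$, $x$ in a basis of $[f,\mathfrak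 g]$, with its Dirac bracket. **Proposition.** The constraints of $\mathcal W_p(N)$ and those of $\mathcal W(gl(Np)^\tau,[N.sl(p)]^\tau)$ are second class. Here $e=1\otimes e_+$, $f=1\otimes e_-$, and the form is normalised so that the constraints agree with $J^{ab}_{1,-1}=\delta^{ab}$; for $p\ge 2$ this means $\kappa=3/(p-p^3)$, and for $p\le1$ there are no constraints. There is exactly one Poisson bracket on $\mathcal W_p(N)^\tau$ (the restricted Dirac bracket) such that $\{[F],[G]\}=[\{F,G\}_*]$ for all $\tau$-invariant $F,G\in\mathcal W_p(N)$. With this bracket, $[x]\mapsto[\tfrac12(x+\tau(x))]$, $x\in gl(Np)$, extends to an isomorphism of Poisson algebras $$\mathcal W_p(N)^\tau\;\cong\;\mathcal W(gl(Np)^\tau,[N.sl(p)]^\tau).$$ Moreover, in each of the following cases, $gl(Np)^\tau$ with its subalgebra $[N.sl(p)]^\tau$ and the principal $sl(2)$ of the latter is isomorphic to the stated $\mathfrak g$ with its subalgebra $\mathfrak h$ and the standard principal $sl(2)$ of $\mathfrak h$; the constraints of $\mathcal W[\mathfrak g,\mathfrak h]$ (for the trace form of the standard representation of $\mathfrak g$)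 are second class; and $\mathcal W_p(N)^\tau$ is isomorphic to $\mathcal W[\mathfrak g,\mathfrak h]$ as a Poisson algebra: - $N=2n+1$ and $p=2k+1$: $\mathcal W[so((2n+1)p),\,n.sl(p)\oplus so(2k+1)]$; - $N=2n$ and $\theta_0(-1)^{p-1}=-1$: $\mathcal W[sp(2np),\,n.sl(p)]$; - $N=2n$ and $\theta_0(-1)^{p-1}=1$: $\mathcal W[so(2np),\,n.sl(p)]$. Here $n.sl(p)$ is embedded in $so(2np)$, $sp(2np)$ as the matrices $\mathrm{diag}(X,-X^t)$ with $X$ block diagonal with $n$ traceless $p\times p$ blocks, and similarly, next to $so(2k+1)$, in $so((2n+1)p)$. -/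

import Mathlib

open scoped Kronecker

attribute [local instance 100] LieRing.ofAssociativeRing

noncomputable section

namespace FoldedW

/-! ## Poisson brackets and Dirac brackets -/

/-- A Poisson bracket on a commutative `ℂ`-algebra. -/
@[ext]
structure PoissonBracket (A : Type*) [CommRing A] [Algebra ℂ A] where
  /-- the bracket `{a, b}` -/
  br : A →ₗ[ℂ] A →ₗ[ℂ] A
  self : ∀ a, br a a = 0
  leibniz : ∀ a b c, br a (b * c) = b * br a c + c * br a b
  jacobi : ∀ a b c, br a (br b c) + br b (br c a) + br c (br a b) = 0

/-- An algebra isomorphism that preserves the Poisson brackets. -/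
def IsPoissonIso {A B : Type*} [CommRing A] [Algebra ℂ A] [CommRing B] [Algebra ℂ B]
    (P : PoissonBracket A) (Q : PoissonBracket B) (Ψ : A ≃ₐ[ℂ] B) : Prop :=
  ∀ x y, Ψ (P.br x y) = Q.br (Ψ x) (Ψ y)

section Basics

variable {A : Type*} [CommRing A] [Algebra ℂ A]

theorem PoissonBracket.skew (P : PoissonBracket A) (a b : A) : P.br a b = -P.br b a := by
  have h := P.self (a + b)
  simp only [map_add, LinearMap.add_apply, P.self, zero_add, add_zero] at h
  exact eq_neg_of_add_eq_zero_right h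

theorem PoissonBracket.leibniz' (P : PoissonBracket A) (a b c : A) :
    P.br (b * c) a = b * P.br c a + c * P.br b a := by
  rw [P.skew, P.leibniz, P.skew a c, P.skew a b]; ring

/-- The zero Poisson bracket. -/
def zeroBracket (A : Type*) [CommRing A] [Algebra ℂ A] : PoissonBracket A where
  br := 0
  self := by simp
  leibniz := by simp
  jacobi := by simp

variable (P : PoissonBracket A) {ι : Type*} (φ : ι → A)

/-- The ideal generated by a family of constraints. -/
def constraintIdeal : Ideal A := Ideal.span (Set.range φ)

/-- The algebra obtained by imposing the constraints `φ α = 0`. -/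
abbrev Reduced : Type _ := A ⧸ constraintIdeal φ

/-- Imposing the constraints. -/
abbrev impose : A →ₐ[ℂ] Reduced φ := Ideal.Quotient.mkₐ ℂ (constraintIdeal φ)

/-- The matrix of constraints `C_{αβ} ∼ {φ_α, φ_β}`: the constraints are applied after the
Poisson brackets have been computed. -/
def constraintMatrix : Matrix ι ι (Reduced φ) :=
  Matrix.of fun α β => impose φ (P.br (φ α) (φ β))

theorem impose_eq_iff (F G : A) : impose φ F = impose φ G ↔ F - G ∈ constraintIdeal φ := by
  simp only [Ideal.Quotient.mkₐ_eq_mk]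
  exact Ideal.Quotient.eq

variable [Fintype ι] [DecidableEq ι]

/-- The constraints are second class: their matrix is invertible on the constraint surface. -/
def IsSecondClass : Prop := IsUnit (constraintMatrix P φ)

/-- `{F, G} - ∑ {F, φ_α} C^{αβ} {φ_β, G}`, with the constraints applied after the Poisson
brackets have been computed. -/
def diracPre (F G : A) : Reduced φ :=
  impose φ (P.br F G) - ∑ α, ∑ β,
    impose φ (P.br F (φ α)) * (constraintMatrix P φ)⁻¹ α β * impose φ (P.br (φ β) G)

variable {P φ}

theorem exists_tilde (h : IsSecondClass P φ) (F : A) : ∃ F' : A, impose φ F = impose φ F' ∧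
    (∀ G G', impose φ G = impose φ G' → impose φ (P.br F' G) = impose φ (P.br F' G')) ∧
    ∀ G, diracPre P φ F G = impose φ (P.br F' G) := by
  have hdet : IsUnit (constraintMatrix P φ).det := (Matrix.isUnit_iff_isUnit_det _).1 h
  have hc : ∀ β, ∃ c : A, impose φ c =
      ∑ α, impose φ (P.br F (φ α)) * (constraintMatrix P φ)⁻¹ α β := fun β =>
    Ideal.Quotient.mk_surjective _
  choose c hc using hc
  have hφ : ∀ α, impose φ (φ α) = 0 := fun α =>
    Ideal.Quotient.eq_zero_iff_mem.2 (Ideal.subset_span ⟨α, rfl⟩)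
  have key : ∀ G, impose φ (P.br (F - ∑ β, c β * φ β) G) = diracPre P φ F G := by
    intro G
    simp only [map_sub, map_sum, LinearMap.sub_apply, LinearMap.sum_apply, P.leibniz', map_add,
      map_mul, hφ, zero_mul, add_zero, hc, diracPre, Finset.sum_mul]
    rw [Finset.sum_comm]
  have hzero : ∀ γ, impose φ (P.br (F - ∑ β, c β * φ β) (φ γ)) = 0 := by
    intro γ
    rw [key, diracPre, Finset.sum_congr rfl fun α _ => show
      (∑ β, impose φ (P.br F (φ α)) * (constraintMatrix P φ)⁻¹ α β *
        impose φ (P.br (φ β) (φ γ))) = impose φ (P.br F (φ α)) *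
        ((constraintMatrix P φ)⁻¹ * constraintMatrix P φ) α γ by
      rw [Matrix.mul_apply, Finset.mul_sum]
      exact Finset.sum_congr rfl fun β _ => mul_assoc _ _ _]
    simp [Matrix.nonsing_inv_mul _ hdet, Matrix.one_apply]
  refine ⟨F - ∑ β, c β * φ β, ?_, ?_, fun G => (key G).symm⟩
  · simp [map_sub, map_sum, map_mul, hφ, -Ideal.Quotient.mkₐ_eq_mk]
  · intro G G' hG
    rw [impose_eq_iff] at hG
    rw [← sub_eq_zero, ← map_sub, ← map_sub]
    generalize G - G' = D at hG
    refine Submodule.span_induction (p := fun D _ =>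
      impose φ (P.br (F - ∑ β, c β * φ β) D) = 0) ?_ ?_ ?_ ?_ hG
    · rintro _ ⟨γ, rfl⟩
      exact hzero γ
    · simp
    · intro x y _ _ hx hy
      rw [map_add, map_add, hx, hy, add_zero]
    · intro a x hx' hx
      have hx0 : impose φ x = 0 := Ideal.Quotient.eq_zero_iff_mem.2 hx'
      rw [smul_eq_mul, P.leibniz, map_add, map_mul, map_mul, hx, hx0]; simp

theorem diracPre_add_left (F F' G : A) :
    diracPre P φ (F + F') G = diracPre P φ F G + diracPre P φ F' G := by
  simp only [diracPre, map_add, LinearMap.add_apply, add_mul, Finset.sum_add_distrib]; ring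

theorem diracPre_add_right (F G G' : A) :
    diracPre P φ F (G + G') = diracPre P φ F G + diracPre P φ F G' := by
  simp only [diracPre, map_add, mul_add, Finset.sum_add_distrib]; ring

theorem diracPre_smul_left (c : ℂ) (F G : A) :
    diracPre P φ (c • F) G = c • diracPre P φ F G := by
  simp only [diracPre, map_smul, LinearMap.smul_apply, smul_mul_assoc, Finset.smul_sum, smul_sub]

theorem diracPre_smul_right (c : ℂ) (F G : A) :
    diracPre P φ F (c • G) = c • diracPre P φ F G := by
  simp only [diracPre, map_smul, mul_smul_comm, Finset.smul_sum, smul_sub]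

theorem diracPre_self (h : IsSecondClass P φ) (F : A) : diracPre P φ F F = 0 := by
  obtain ⟨F', h1, h2, h3⟩ := exists_tilde h F
  rw [h3, h2 F F' h1, P.self, map_zero]

theorem diracPre_skew (h : IsSecondClass P φ) (F G : A) :
    diracPre P φ F G = -diracPre P φ G F := by
  have h' := diracPre_self h (F + G)
  rw [diracPre_add_left, diracPre_add_right, diracPre_add_right, diracPre_self h,
    diracPre_self h, zero_add, add_zero] at h'
  exact eq_neg_of_add_eq_zero_left h'

theorem diracPre_congr (h : IsSecondClass P φ) {F F' G G' : A} (hF : impose φ F = impose φ F')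
    (hG : impose φ G = impose φ G') : diracPre P φ F G = diracPre P φ F' G' := by
  have right : ∀ F G G' : A, impose φ G = impose φ G' →
      diracPre P φ F G = diracPre P φ F G' := by
    intro F G G' hG
    obtain ⟨F₁, -, h2, h3⟩ := exists_tilde h F
    rw [h3, h3, h2 _ _ hG]
  rw [right F G G' hG, diracPre_skew h, right G' F F' hF, ← diracPre_skew h]

/-- The Dirac bracket on the reduced algebra, for second class constraints. -/
def diracOfSecondClass (h : IsSecondClass P φ) : PoissonBracket (Reduced φ) where
  br := LinearMap.mk₂ ℂ (fun x y => Quotient.liftOn₂' x y (diracPre P φ) (by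
      intro F G F' G' hF hG
      exact diracPre_congr h (Quotient.sound' hF) (Quotient.sound' hG)))
    (by
      rintro ⟨F⟩ ⟨F'⟩ ⟨G⟩
      exact diracPre_add_left F F' G)
    (by
      rintro c ⟨F⟩ ⟨G⟩
      exact diracPre_smul_left c F G)
    (by
      rintro ⟨F⟩ ⟨G⟩ ⟨G'⟩
      exact diracPre_add_right F G G')
    (by
      rintro c ⟨F⟩ ⟨G⟩
      exact diracPre_smul_right c F G)
  self := by
    rintro ⟨F⟩
    exact diracPre_self h F
  leibniz := by
    rintro ⟨F⟩ ⟨G⟩ ⟨H⟩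
    obtain ⟨F', -, -, h3⟩ := exists_tilde h F
    change diracPre P φ F (G * H) = impose φ G * diracPre P φ F H + impose φ H * diracPre P φ F G
    rw [h3, h3, h3, P.leibniz, map_add, map_mul, map_mul]
  jacobi := by
    rintro ⟨F⟩ ⟨G⟩ ⟨H⟩
    obtain ⟨F', f1, f2, f3⟩ := exists_tilde h F
    obtain ⟨G', g1, g2, g3⟩ := exists_tilde h G
    obtain ⟨H', h1, h2, h3⟩ := exists_tilde h H
    have step : ∀ {X X' Y Y' Z Z' : A}, (∀ W, diracPre P φ X W = impose φ (P.br X' W)) →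
        (∀ W W', impose φ W = impose φ W' → impose φ (P.br X' W) = impose φ (P.br X' W')) →
        (∀ W, diracPre P φ Y W = impose φ (P.br Y' W)) →
        (∀ W W', impose φ W = impose φ W' → impose φ (P.br Y' W) = impose φ (P.br Y' W')) →
        impose φ Z = impose φ Z' →
        Quotient.liftOn₂' (impose φ X) (diracPre P φ Y Z) (diracPre P φ) (by
          intro F G F' G' hF hG
          exact diracPre_congr h (Quotient.sound' hF) (Quotient.sound' hG)) =
        impose φ (P.br X' (P.br Y' Z')) := by
      intro X X' Y Y' Z Z' x3 x2 y3 y2 z1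
      rw [y3, y2 _ _ z1]
      exact x3 _
    refine (congrArg₂ (· + ·) (congrArg₂ (· + ·) (step f3 f2 g3 g2 h1) (step g3 g2 h3 h2 f1))
      (step h3 h2 f3 f2 g1)).trans ?_
    simp only [← map_add, P.jacobi, map_zero]

theorem diracOfSecondClass_mk (h : IsSecondClass P φ) (F G : A) :
    (diracOfSecondClass h).br (impose φ F) (impose φ G) = diracPre P φ F G := rfl

variable (P φ)

open Classical in
/-- The Dirac bracket on the reduced algebra (the zero bracket if the constraints fail to be
second class). -/
def diracBracket : PoissonBracket (Reduced φ) :=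
  if h : IsSecondClass P φ then diracOfSecondClass h else zeroBracket _

end Basics

/-! ## The Poisson algebra of polynomials in the elements of a Lie algebra -/

section LiePoisson

variable {L : Type*} [LieRing L] [LieAlgebra ℂ L]

/-- The linear map `x ↦ (x, f x)` to the trivial square-zero extension. -/
def symDerAux (f : L →ₗ[ℂ] SymmetricAlgebra ℂ L) :
    L →ₗ[ℂ] TrivSqZeroExt (SymmetricAlgebra ℂ L) (SymmetricAlgebra ℂ L) where
  toFun x := TrivSqZeroExt.inl (SymmetricAlgebra.ι ℂ L x) + TrivSqZeroExt.inr (f x)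
  map_add' x y := by
    ext <;> simp
  map_smul' c x := by
    ext <;> simp

theorem fst_lift_symDerAux (f : L →ₗ[ℂ] SymmetricAlgebra ℂ L) (a : SymmetricAlgebra ℂ L) :
    (SymmetricAlgebra.lift (symDerAux f) a).fst = a := by
  induction a using SymmetricAlgebra.induction with
  | algebraMap r => simp [TrivSqZeroExt.algebraMap_eq_inl']
  | ι x => simp [symDerAux]
  | mul a b ha hb => simp [ha, hb]
  | add a b ha hb => simp [ha, hb]

/-- The derivation of the symmetric algebra with prescribed values on generators. -/
def symDer (f : L →ₗ[ℂ] SymmetricAlgebra ℂ L) :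
    Derivation ℂ (SymmetricAlgebra ℂ L) (SymmetricAlgebra ℂ L) :=
  Derivation.mk'
    { toFun := fun a => (SymmetricAlgebra.lift (symDerAux f) a).snd
      map_add' := by simp
      map_smul' := by simp }
    (by
      intro a b
      simp [fst_lift_symDerAux, mul_comm])

theorem symDer_ι (f : L →ₗ[ℂ] SymmetricAlgebra ℂ L) (x : L) :
    symDer f (SymmetricAlgebra.ι ℂ L x) = f x := by
  simp [symDer, symDerAux]

theorem symDer_unique {D D' : Derivation ℂ (SymmetricAlgebra ℂ L) (SymmetricAlgebra ℂ L)}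
    (h : ∀ x, D (SymmetricAlgebra.ι ℂ L x) = D' (SymmetricAlgebra.ι ℂ L x)) : D = D' := by
  ext a
  induction a using SymmetricAlgebra.induction with
  | algebraMap r => simp
  | ι x => exact h x
  | mul a b ha hb => simp [ha, hb]
  | add a b ha hb => simp [ha, hb]

/-- The adjoint action `G ↦ {x, G}` of an element of the Lie algebra. -/
def adDer (x : L) : Derivation ℂ (SymmetricAlgebra ℂ L) (SymmetricAlgebra ℂ L) :=
  symDer (SymmetricAlgebra.ι ℂ L ∘ₗ (LieAlgebra.ad ℂ L x : L →ₗ[ℂ] L))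

theorem adDer_ι (x y : L) :
    adDer x (SymmetricAlgebra.ι ℂ L y) = SymmetricAlgebra.ι ℂ L ⁅x, y⁆ := by
  simp [adDer, symDer_ι]

theorem adDer_add (x y : L) : adDer (x + y) = adDer x + adDer y :=
  symDer_unique fun z => by simp [adDer_ι]

theorem adDer_smul (c : ℂ) (x : L) : adDer (c • x) = c • adDer x :=
  symDer_unique fun z => by simp [adDer_ι]

theorem adDer_lie (x y : L) : adDer ⁅x, y⁆ = ⁅adDer x, adDer y⁆ :=
  symDer_unique fun z => by
    simp [Derivation.commutator_apply, adDer_ι, ← map_sub]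

/-- The Hamiltonian derivation `G ↦ {F, G}`. -/
def ham (F : SymmetricAlgebra ℂ L) : Derivation ℂ (SymmetricAlgebra ℂ L) (SymmetricAlgebra ℂ L) :=
  symDer
    { toFun := fun y => -adDer y F
      map_add' := by
        intro x y
        simp [adDer_add]; ring
      map_smul' := by
        intro c x
        simp [adDer_smul] }

theorem ham_ι (F : SymmetricAlgebra ℂ L) (y : L) :
    ham F (SymmetricAlgebra.ι ℂ L y) = -adDer y F := by
  simp [ham, symDer_ι]

theorem ham_of_ι (x : L) : ham (SymmetricAlgebra.ι ℂ L x) = adDer x :=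
  symDer_unique fun y => by
    rw [ham_ι, adDer_ι, adDer_ι, ← map_neg, lie_skew]

theorem ham_add (F G : SymmetricAlgebra ℂ L) : ham (F + G) = ham F + ham G :=
  symDer_unique fun y => by
    simp [ham_ι]; ring

theorem ham_smul (c : ℂ) (F : SymmetricAlgebra ℂ L) : ham (c • F) = c • ham F :=
  symDer_unique fun y => by simp [ham_ι]

theorem ham_algebraMap (c : ℂ) : ham (algebraMap ℂ (SymmetricAlgebra ℂ L) c) = 0 :=
  symDer_unique fun y => by simp [ham_ι]

theorem ham_mul (F G : SymmetricAlgebra ℂ L) : ham (F * G) = F • ham G + G • ham F :=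
  symDer_unique fun y => by
    simp [ham_ι]; ring

theorem ham_skew (F G : SymmetricAlgebra ℂ L) : ham F G = -ham G F := by
  induction F using SymmetricAlgebra.induction with
  | algebraMap r => simp [ham_algebraMap]
  | ι x => rw [ham_of_ι, ham_ι, neg_neg]
  | mul a b ha hb =>
    simp [ham_mul, ha, hb]; ring
  | add a b ha hb =>
    simp [ham_add, ha, hb]; ring

theorem ham_lie_ι (x : L) (G : SymmetricAlgebra ℂ L) : ⁅adDer x, ham G⁆ = ham (adDer x G) :=
  symDer_unique fun y => by
    have h := congrArg (fun D : Derivation ℂ _ _ => D G) (adDer_lie x y)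
    simp only [Derivation.commutator_apply] at h
    rw [Derivation.commutator_apply, ham_ι, ham_ι, adDer_ι, ham_ι, h, map_neg]
    ring

theorem ham_lie (F G : SymmetricAlgebra ℂ L) : ⁅ham F, ham G⁆ = ham (ham F G) := by
  induction F using SymmetricAlgebra.induction with
  | algebraMap r =>
    have h0 : ham (0 : SymmetricAlgebra ℂ L) = 0 := by simpa using ham_algebraMap (L := L) 0
    rw [ham_algebraMap, Derivation.zero_apply, h0]
    exact zero_lie (ham G)
  | ι x => rw [ham_of_ι, ham_lie_ι]
  | mul a b ha hb =>
    ext H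
    have ha' := congrArg (fun D : Derivation ℂ _ _ => D H) ha
    have hb' := congrArg (fun D : Derivation ℂ _ _ => D H) hb
    simp only [Derivation.commutator_apply] at ha' hb'
    simp only [Derivation.commutator_apply, ham_mul, ham_add, Derivation.add_apply,
      Derivation.smul_apply, smul_eq_mul, Derivation.leibniz, map_add, ← ha', ← hb', ham_skew G a,
      ham_skew G b]
    ring
  | add a b ha hb =>
    rw [ham_add, Derivation.add_apply, ham_add, ← ha, ← hb]
    exact add_lie (ham a) (ham b) (ham G)

variable (L) in
/-- The Poisson bracket on the symmetric algebra of a Lie algebra that extends the Lie bracket: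
`{x, y} = [x, y]` on generators. -/
def liePoisson : PoissonBracket (SymmetricAlgebra ℂ L) where
  br := LinearMap.mk₂ ℂ (fun F G => ham F G) (by simp [ham_add]) (by simp [ham_smul]) (by simp)
    (by simp)
  self F := by
    have h := ham_skew F F
    have h2 : (2 : ℂ) • ham F F = 0 := by rw [two_smul]; nth_rewrite 1 [h]; simp
    exact (smul_eq_zero.1 h2).resolve_left two_ne_zero
  leibniz F G H := by simp
  jacobi F G H := by
    have h := congrArg (fun D : Derivation ℂ _ _ => D H) (ham_lie F G)
    simp only [Derivation.commutator_apply] at h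
    simp only [LinearMap.mk₂_apply]
    rw [ham_skew H (ham F G), ← h, ham_skew H F, map_neg]
    ring

theorem liePoisson_ι (x y : L) :
    (liePoisson L).br (SymmetricAlgebra.ι ℂ L x) (SymmetricAlgebra.ι ℂ L y) =
      SymmetricAlgebra.ι ℂ L ⁅x, y⁆ := by
  simp [liePoisson, ham_of_ι, adDer_ι]

end LiePoisson

/-! ## The algebra `gl(Np)` and the algebra `W_p(N)` -/

/-- The nilpotent `e_- = ∑ E_{k+1,k}` of the principal `sl(2)` of `gl(p)`. -/
def eMinus (p : ℕ) : Matrix (Fin p) (Fin p) ℂ :=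
  Matrix.of fun k l => if (k : ℕ) = l + 1 then 1 else 0

/-- The nilpotent `e_+ = ∑ k (p - k) E_{k,k+1}` (with `1 ≤ k < p`) of the principal `sl(2)` of
`gl(p)`; here the indices of `Fin p` start at `0`. -/
def ePlus (p : ℕ) : Matrix (Fin p) (Fin p) ℂ :=
  Matrix.of fun k l => if (l : ℕ) = k + 1 then ((k : ℂ) + 1) * ((p : ℂ) - k - 1) else 0

/-- The `p × p` matrix `M_{jm}`: `M_{jj} = e_+ ^ j`, and `M_{j,m-1} = [e_-, M_{jm}]`. -/
def M (p j : ℕ) (m : ℤ) : Matrix (Fin p) (Fin p) ℂ :=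
  (fun X => ⁅eMinus p, X⁆)^[((j : ℤ) - m).toNat] (ePlus p ^ j)

/-- The Lie algebra `gl(Np)`. -/
abbrev gl (N p : ℕ) : Type := Matrix (Fin N × Fin p) (Fin N × Fin p) ℂ

/-- The generator `J_{jm}^{ab} = E^{ab} ⊗ M_{jm}` of `gl(Np)`. -/
def J (N p : ℕ) (a b : Fin N) (j : ℕ) (m : ℤ) : gl N p :=
  Matrix.single a b 1 ⊗ₖ M p j m

/-- The labels `(j, m, a, b)`, `0 ≤ j < p`, `-j ≤ m < j`, of the constraints. -/
abbrev CIdx (N p : ℕ) : Type :=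
  Σ j : Fin p, ↥(Finset.Ico (-((j : ℕ) : ℤ)) ((j : ℕ) : ℤ)) × Fin N × Fin N

/-- The constraints of `W_p(N)`: `J_{jm}^{ab} = 0` for `m < j`, except `J_{1,-1}^{ab} = δ^{ab}`. -/
def wpConstraint (N p : ℕ) (α : CIdx N p) : SymmetricAlgebra ℂ (gl N p) :=
  SymmetricAlgebra.ι ℂ (gl N p) (J N p α.2.2.1 α.2.2.2 α.1 α.2.1) -
    algebraMap ℂ _
      (if (α.1 : ℕ) = 1 ∧ (α.2.1 : ℤ) = -1 ∧ α.2.2.1 = α.2.2.2 then 1 else 0)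

/-- The algebra `W_p(N) = W(gl(Np), N.sl(p))`: polynomials in the elements of `gl(Np)`, subject to
the constraints. -/
abbrev Wp (N p : ℕ) : Type := Reduced (wpConstraint N p)

/-- The Dirac bracket of `W_p(N)`. -/
def wpBracket (N p : ℕ) : PoissonBracket (Wp N p) :=
  diracBracket (liePoisson (gl N p)) (wpConstraint N p)

/-- The class in `W_p(N)` of an element of `gl(Np)`. -/
def wpMk (N p : ℕ) (x : gl N p) : Wp N p :=
  impose (wpConstraint N p) (SymmetricAlgebra.ι ℂ (gl N p) x)

/-- The generators `W_j^{ab} = J_{jj}^{ab}` of `W_p(N)`. -/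
def wGen (N p : ℕ) (a b : Fin N) (j : Fin p) : Wp N p := wpMk N p (J N p a b j (j : ℕ))

/-! ## The automorphism `τ` -/

/-- Signs `θ^a = ±1` with `θ^a θ^{N+1-a} = θ₀` for all `a`. -/
def Signs (N : ℕ) (θ₀ : ℤˣ) : Type := {θ : Fin N → ℤˣ // ∀ a, θ a * θ a.rev = θ₀}

/-- The sign `θ^a` as a complex number. -/
def Signs.val {N : ℕ} {θ₀ : ℤˣ} (θ : Signs N θ₀) (a : Fin N) : ℂ := ((θ.1 a : ℤ) : ℂ)

section Tau

variable {N : ℕ} {θ₀ : ℤˣ} (θ : Signs N θ₀) (p : ℕ)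

theorem Signs.sq (a : Fin N) : θ.val a * θ.val a = 1 := by
  unfold Signs.val
  rw [← Int.cast_mul, ← Units.val_mul, Int.units_mul_self]; simp

theorem Signs.rev_rev (a b : Fin N) :
    θ.val a.rev * θ.val b.rev = θ.val a * θ.val b := by
  have h : ∀ c : Fin N, θ.val c.rev = ((θ₀ : ℤ) : ℂ) * θ.val c := by
    intro c
    have h1 : θ.val c * θ.val c.rev = ((θ₀ : ℤ) : ℂ) := by
      unfold Signs.val
      rw [← Int.cast_mul, ← Units.val_mul, θ.2 c]
    rw [← h1, mul_right_comm, θ.sq, one_mul]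
  have h0 : ((θ₀ : ℤ) : ℂ) * ((θ₀ : ℤ) : ℂ) = 1 := by
    rw [← Int.cast_mul, ← Units.val_mul, Int.units_mul_self]; simp
  rw [h, h]
  linear_combination (θ.val a * θ.val b) * h0

/-- The automorphism `τ` of `gl(Np)`, in matrix entries. On the generators it is
`τ(J_{jm}^{ab}) = (-1)^{j+1} θ^a θ^b J_{jm}^{N+1-b,N+1-a}`, see `tau_J`. -/
def tau : gl N p →ₗ⁅ℂ⁆ gl N p where
  toFun X := Matrix.of fun u v =>
    -(θ.val u.1 * θ.val v.1 * (-1) ^ ((u.2 : ℕ) + (v.2 : ℕ)) *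
      X (v.1.rev, v.2.rev) (u.1.rev, u.2.rev))
  map_add' X Y := by
    ext u v
    simp [mul_add]; ring
  map_smul' c X := by
    ext u v
    simp; ring
  map_lie' := by
    intro X Y
    have key : ∀ (X Y : gl N p) (u v : Fin N × Fin p),
        ∑ w : Fin N × Fin p, X (v.1.rev, v.2.rev) w * Y w (u.1.rev, u.2.rev) =
        ∑ w : Fin N × Fin p, X (v.1.rev, v.2.rev) (w.1.rev, w.2.rev) *
          Y (w.1.rev, w.2.rev) (u.1.rev, u.2.rev) := fun X Y u v =>
      (Equiv.sum_comp (Equiv.prodCongr Fin.revPerm Fin.revPerm)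
        (fun w => X (v.1.rev, v.2.rev) w * Y w (u.1.rev, u.2.rev))).symm
    ext u v
    have sgn : ∀ k : ℕ, ((-1 : ℂ)) ^ k * (-1) ^ k = 1 := by
      intro k
      rw [← pow_add, ← two_mul, pow_mul]; simp
    simp only [Ring.lie_def, Matrix.of_apply, Matrix.sub_apply, Matrix.mul_apply, key]
    rw [mul_sub, Finset.mul_sum, Finset.mul_sum, neg_sub, ← Finset.sum_sub_distrib,
      ← Finset.sum_sub_distrib]
    refine Finset.sum_congr rfl fun w _ => ?_
    have h : θ.val w.1 * θ.val w.1 * ((-1) ^ (w.2 : ℕ) * (-1) ^ (w.2 : ℕ)) = 1 := by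
      rw [θ.sq, sgn, one_mul]
    simp only [pow_add]
    linear_combination (θ.val u.1 * θ.val v.1 * (-1) ^ (u.2 : ℕ) * (-1) ^ (v.2 : ℕ) *
      (X (v.1.rev, v.2.rev) (w.1.rev, w.2.rev) * Y (w.1.rev, w.2.rev) (u.1.rev, u.2.rev) -
        Y (v.1.rev, v.2.rev) (w.1.rev, w.2.rev) * X (w.1.rev, w.2.rev) (u.1.rev, u.2.rev))) * h

/-- The anti-involution `X_{kl} ↦ (-1)^{k+l} X_{p+1-l,p+1-k}` of the `p × p` matrices. -/
def flip (X : Matrix (Fin p) (Fin p) ℂ) : Matrix (Fin p) (Fin p) ℂ :=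
  Matrix.of fun k l => (-1) ^ ((k : ℕ) + (l : ℕ)) * X l.rev k.rev

variable {p}

theorem flip_mul (X Y : Matrix (Fin p) (Fin p) ℂ) : flip p (X * Y) = flip p Y * flip p X := by
  ext k l
  simp only [flip, Matrix.of_apply, Matrix.mul_apply, Finset.mul_sum]
  rw [← Equiv.sum_comp Fin.revPerm]
  refine Finset.sum_congr rfl fun i _ => ?_
  have h : ((-1 : ℂ)) ^ (i : ℕ) * (-1) ^ (i : ℕ) = 1 := by
    rw [← pow_add, ← two_mul, pow_mul]; simp
  simp only [Fin.revPerm_apply, pow_add]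
  linear_combination (-(-1) ^ (k : ℕ) * (-1) ^ (l : ℕ) * X l.rev i.rev * Y i.rev k.rev) * h

theorem flip_sub (X Y : Matrix (Fin p) (Fin p) ℂ) : flip p (X - Y) = flip p X - flip p Y := by
  ext k l
  simp [flip, mul_sub]

theorem flip_smul (c : ℂ) (X : Matrix (Fin p) (Fin p) ℂ) : flip p (c • X) = c • flip p X := by
  ext k l
  simp [flip]; ring

theorem flip_one : flip p 1 = 1 := by
  ext k l
  by_cases h : k = l
  · subst h
    simp [flip, ← two_mul, pow_mul]
  · simp [flip, Matrix.one_apply, h, Fin.rev_inj, Ne.symm h]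

theorem flip_eMinus : flip p (eMinus p) = -eMinus p := by
  ext k l
  simp only [flip, eMinus, Matrix.of_apply, Matrix.neg_apply, Fin.val_rev]
  by_cases h : (k : ℕ) = l + 1
  · have h' : p - ((l : ℕ) + 1) = p - ((k : ℕ) + 1) + 1 := by omega
    rw [if_pos h, if_pos h', h, show (l : ℕ) + 1 + l = 2 * l + 1 by ring, pow_succ, pow_mul]
    simp
  · have h' : ¬ p - ((l : ℕ) + 1) = p - ((k : ℕ) + 1) + 1 := by omega
    rw [if_neg h, if_neg h']; simp

theorem flip_ePlus : flip p (ePlus p) = -ePlus p := by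
  ext k l
  simp only [flip, ePlus, Matrix.of_apply, Matrix.neg_apply, Fin.val_rev]
  by_cases h : (l : ℕ) = k + 1
  · have h' : p - ((k : ℕ) + 1) = p - ((l : ℕ) + 1) + 1 := by omega
    have hl : (l : ℕ) + 1 ≤ p := l.2
    rw [if_pos h, if_pos h', h, show (k : ℕ) + (k + 1) = 2 * k + 1 by ring, pow_succ, pow_mul,
      Nat.cast_sub (by omega)]
    push_cast
    ring
  · have h' : ¬ p - ((k : ℕ) + 1) = p - ((l : ℕ) + 1) + 1 := by omega
    rw [if_neg h, if_neg h']; simp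

theorem flip_M (j : ℕ) (m : ℤ) : flip p (M p j m) = (-1 : ℂ) ^ j • M p j m := by
  unfold M
  generalize ((j : ℤ) - m).toNat = t
  induction t with
  | zero =>
    simp only [Function.iterate_zero, id_eq]
    induction j with
    | zero => simp [flip_one]
    | succ j ih =>
      rw [pow_succ, flip_mul, ih, flip_ePlus, ← pow_succ, pow_succ' (ePlus p), pow_succ]
      simp
  | succ t ih =>
    rw [Function.iterate_succ_apply', Ring.lie_def, flip_sub, flip_mul, flip_mul, ih, flip_eMinus,
      smul_sub]
    simp only [smul_mul_assoc, mul_smul_comm, neg_mul, mul_neg, smul_neg]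
    abel

theorem tau_kronecker (A : Matrix (Fin N) (Fin N) ℂ) (B : Matrix (Fin p) (Fin p) ℂ) :
    tau θ p (A ⊗ₖ B) =
      -((Matrix.of fun a b => θ.val a * θ.val b * A b.rev a.rev) ⊗ₖ flip p B) := by
  ext u v
  simp [tau, flip]; ring

/-- The defining formula of `τ` on the generators. -/
theorem tau_J (a b : Fin N) (j : ℕ) (m : ℤ) :
    tau θ p (J N p a b j m) =
      ((-1) ^ (j + 1) * (θ.val a * θ.val b)) • J N p b.rev a.rev j m := by
  unfold J
  rw [tau_kronecker, flip_M]
  ext u v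
  have h : ∀ c d : Fin N, c.rev = d ↔ c = d.rev := by
    intro c d
    rw [← Fin.rev_inj, Fin.rev_rev]
  have e : Matrix.single a b (1 : ℂ) v.1.rev u.1.rev =
      Matrix.single b.rev a.rev (1 : ℂ) u.1 v.1 := by
    simp only [Matrix.single_apply]
    refine if_congr ?_ rfl rfl
    constructor
    · rintro ⟨h1, h2⟩
      subst h1 h2
      simp
    · rintro ⟨h1, h2⟩
      rw [← h1, ← h2]
      simp
  have s : θ.val u.1 * θ.val v.1 * Matrix.single b.rev a.rev (1 : ℂ) u.1 v.1 =
      θ.val a * θ.val b * Matrix.single b.rev a.rev (1 : ℂ) u.1 v.1 := by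
    rw [Matrix.single_apply]
    split_ifs with hc
    · rw [← hc.1, ← hc.2, θ.rev_rev, mul_comm (θ.val b)]
    · simp
  simp only [Matrix.neg_apply, Matrix.kroneckerMap_apply, Matrix.of_apply, Matrix.smul_apply,
    smul_eq_mul, e, s, pow_succ]
  ring

/-! ### `τ` on polynomials and on `W_p(N)` -/

variable (p)

/-- `τ` on polynomials in the elements of `gl(Np)`. -/
def symTau : SymmetricAlgebra ℂ (gl N p) →ₐ[ℂ] SymmetricAlgebra ℂ (gl N p) :=
  SymmetricAlgebra.lift (SymmetricAlgebra.ι ℂ (gl N p) ∘ₗ (tau θ p : gl N p →ₗ[ℂ] gl N p))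

theorem symTau_constraint (α : CIdx N p) :
    symTau θ p (wpConstraint N p α) ∈ constraintIdeal (wpConstraint N p) := by
  obtain ⟨j, m, a, b⟩ := α
  have key : symTau θ p (wpConstraint N p ⟨j, m, a, b⟩) =
      algebraMap ℂ _ ((-1) ^ ((j : ℕ) + 1) * (θ.val a * θ.val b)) *
        wpConstraint N p ⟨j, m, b.rev, a.rev⟩ := by
    simp only [symTau, wpConstraint, map_sub, AlgHom.commutes, SymmetricAlgebra.lift_ι_apply,
      LinearMap.comp_apply, LieHom.coe_toLinearMap, tau_J, map_smul, mul_sub, ← Algebra.smul_def,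
      ← map_mul]
    congr 2
    by_cases hab : a = b
    · subst hab
      by_cases hj : (j : ℕ) = 1
      · simp [hj, θ.sq]
      · simp [hj]
    · simp [hab, Ne.symm hab, Fin.rev_inj]
  rw [key]
  exact Ideal.mul_mem_left _ _ (Ideal.subset_span ⟨_, rfl⟩)

/-- `τ` on `W_p(N)`. -/
def wTau : Wp N p →ₐ[ℂ] Wp N p :=
  Ideal.quotientMapₐ _ (symTau θ p) (by
    refine Ideal.span_le.2 ?_
    rintro _ ⟨α, rfl⟩
    exact symTau_constraint θ p α)

/-! ### The folded algebra -/

/-- The ideal of `W_p(N)` generated by the elements `W_j^{ab} - τ(W_j^{ab})`. -/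
def foldIdeal : Ideal (Wp N p) :=
  Ideal.span {x | ∃ (a b : Fin N) (j : Fin p), x = wGen N p a b j - wTau θ p (wGen N p a b j)}

/-- The coset `W_p(N)^τ`. -/
abbrev FoldedWp : Type := Wp N p ⧸ foldIdeal θ p

/-- `B` is the restriction of the Dirac bracket of `W_p(N)` to the coset: on the classes of
`τ`-invariant elements it is the class of their Dirac bracket. -/
def IsRestrictedDirac (B : PoissonBracket (FoldedWp θ p)) : Prop :=
  ∀ F G : Wp N p, wTau θ p F = F → wTau θ p G = G →
    B.br (Ideal.Quotient.mk _ F) (Ideal.Quotient.mk _ G) =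
      Ideal.Quotient.mk (foldIdeal θ p) ((wpBracket N p).br F G)

end Tau

/-! ## Hamiltonian reduction of a matrix Lie algebra -/

section WAlgebra

variable {ι : Type} [Fintype ι] [DecidableEq ι] (L : LieSubalgebra ℂ (Matrix ι ι ℂ))

/-- The constraints of the Hamiltonian reduction of the matrix Lie algebra `L` with respect to an
`sl(2)`-triple with nilpotents `e, f ∈ L`, for the invariant form `(x, y) = κ tr(x y)`. The
constrained elements form the space `[f, L]`, a complement in `L` of the highest weight vectors
(the kernel of `ad e`), and `x ∈ [f, L]` is constrained to the value `(e, x)`; one constraint is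
taken for each element `x` of a basis of `[f, L]`. -/
def wConstraint (κ : ℂ) (e f : L)
    (i : Fin (Module.finrank ℂ (LinearMap.range (LieAlgebra.ad ℂ L f)))) : SymmetricAlgebra ℂ L :=
  let x : L := Module.finBasis ℂ (LinearMap.range (LieAlgebra.ad ℂ L f)) i
  SymmetricAlgebra.ι ℂ L x -
    algebraMap ℂ _ (κ * Matrix.trace ((e : Matrix ι ι ℂ) * (x : Matrix ι ι ℂ)))

/-- The algebra `W[L, h]`, where `e, f` are the nilpotents of the principal `sl(2)` of `h`. -/
abbrev WAlg (κ : ℂ) (e f : L) : Type := Reduced (wConstraint L κ e f)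

/-- The Dirac bracket of the algebra `W[L, h]`. -/
def wBracket (κ : ℂ) (e f : L) : PoissonBracket (WAlg L κ e f) :=
  diracBracket (liePoisson L) (wConstraint L κ e f)

/-- The class in `W[L, h]` of an element of `L`. -/
def wMk (κ : ℂ) (e f x : L) : WAlg L κ e f :=
  impose (wConstraint L κ e f) (SymmetricAlgebra.ι ℂ L x)

end WAlgebra

/-! ## The folded Lie algebras -/

section FoldedLie

variable {N : ℕ} {θ₀ : ℤˣ} (θ : Signs N θ₀) (p : ℕ)

/-- `gl(Np)^τ`, the elements fixed by `τ`. -/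
def glTau : LieSubalgebra ℂ (gl N p) where
  carrier := {X | tau θ p X = X}
  add_mem' {X Y} hX hY := by
    change tau θ p X = X at hX
    change tau θ p Y = Y at hY
    change tau θ p (X + Y) = X + Y
    rw [map_add, hX, hY]
  zero_mem' := map_zero (tau θ p)
  smul_mem' c X hX := by
    change tau θ p X = X at hX
    change tau θ p (c • X) = c • X
    rw [map_smul, hX]
  lie_mem' {X Y} hX hY := by
    change tau θ p X = X at hX
    change tau θ p Y = Y at hY
    change tau θ p ⁅X, Y⁆ = ⁅X, Y⁆
    rw [LieHom.map_lie, hX, hY]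

theorem tau_tau (X : gl N p) : tau θ p (tau θ p X) = X := by
  ext u v
  have h1 : ∀ k : Fin p, ((-1 : ℂ)) ^ (k : ℕ) * (-1) ^ (k.rev : ℕ) = (-1) ^ (p - 1) := by
    intro k
    rw [← pow_add, Fin.val_rev]
    congr 1
    have := k.2
    omega
  have h2 : ((-1 : ℂ)) ^ (p - 1) * (-1) ^ (p - 1) = 1 := by
    rw [← pow_add, ← two_mul, pow_mul]; simp
  have h3 := θ.rev_rev v.1 u.1
  simp only [tau, LieHom.coe_mk, Matrix.of_apply, Fin.rev_rev, pow_add, h3]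
  linear_combination
    (X u v * (-1) ^ (u.2 : ℕ) * (-1) ^ (v.2 : ℕ) * (-1) ^ (u.2.rev : ℕ) * (-1) ^ (v.2.rev : ℕ)) *
      (θ.val u.1 * θ.val u.1 * θ.sq v.1 + θ.sq u.1) +
    (X u v * (-1) ^ (v.2 : ℕ) * (-1) ^ (v.2.rev : ℕ)) * h1 u.2 +
    (X u v * (-1) ^ (p - 1)) * h1 v.2 + X u v * h2

/-- The projection `(x + τ(x)) / 2` of `gl(Np)` onto `gl(Np)^τ`. -/
def symmetrize (x : gl N p) : glTau θ p :=
  ⟨(1 / 2 : ℂ) • (x + tau θ p x), by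
    change tau θ p _ = _
    rw [map_smul, map_add, tau_tau, add_comm]⟩

theorem one_kronecker_mem {B : Matrix (Fin p) (Fin p) ℂ} (hB : flip p B = -B) :
    (1 : Matrix (Fin N) (Fin N) ℂ) ⊗ₖ B ∈ glTau θ p := by
  have h : (Matrix.of fun a b => θ.val a * θ.val b * (1 : Matrix (Fin N) (Fin N) ℂ) b.rev a.rev) =
      1 := by
    ext a b
    by_cases hab : a = b
    · subst hab
      simp [θ.sq]
    · simp [Matrix.one_apply, hab, Fin.rev_inj, Ne.symm hab]
  change tau θ p _ = _
  rw [tau_kronecker, h, hB]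
  ext u v
  simp

/-- The nilpotent `e_+` of the principal `sl(2)` of `[N.sl(p)]^τ` (and of `N.sl(p)`). -/
def glE : glTau θ p := ⟨1 ⊗ₖ ePlus p, one_kronecker_mem θ p flip_ePlus⟩

/-- The nilpotent `e_-` of the principal `sl(2)` of `[N.sl(p)]^τ` (and of `N.sl(p)`). -/
def glF : glTau θ p := ⟨1 ⊗ₖ eMinus p, one_kronecker_mem θ p flip_eMinus⟩

/-- The normalisation of the invariant form for which the constraints read
`J_{1,-1}^{ab} = δ^{ab}`: one has `tr(e_+ M_{1,-1}) = -2 ∑ k (p - k) = (p - p^3) / 3`. -/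
def kappa (p : ℕ) : ℂ := 3 / ((p : ℂ) - (p : ℂ) ^ 3)

/-- The subalgebra `N.sl(p)` of `gl(Np)`, generated by the `J_{jm}^{aa}`, `j ≥ 1`. -/
def nSl (N p : ℕ) : LieSubalgebra ℂ (gl N p) :=
  LieSubalgebra.lieSpan ℂ _ {x | ∃ (a : Fin N) (j : ℕ) (m : ℤ),
    1 ≤ j ∧ j < p ∧ -(j : ℤ) ≤ m ∧ m ≤ j ∧ x = J N p a a j m}

end FoldedLie

/-! ## The target algebras -/

section Targets

open Matrix LieAlgebra

variable (n p : ℕ)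

/-- The matrix `diag(X, -Xᵗ)`, where `X` is block diagonal with blocks `x 1, …, x n`. -/
def dbl {n p : ℕ} (x : Fin n → Matrix (Fin p) (Fin p) ℂ) :
    Matrix ((Fin p × Fin n) ⊕ (Fin p × Fin n)) ((Fin p × Fin n) ⊕ (Fin p × Fin n)) ℂ :=
  fromBlocks (blockDiagonal x) 0 0 (-(blockDiagonal x)ᵀ)

theorem dbl_isSkewAdjoint_JD {n p : ℕ} (x : Fin n → Matrix (Fin p) (Fin p) ℂ) :
    (Orthogonal.JD (Fin p × Fin n) ℂ).IsSkewAdjoint (dbl x) := by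
  simp [Matrix.IsSkewAdjoint, Matrix.IsAdjointPair, Orthogonal.JD, dbl, fromBlocks_transpose,
    fromBlocks_multiply, fromBlocks_neg]

theorem dbl_isSkewAdjoint_J {n p : ℕ} (x : Fin n → Matrix (Fin p) (Fin p) ℂ) :
    (Matrix.J (Fin p × Fin n) ℂ).IsSkewAdjoint (dbl x) := by
  simp [Matrix.IsSkewAdjoint, Matrix.IsAdjointPair, Matrix.J, dbl, fromBlocks_transpose,
    fromBlocks_multiply, fromBlocks_neg]

/-- `so(2np)`. -/
abbrev soEven := Orthogonal.typeD (Fin p × Fin n) ℂ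

/-- `sp(2np)`. -/
abbrev spEven := Symplectic.sp (Fin p × Fin n) ℂ

/-- The bilinear form `∑ (-1)^k x_k y_{p+1-k}` on `ℂ^p`; it is nondegenerate, and symmetric for
odd `p`. -/
def antiDiag : Matrix (Fin p) (Fin p) ℂ :=
  Matrix.of fun k l => if l = k.rev then (-1) ^ (k : ℕ) else 0

/-- The bilinear form on `ℂ^p ⊕ ℂ^{np} ⊕ ℂ^{np}` given by `antiDiag` on the first summand and by
the pairing of the other two. -/
def oddForm : Matrix (Fin p ⊕ ((Fin p × Fin n) ⊕ (Fin p × Fin n)))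
    (Fin p ⊕ ((Fin p × Fin n) ⊕ (Fin p × Fin n))) ℂ :=
  fromBlocks (antiDiag p) 0 0 (Orthogonal.JD (Fin p × Fin n) ℂ)

/-- `so((2n+1)p)` for odd `p`. -/
abbrev soOdd := skewAdjointMatricesLieSubalgebra (oddForm n p)

theorem isSkewAdjoint_antiDiag {p : ℕ} {X : Matrix (Fin p) (Fin p) ℂ} (h : flip p X = -X) :
    (antiDiag p).IsSkewAdjoint X := by
  have hl : antiDiag p * (-X) = Matrix.of fun k l : Fin p => -((-1) ^ (k : ℕ) * X k.rev l) := by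
    ext k l
    simp [antiDiag, Matrix.mul_apply]
  have hr : Xᵀ * antiDiag p = Matrix.of fun k l : Fin p => (-1) ^ (l.rev : ℕ) * X l.rev k := by
    ext k l
    have hx : ∀ i : Fin p, l = i.rev ↔ i = l.rev := by
      intro i
      constructor
      · rintro rfl
        simp
      · rintro rfl
        simp
    simp [antiDiag, Matrix.mul_apply, hx, mul_comm]
  unfold Matrix.IsSkewAdjoint Matrix.IsAdjointPair
  rw [hl, hr]
  ext k l
  have h1 := congrFun (congrFun h l.rev) k
  simp only [flip, Matrix.of_apply, Matrix.neg_apply, Fin.rev_rev, pow_add] at h1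
  have h2 : ((-1 : ℂ)) ^ (l.rev : ℕ) * (-1) ^ (l.rev : ℕ) = 1 := by
    rw [← pow_add, ← two_mul, pow_mul]; simp
  simp only [Matrix.of_apply]
  linear_combination ((-1) ^ (l.rev : ℕ)) * h1 - (-1) ^ (k : ℕ) * X k.rev l * h2

theorem oddBlock_isSkewAdjoint {n p : ℕ} {y : Matrix (Fin p) (Fin p) ℂ}
    (x : Fin n → Matrix (Fin p) (Fin p) ℂ) (hy : flip p y = -y) :
    (oddForm n p).IsSkewAdjoint (fromBlocks y 0 0 (dbl x)) := by
  have h1 := isSkewAdjoint_antiDiag hy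
  have h2 := dbl_isSkewAdjoint_JD x
  unfold Matrix.IsSkewAdjoint Matrix.IsAdjointPair at *
  rw [oddForm, fromBlocks_transpose, fromBlocks_neg, fromBlocks_multiply, fromBlocks_multiply]
  simp only [Matrix.transpose_zero, Matrix.zero_mul, Matrix.mul_zero, neg_zero, add_zero,
    zero_add, h1, h2]

/-- The nilpotent `e_+` of the principal `sl(2)` of `n.sl(p) ⊆ so(2np)`. -/
def soEvenE : soEven n p := ⟨dbl fun _ => ePlus p,
  (mem_skewAdjointMatricesSubmodule _ _).2 (dbl_isSkewAdjoint_JD _)⟩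

/-- The nilpotent `e_-` of the principal `sl(2)` of `n.sl(p) ⊆ so(2np)`. -/
def soEvenF : soEven n p := ⟨dbl fun _ => eMinus p,
  (mem_skewAdjointMatricesSubmodule _ _).2 (dbl_isSkewAdjoint_JD _)⟩

/-- The nilpotent `e_+` of the principal `sl(2)` of `n.sl(p) ⊆ sp(2np)`. -/
def spEvenE : spEven n p := ⟨dbl fun _ => ePlus p,
  (mem_skewAdjointMatricesSubmodule _ _).2 (dbl_isSkewAdjoint_J _)⟩

/-- The nilpotent `e_-` of the principal `sl(2)` of `n.sl(p) ⊆ sp(2np)`. -/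
def spEvenF : spEven n p := ⟨dbl fun _ => eMinus p,
  (mem_skewAdjointMatricesSubmodule _ _).2 (dbl_isSkewAdjoint_J _)⟩

/-- The nilpotent `e_+` of the principal `sl(2)` of `so(p) ⊕ n.sl(p) ⊆ so((2n+1)p)`. -/
def soOddE : soOdd n p := ⟨fromBlocks (ePlus p) 0 0 (dbl fun _ => ePlus p),
  (mem_skewAdjointMatricesSubmodule _ _).2 (oddBlock_isSkewAdjoint _ flip_ePlus)⟩

/-- The nilpotent `e_-` of the principal `sl(2)` of `so(p) ⊕ n.sl(p) ⊆ so((2n+1)p)`. -/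
def soOddF : soOdd n p := ⟨fromBlocks (eMinus p) 0 0 (dbl fun _ => eMinus p),
  (mem_skewAdjointMatricesSubmodule _ _).2 (oddBlock_isSkewAdjoint _ flip_eMinus)⟩

/-- The subalgebra `n.sl(p)` of `so(2np)` and of `sp(2np)`: the matrices `diag(X, -Xᵗ)` with `X`
block diagonal with traceless blocks. -/
def nSlEven : LieSubalgebra ℂ
    (Matrix ((Fin p × Fin n) ⊕ (Fin p × Fin n)) ((Fin p × Fin n) ⊕ (Fin p × Fin n)) ℂ) :=
  LieSubalgebra.lieSpan ℂ _ {z | ∃ x : Fin n → Matrix (Fin p) (Fin p) ℂ,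
    (∀ i, (x i).trace = 0) ∧ z = dbl x}

/-- The subalgebra `so(p) ⊕ n.sl(p)` of `so((2n+1)p)`, for odd `p`. -/
def nSlOdd : LieSubalgebra ℂ (Matrix (Fin p ⊕ ((Fin p × Fin n) ⊕ (Fin p × Fin n)))
    (Fin p ⊕ ((Fin p × Fin n) ⊕ (Fin p × Fin n))) ℂ) :=
  LieSubalgebra.lieSpan ℂ _ {z | ∃ (y : Matrix (Fin p) (Fin p) ℂ)
    (x : Fin n → Matrix (Fin p) (Fin p) ℂ),
    (antiDiag p).IsSkewAdjoint y ∧ (∀ i, (x i).trace = 0) ∧ z = fromBlocks y 0 0 (dbl x)}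

end Targets

/-! ## Identification of a folded algebra -/

/-- The Lie algebra `gl(Np)^τ`, with its subalgebra `[N.sl(p)]^τ` and the principal `sl(2)` of that
subalgebra, is isomorphic to `L` with its subalgebra `h` and the `sl(2)` of `e, f`. -/
def FoldsTo {N : ℕ} {θ₀ : ℤˣ} (θ : Signs N θ₀) (p : ℕ) {ι : Type} [Fintype ι] [DecidableEq ι]
    (L h : LieSubalgebra ℂ (Matrix ι ι ℂ)) (e f : L) : Prop :=
  ∃ Φ : glTau θ p ≃ₗ⁅ℂ⁆ L, (∀ x : glTau θ p, (x : gl N p) ∈ nSl N p ↔ (Φ x : Matrix ι ι ℂ) ∈ h) ∧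
    Φ (glE θ p) = e ∧ Φ (glF θ p) = f

/-- The Poisson algebra `(A, B)` is the algebra `W[L, h]`, where `e, f` are the nilpotents of the
principal `sl(2)` of `h`: the constraints are second class, and `A` with the bracket `B` is
isomorphic to the reduced algebra with its Dirac bracket. -/
def IsWAlgebra {A : Type} [CommRing A] [Algebra ℂ A] (B : PoissonBracket A)
    {ι : Type} [Fintype ι] [DecidableEq ι] (L : LieSubalgebra ℂ (Matrix ι ι ℂ)) (e f : L) : Prop :=
  IsSecondClass (liePoisson L) (wConstraint L 1 e f) ∧
    ∃ Ψ : A ≃ₐ[ℂ] WAlg L 1 e f, IsPoissonIso B (wBracket L 1 e f) Ψ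

end FoldedW

end

noncomputable section

namespace FoldedW

/-! ## Dirac brackets and first class lifts -/

section DiracMaps

variable {A B : Type*} [CommRing A] [Algebra ℂ A] [CommRing B] [Algebra ℂ B]

/-! Dirac brackets are handled through first class lifts. For second class constraints every class
in the quotient has a lift `F` whose brackets with all constraints vanish on the constraint surface
(`exists_firstClass`), and against such an `F` the Dirac bracket is just the original bracket. An
algebra homomorphism therefore respects Dirac brackets as soon as it respects the original bracket
against these lifts (`map_diracBracket`); the inverse of the matrix of constraints need not be
followed.

All constraints in question have the form `x = χ x` with `x` in a basis of `V = [f, L]` and `χ x = κ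
tr (e x)`. Grade `L` by half the eigenvalues of `ad [e, f]`. On `V`, an entry of the matrix of
constraints between degrees `m` and `n` is zero if `m + n < -1`, and is the number `χ ⁅x, y⁆` if `m
+ n = -1`. These numbers form a nondegenerate pairing of degrees `m` and `-1 - m`, so the matrix is
block triangular with invertible diagonal blocks (`IsGoodGrading.isSecondClass`). Nondegeneracy is
the injectivity of `ad f ∘ ad e` on `[f, L]`, read off from the basis of strings `(ad e_-)^t
(e_+^j)`, and it passes from `gl(Np)` to `gl(Np)^τ` because the latter is a graded, orthogonal
direct summand (`isGoodGrading_of_retract`).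

For the folding, the projection `(1 + τ) / 2` onto `gl(Np)^τ` induces a homomorphism of symmetric
algebras. It is not Poisson, but it respects brackets with `τ`-invariant polynomials, since the
bracket of such a polynomial with an anti-invariant generator is anti-invariant and is therefore
sent to zero (`foldSym_ham`). Invariant elements have invariant first class lifts, by averaging. The
projection and the inclusion of `gl(Np)^τ` induce mutually inverse maps between the coset and the
reduction of `gl(Np)^τ`. The bracket of the coset is transported along this isomorphism; it is the
only possible one because every class has an invariant representative.

For the identifications, `gl(Np)^τ` is the Lie algebra of the bilinear form that pairs the index
`(a, k)` with its reversal, with sign `θ^a (-1)^k`. Exchanging the two arguments multiplies the form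
by `θ₀ (-1)^(p-1)`, which decides between orthogonal and symplectic. A signed permutation of the
indices carries it, up to a global sign, to the standard form (`FormEquiv`), preserves traces of
products, and sends block diagonal matrices to the matrices `diag(X, -Xᵗ)`. The two normalisations
of the invariant form, `kappa p` and `1`, are related by the automorphism that multiplies degree `d`
by `c ^ d` (`isWAlgebra_foldBracket`). -/

theorem IsPoissonIso.trans {C : Type*} [CommRing C] [Algebra ℂ C] {P : PoissonBracket A}
    {Q : PoissonBracket B} {R : PoissonBracket C} {Ψ : A ≃ₐ[ℂ] B} {Ψ' : B ≃ₐ[ℂ] C}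
    (h : IsPoissonIso P Q Ψ) (h' : IsPoissonIso Q R Ψ') : IsPoissonIso P R (Ψ.trans Ψ') :=
  fun x y => by simp only [AlgEquiv.trans_apply, h x y, h' _ _]

/-- The Poisson bracket obtained by transport of structure. -/
def PoissonBracket.comap (Q : PoissonBracket B) (Ψ : A ≃ₐ[ℂ] B) : PoissonBracket A where
  br := LinearMap.mk₂ ℂ (fun x y => Ψ.symm (Q.br (Ψ x) (Ψ y))) (by simp) (by simp) (by simp)
    (by simp)
  self a := by simp [Q.self]
  leibniz a b c := by simp [Q.leibniz]
  jacobi a b c := by simp [← map_add, Q.jacobi]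

theorem PoissonBracket.comap_br (Q : PoissonBracket B) (Ψ : A ≃ₐ[ℂ] B) (x y : A) :
    (Q.comap Ψ).br x y = Ψ.symm (Q.br (Ψ x) (Ψ y)) := rfl

theorem PoissonBracket.isPoissonIso_comap (Q : PoissonBracket B) (Ψ : A ≃ₐ[ℂ] B) :
    IsPoissonIso (Q.comap Ψ) Q Ψ := fun x y => by simp [comap_br]

variable {P : PoissonBracket A} {ι : Type*} {φ : ι → A}

theorem impose_constraint (α : ι) : impose φ (φ α) = 0 :=
  Ideal.Quotient.eq_zero_iff_mem.2 (Ideal.subset_span ⟨α, rfl⟩)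

/-- The bracket of a first class element with an element of the constraint ideal vanishes on the
constraint surface. -/
theorem impose_br_eq_zero {F : A} (hF : ∀ α, impose φ (P.br F (φ α)) = 0) {a : A}
    (ha : a ∈ constraintIdeal φ) : impose φ (P.br F a) = 0 := by
  refine Submodule.span_induction (p := fun D _ => impose φ (P.br F D) = 0) ?_ ?_ ?_ ?_ ha
  · rintro _ ⟨γ, rfl⟩
    exact hF γ
  · simp
  · intro x y _ _ hx hy
    rw [map_add, map_add, hx, hy, add_zero]
  · intro a x hx' hx
    have hx0 : impose φ x = 0 := Ideal.Quotient.eq_zero_iff_mem.2 hx'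
    rw [smul_eq_mul, P.leibniz, map_add, map_mul, map_mul, hx, hx0]; simp

variable [Fintype ι] [DecidableEq ι]

theorem diracBracket_impose (h : IsSecondClass P φ) (F G : A) :
    (diracBracket P φ).br (impose φ F) (impose φ G) = diracPre P φ F G := by
  rw [diracBracket, dif_pos h, diracOfSecondClass_mk]

/-- For a first class `F`, the Dirac bracket with `F` is the original bracket. -/
theorem diracPre_of_firstClass {F : A} (h : ∀ α, impose φ (P.br F (φ α)) = 0) (G : A) :
    diracPre P φ F G = impose φ (P.br F G) := by
  simp [diracPre, h, -Ideal.Quotient.mkₐ_eq_mk]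

theorem diracBracket_of_firstClass (h : IsSecondClass P φ) {F : A}
    (hF : ∀ α, impose φ (P.br F (φ α)) = 0) (G : A) :
    (diracBracket P φ).br (impose φ F) (impose φ G) = impose φ (P.br F G) := by
  rw [diracBracket_impose h, diracPre_of_firstClass hF]

theorem exists_firstClass (h : IsSecondClass P φ) (x : Reduced φ) :
    ∃ F : A, impose φ F = x ∧ ∀ α, impose φ (P.br F (φ α)) = 0 := by
  obtain ⟨F, rfl⟩ := Ideal.Quotient.mkₐ_surjective ℂ (constraintIdeal φ) x
  obtain ⟨F', h1, h2, -⟩ := exists_tilde h F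
  refine ⟨F', h1.symm, fun α => ?_⟩
  -- The bracket with the lift depends only on the class of the other argument, and a constraint has
  -- the class of `0`.
  rw [h2 (φ α) 0 (by rw [impose_constraint, map_zero]), map_zero, map_zero]

/-- A homomorphism that is compatible with the brackets of first class elements is compatible with
the Dirac brackets. -/
theorem map_diracBracket {Q : PoissonBracket B} {κ : Type*} [Fintype κ] [DecidableEq κ]
    {ψ : κ → B} (hP : IsSecondClass P φ) (hQ : IsSecondClass Q ψ) (π : A →ₐ[ℂ] B)
    (Ψ : Reduced φ →ₐ[ℂ] Reduced ψ) (hΨ : ∀ a, Ψ (impose φ a) = impose ψ (π a))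
    (hψ : ∀ β, ∃ a ∈ constraintIdeal φ, π a = ψ β) {F : A}
    (hF : ∀ α, impose φ (P.br F (φ α)) = 0) (hπ : ∀ G, π (P.br F G) = Q.br (π F) (π G))
    (x : Reduced φ) :
    Ψ ((diracBracket P φ).br (impose φ F) x) = (diracBracket Q ψ).br (Ψ (impose φ F)) (Ψ x) := by
  obtain ⟨G, rfl⟩ := Ideal.Quotient.mkₐ_surjective ℂ (constraintIdeal φ) x
  -- The image of `F` is again first class, because each constraint on the target lifts to an
  -- element of the source ideal.
  have hF' : ∀ β, impose ψ (Q.br (π F) (ψ β)) = 0 := by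
    intro β
    obtain ⟨a, ha, hb⟩ := hψ β
    rw [← hb, ← hπ, ← hΨ, impose_br_eq_zero hF ha, map_zero]
  rw [diracBracket_of_firstClass hP hF, hΨ, hΨ, hΨ, diracBracket_of_firstClass hQ hF', hπ]

end DiracMaps

/-! ## Homomorphisms of symmetric algebras -/

section SymMaps

variable {L L' : Type*} [LieRing L] [LieAlgebra ℂ L] [LieRing L'] [LieAlgebra ℂ L']

theorem liePoisson_br (F G : SymmetricAlgebra ℂ L) : (liePoisson L).br F G = ham F G := rfl

/-- The algebra homomorphism of symmetric algebras extending a linear map. -/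
def symMap (f : L →ₗ[ℂ] L') : SymmetricAlgebra ℂ L →ₐ[ℂ] SymmetricAlgebra ℂ L' :=
  SymmetricAlgebra.lift (SymmetricAlgebra.ι ℂ L' ∘ₗ f)

@[simp]
theorem symMap_ι (f : L →ₗ[ℂ] L') (x : L) :
    symMap f (SymmetricAlgebra.ι ℂ L x) = SymmetricAlgebra.ι ℂ L' (f x) := by
  simp [symMap]

/-- Two derivations that are related by an algebra homomorphism on generators are related by it. -/
theorem map_derivation {π : SymmetricAlgebra ℂ L →ₐ[ℂ] SymmetricAlgebra ℂ L'}
    {D : Derivation ℂ (SymmetricAlgebra ℂ L) (SymmetricAlgebra ℂ L)}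
    {D' : Derivation ℂ (SymmetricAlgebra ℂ L') (SymmetricAlgebra ℂ L')}
    (h : ∀ x, π (D (SymmetricAlgebra.ι ℂ L x)) = D' (π (SymmetricAlgebra.ι ℂ L x)))
    (F : SymmetricAlgebra ℂ L) : π (D F) = D' (π F) := by
  induction F using SymmetricAlgebra.induction with
  | algebraMap r => simp
  | ι x => exact h x
  | mul a b ha hb => simp [ha, hb]
  | add a b ha hb => simp [ha, hb]

/-- If `f` intertwines the adjoint action of `x` and `x'`, so does its extension. -/
theorem symMap_adDer {f : L →ₗ[ℂ] L'} {x : L} {x' : L'} (h : ∀ y, f ⁅x, y⁆ = ⁅x', f y⁆)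
    (F : SymmetricAlgebra ℂ L) : symMap f (adDer x F) = adDer x' (symMap f F) :=
  map_derivation (fun y => by simp [adDer_ι, h]) F

/-- With `F` fixed, both sides are derivations in `G`, so generators suffice; there the bracket is
the adjoint action on `F`. -/
theorem symMap_ham (f : L →ₗ⁅ℂ⁆ L') (F G : SymmetricAlgebra ℂ L) :
    symMap (f : L →ₗ[ℂ] L') (ham F G) =
      ham (symMap (f : L →ₗ[ℂ] L') F) (symMap (f : L →ₗ[ℂ] L') G) :=
  map_derivation (fun y => by
    rw [ham_ι, map_neg, symMap_adDer (x' := f y) (fun z => f.map_lie y z), symMap_ι, ham_ι]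
    rfl) G

end SymMaps

/-! ## Linear constraints -/

section LinearConstraints

variable {L : Type*} [LieRing L] [LieAlgebra ℂ L]

/-- The family `φ` consists of the constraints `x = χ x` for `x` in a basis of `V`. -/
def IsLinearConstraint (V : Submodule ℂ L) (χ : L →ₗ[ℂ] ℂ) {ι : Type*}
    (φ : ι → SymmetricAlgebra ℂ L) : Prop :=
  ∃ x : ι → L, LinearIndependent ℂ x ∧ Submodule.span ℂ (Set.range x) = V ∧
    ∀ i, φ i = SymmetricAlgebra.ι ℂ L (x i) - algebraMap ℂ _ (χ (x i))

variable {V : Submodule ℂ L} {χ : L →ₗ[ℂ] ℂ} {ι : Type*} {φ : ι → SymmetricAlgebra ℂ L}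

/-- The condition `x = χ x` is linear in `x`, so the ideal depends only on `V` and `χ`. The
arbitrary basis chosen in `wConstraint` thereby becomes harmless. -/
theorem IsLinearConstraint.mem (h : IsLinearConstraint V χ φ) {x : L} (hx : x ∈ V) :
    SymmetricAlgebra.ι ℂ L x - algebraMap ℂ _ (χ x) ∈ constraintIdeal φ := by
  obtain ⟨b, -, hb, hφ⟩ := h
  rw [← hb] at hx
  induction hx using Submodule.span_induction with
  | mem x hx =>
    obtain ⟨i, rfl⟩ := hx
    rw [← hφ]
    exact Ideal.subset_span ⟨i, rfl⟩
  | zero => simp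
  | add x y _ _ hx hy =>
    convert add_mem hx hy using 1
    simp only [map_add]; ring
  | smul c x _ hx =>
    convert Ideal.mul_mem_left _ (algebraMap ℂ _ c) hx using 1
    rw [← Algebra.smul_def, smul_sub, map_smul, map_smul, smul_eq_mul, map_mul, Algebra.smul_def,
      Algebra.smul_def]

theorem IsLinearConstraint.impose_eq (h : IsLinearConstraint V χ φ) {x : L} (hx : x ∈ V) :
    impose φ (SymmetricAlgebra.ι ℂ L x) = algebraMap ℂ _ (χ x) := by
  rw [← AlgHom.commutes (impose φ), impose_eq_iff]
  exact h.mem hx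

/-- An algebra homomorphism that respects linear constraints vanishes on the ideal they generate. -/
theorem IsLinearConstraint.le_ker (h : IsLinearConstraint V χ φ) {B : Type*} [CommRing B]
    [Algebra ℂ B] (π : SymmetricAlgebra ℂ L →ₐ[ℂ] B)
    (hπ : ∀ x ∈ V, π (SymmetricAlgebra.ι ℂ L x) = algebraMap ℂ B (χ x)) :
    ∀ a ∈ constraintIdeal φ, π a = 0 := by
  obtain ⟨b, -, hb, hφ⟩ := h
  suffices constraintIdeal φ ≤ RingHom.ker π from fun a ha => this ha
  refine Ideal.span_le.2 ?_
  rintro _ ⟨i, rfl⟩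
  have : b i ∈ V := hb ▸ Submodule.subset_span ⟨i, rfl⟩
  change π (φ i) = 0
  rw [hφ, map_sub, hπ _ this, AlgHom.commutes, sub_self]

theorem IsLinearConstraint.of_eq (h : IsLinearConstraint V χ φ) {V' : Submodule ℂ L}
    (hV : V = V') : IsLinearConstraint V' χ φ := hV ▸ h

/-- Homomorphisms from a reduced symmetric algebra are determined by their values on generators. -/
theorem reduced_algHom_ext {B : Type*} [CommRing B] [Algebra ℂ B] {f g : Reduced φ →ₐ[ℂ] B}
    (h : ∀ x, f (impose φ (SymmetricAlgebra.ι ℂ L x)) = g (impose φ (SymmetricAlgebra.ι ℂ L x)))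
    (a : Reduced φ) : f a = g a := by
  obtain ⟨F, rfl⟩ := Ideal.Quotient.mkₐ_surjective ℂ (constraintIdeal φ) a
  induction F using SymmetricAlgebra.induction with
  | algebraMap r => rw [AlgHom.commutes, AlgHom.commutes, AlgHom.commutes]
  | ι x => exact h x
  | mul a b ha hb => rw [map_mul, map_mul, map_mul, ha, hb]
  | add a b ha hb => rw [map_add, map_add, map_add, ha, hb]

end LinearConstraints

/-! ## Linear constraints that are second class -/

section GoodGrading

variable {L L' : Type*} [LieRing L] [LieAlgebra ℂ L] [LieRing L'] [LieAlgebra ℂ L']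

/-- A grading `g` of the Lie algebra `L` that makes the constraints `x = χ x`, `x ∈ V`, second
class: `V` is a graded subspace that contains all elements of negative degree, `χ` vanishes in
degrees below `-1`, and `χ [x, y]` pairs the degrees `m` and `-1 - m` of `V`. -/
structure IsGoodGrading (V : Submodule ℂ L) (χ : L →ₗ[ℂ] ℂ) (g : ℤ → Submodule ℂ L) : Prop where
  exists_bound : ∃ K : ℤ, ∀ m, (m < -K ∨ K ≤ m) → g m ⊓ V = ⊥
  le_iSup : V ≤ ⨆ m, g m ⊓ V
  lie_mem : ∀ {m n x y}, x ∈ g m → y ∈ g n → ⁅x, y⁆ ∈ g (m + n)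
  neg_le : ∀ m < 0, g m ≤ V
  chi_eq_zero : ∀ m < -1, ∀ x ∈ g m, χ x = 0
  nondeg : ∀ m, ∀ y ∈ g m ⊓ V, (∀ x ∈ g (-1 - m) ⊓ V, χ ⁅x, y⁆ = 0) → y = 0

/-- Agreement of the functionals on `V` is enough: the axioms evaluate `χ` in negative degrees only,
and these lie in `V`. -/
theorem IsGoodGrading.map {V : Submodule ℂ L} {χ : L →ₗ[ℂ] ℂ} {g : ℤ → Submodule ℂ L}
    (h : IsGoodGrading V χ g) (Φ : L ≃ₗ⁅ℂ⁆ L') {χ' : L' →ₗ[ℂ] ℂ} (hχ : ∀ x ∈ V, χ' (Φ x) = χ x) :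
    IsGoodGrading (V.map (Φ : L →ₗ[ℂ] L')) χ' fun m => (g m).map (Φ : L →ₗ[ℂ] L') := by
  have inf : ∀ m, (g m).map (Φ : L →ₗ[ℂ] L') ⊓ V.map (Φ : L →ₗ[ℂ] L') =
      (g m ⊓ V).map (Φ : L →ₗ[ℂ] L') := fun m =>
    (Submodule.map_inf (Φ : L →ₗ[ℂ] L') Φ.injective).symm
  refine ⟨?_, ?_, ?_, ?_, ?_, ?_⟩
  · obtain ⟨K, hK⟩ := h.exists_bound
    refine ⟨K, fun m hm => ?_⟩
    rw [inf, hK m hm, Submodule.map_bot]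
  · simp only [inf, ← Submodule.map_iSup]
    exact Submodule.map_mono h.le_iSup
  · rintro m n _ _ ⟨x, hx, rfl⟩ ⟨y, hy, rfl⟩
    exact ⟨⁅x, y⁆, h.lie_mem hx hy, Φ.map_lie x y⟩
  · exact fun m hm => Submodule.map_mono (h.neg_le m hm)
  · rintro m hm _ ⟨x, hx, rfl⟩
    exact (hχ x (h.neg_le m (by omega) hx)).trans (h.chi_eq_zero m hm x hx)
  · intro m y hy hxy
    rw [inf] at hy
    obtain ⟨y, hy, rfl⟩ := hy
    have : y = 0 := by
      refine h.nondeg m y hy fun x hx => ?_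
      have h1 := hxy (Φ x) (by rw [inf]; exact ⟨x, hx, rfl⟩)
      have h2 : ⁅x, y⁆ ∈ V := h.neg_le (-1 - m + m) (by omega) (h.lie_mem hx.1 hy.1)
      rw [← hχ _ h2, Φ.map_lie]
      exact h1
    rw [this, map_zero]

/-- Vectors dual to a basis of a homogeneous component of `V`. -/
theorem IsGoodGrading.exists_dual [FiniteDimensional ℂ L] {V : Submodule ℂ L} {χ : L →ₗ[ℂ] ℂ}
    {g : ℤ → Submodule ℂ L} (h : IsGoodGrading V χ g) (m : ℤ) {κ : Type*} [Finite κ]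
    (w : Module.Basis κ ℂ ↥(g m ⊓ V)) (i : κ) :
    ∃ x ∈ g (-1 - m) ⊓ V, ∀ y : ↥(g m ⊓ V), χ ⁅x, (y : L)⁆ = w.repr y i := by
  let B : ↥(g (-1 - m) ⊓ V) →ₗ[ℂ] ↥(g m ⊓ V) →ₗ[ℂ] ℂ :=
    LinearMap.mk₂ ℂ (fun x y => χ ⁅(x : L), (y : L)⁆) (by simp) (by simp) (by simp) (by simp)
  have hB : Function.Surjective B := by
    -- In finite dimension, surjectivity onto the dual space is injectivity of the flipped pairing,
    -- which is `nondeg`.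
    rw [← LinearMap.flip_injective_iff₁, injective_iff_map_eq_zero]
    intro y hy
    refine Subtype.ext (h.nondeg m y y.2 fun x hx => ?_)
    exact congrArg (fun l : ↥(g (-1 - m) ⊓ V) →ₗ[ℂ] ℂ => l ⟨x, hx⟩) hy
  obtain ⟨x, hx⟩ := hB (w.coord i)
  exact ⟨x, x.2, fun y => congrArg (fun l : ↥(g m ⊓ V) →ₗ[ℂ] ℂ => l y) hx⟩

/-- Linear constraints with a good grading are second class. -/
theorem IsGoodGrading.isSecondClass [FiniteDimensional ℂ L] {V : Submodule ℂ L} {χ : L →ₗ[ℂ] ℂ}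
    {g : ℤ → Submodule ℂ L} (h : IsGoodGrading V χ g) {ι : Type*} [Fintype ι] [DecidableEq ι]
    {φ : ι → SymmetricAlgebra ℂ L} (hφ : IsLinearConstraint V χ φ) :
    IsSecondClass (liePoisson L) φ := by
  have hφ' := hφ
  obtain ⟨b, hb, hV, hbφ⟩ := hφ'
  set ω : L → L → Reduced φ := fun x y => impose φ (SymmetricAlgebra.ι ℂ L ⁅x, y⁆) with hω
  have hωs : ∀ (s : Finset ι) (a : ι → ℂ) (y : L),
      ω (∑ α ∈ s, a α • b α) y = ∑ α ∈ s, algebraMap ℂ _ (a α) * ω (b α) y := by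
    intro s a y
    simp only [hω, sum_lie, smul_lie, map_sum, map_smul, ← Algebra.smul_def]
  -- the functionals on `V` of the form `∑ c α * ω (b α) ·`
  have key : ∀ (K : ℤ) (_ : ∀ m, (m < -K ∨ K ≤ m) → g m ⊓ V = ⊥) (d : ℕ) (k : ℤ) (_ : K ≤ k + d)
      (l : L →ₗ[ℂ] Reduced φ) (_ : ∀ m < k, ∀ y ∈ g m ⊓ V, l y = 0),
      ∃ c : ι → Reduced φ, ∀ y ∈ V, ∑ α, c α * ω (b α) y = l y := by
    intro K hK d
    -- Block elimination from the lowest degree upwards: `l` already vanishes below degree `k`, and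
    -- `d` bounds the number of degrees left before `g m ⊓ V` becomes zero.
    induction d with
    | zero =>
      intro k hk l hl
      refine ⟨0, fun y hy => ?_⟩
      have hle : ⨆ m, g m ⊓ V ≤ LinearMap.ker l := by
        refine iSup_le fun m y hy => ?_
        by_cases hm : m < k
        · exact hl m hm y hy
        · rw [hK m (by right; push_cast at hk; omega)] at hy
          rw [(Submodule.mem_bot ℂ).1 hy]
          exact Submodule.zero_mem _
      have : l y = 0 := hle (h.le_iSup hy)
      simp [this]
    | succ d ih =>
      intro k hk l hl
      let w := Module.finBasis ℂ ↥(g k ⊓ V)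
      choose v hv hvw using h.exists_dual k w
      have hva : ∀ i, ∃ a : ι → ℂ, ∑ α, a α • b α = v i := fun i => by
        rw [← Submodule.mem_span_range_iff_exists_fun, hV]
        exact (hv i).2
      choose a ha using hva
      -- The `v i` have degree `-1 - k` and are dual to the basis `w` of degree `k`, so this
      -- correction removes the degree `k` part of `l`.
      let l' : L →ₗ[ℂ] Reduced φ := l - ∑ i, LinearMap.mulLeft ℂ (l (w i)) ∘ₗ
        (impose φ).toLinearMap ∘ₗ SymmetricAlgebra.ι ℂ L ∘ₗ (LieAlgebra.ad ℂ L (v i) : L →ₗ[ℂ] L)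
      have hl' : ∀ y, l' y = l y - ∑ i, l (w i) * ω (v i) y := by
        intro y
        simp [l', hω, LinearMap.sum_apply]
      obtain ⟨c, hc⟩ := ih (k + 1) (by push_cast at hk ⊢; omega) l' (by
        intro m hm y hy
        rw [hl']
        rcases (Int.lt_add_one_iff.1 hm).lt_or_eq with hm | rfl
        -- Below degree `k` the correction is invisible: `⁅v i, y⁆` has degree less than `-1`, where
        -- elements are constrained to zero.
        · rw [hl m hm y hy, zero_sub, neg_eq_zero]
          refine Finset.sum_eq_zero fun i _ => ?_
          have h1 := h.lie_mem (hv i).1 hy.1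
          simp only [hω]
          rw [hφ.impose_eq (h.neg_le _ (by omega) h1), h.chi_eq_zero _ (by omega) _ h1, map_zero,
            mul_zero]
        -- In degree `k` itself `⁅v i, y⁆` has degree `-1` and is constrained to a number, the
        -- coordinate of `y` along `w i`.
        · rw [sub_eq_zero]
          have h1 : ∀ i, ω (v i) y = algebraMap ℂ _ (w.repr ⟨y, hy⟩ i) := fun i => by
            have h2 := h.lie_mem (hv i).1 hy.1
            simp only [hω]
            rw [hφ.impose_eq (h.neg_le _ (by omega) h2), ← hvw i ⟨y, hy⟩]
          have h3 := congrArg (fun z : ↥(g m ⊓ V) => l z) (w.sum_repr ⟨y, hy⟩)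
          simp only [Submodule.coe_sum, Submodule.coe_smul, map_sum, map_smul] at h3
          rw [← h3]
          refine Finset.sum_congr rfl fun i _ => ?_
          rw [h1, Algebra.smul_def, mul_comm])
      refine ⟨fun α => c α + ∑ i, l (w i) * algebraMap ℂ _ (a i α), fun y hy => ?_⟩
      simp only [add_mul, Finset.sum_add_distrib, hc y hy, hl', Finset.sum_mul]
      rw [Finset.sum_comm, sub_add_eq_add_sub, add_sub_assoc, add_eq_left, sub_eq_zero]
      refine Finset.sum_congr rfl fun i _ => ?_
      rw [← ha i, hωs, Finset.mul_sum]
      exact Finset.sum_congr rfl fun α _ => mul_assoc _ _ _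
  obtain ⟨K, hK⟩ := h.exists_bound
  have hinv : ∀ β, ∃ c : ι → Reduced φ, ∀ γ, ∑ α, c α * ω (b α) (b γ) = if β = γ then 1 else 0 := by
    intro β
    obtain ⟨f, hf⟩ := (Module.Basis.span hb).coord β |>.exists_extend
    -- Applied to the coordinate functional of `b β`, extended from `V` to `L`, this gives row `β`
    -- of a left inverse. Below degree `-K` nothing has to be checked, and `2 * K` steps reach the
    -- upper bound.
    obtain ⟨c, hc⟩ := key K hK (2 * K).toNat (-K) (by omega) ((Algebra.linearMap ℂ _) ∘ₗ f) (by
      intro m hm y hy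
      rw [hK m (Or.inl hm)] at hy
      rw [(Submodule.mem_bot ℂ).1 hy, map_zero])
    refine ⟨c, fun γ => ?_⟩
    rw [hc _ (hV ▸ Submodule.subset_span ⟨γ, rfl⟩)]
    have h1 : f (b γ) = (Module.Basis.span hb).coord β (Module.Basis.span hb γ) := by
      rw [← hf, LinearMap.comp_apply, Submodule.subtype_apply, Module.Basis.coe_span_apply]
    rw [Module.Basis.coord_apply, Module.Basis.repr_self] at h1
    rw [LinearMap.comp_apply, h1, Finsupp.single_apply]
    by_cases hβ : β = γ
    · simp [hβ]
    · simp [hβ, Ne.symm hβ]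
  choose c hc using hinv
  have hC : ∀ α γ, constraintMatrix (liePoisson L) φ α γ = ω (b α) (b γ) := by
    intro α γ
    simp only [constraintMatrix, Matrix.of_apply, hbφ, map_sub, LinearMap.sub_apply, hω,
      liePoisson_ι]
    have h0 : ∀ (r : ℂ) (F : SymmetricAlgebra ℂ L), (liePoisson L).br F (algebraMap ℂ _ r) = 0 :=
      fun r F => by simp [liePoisson_br]
    rw [h0, h0, (liePoisson L).skew (algebraMap ℂ _ _), h0]
    simp
  have hinv : Matrix.of c * constraintMatrix (liePoisson L) φ = 1 := by
    ext β γ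
    simp only [Matrix.mul_apply, Matrix.of_apply, hC, hc, Matrix.one_apply]
  exact ⟨⟨_, Matrix.of c, mul_eq_one_comm.1 hinv, hinv⟩, rfl⟩

end GoodGrading

/-! ## Matrices graded by an integer weight of the indices -/

section Offset

variable {n : Type*} (w : n → ℤ)

/-- The matrices with entries only at places `(u, v)` with `w v - w u = d`. -/
def offset (d : ℤ) : Submodule ℂ (Matrix n n ℂ) where
  carrier := {X | ∀ u v, w v - w u ≠ d → X u v = 0}
  add_mem' {X Y} hX hY u v h := by simp [hX u v h, hY u v h]
  zero_mem' _ _ _ := rfl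
  smul_mem' c X hX u v h := by simp [hX u v h]

/-- The projection to `offset w d`. -/
def offsetProj (d : ℤ) : Matrix n n ℂ →ₗ[ℂ] Matrix n n ℂ where
  toFun X := Matrix.of fun u v => if w v - w u = d then X u v else 0
  map_add' X Y := by ext u v; by_cases h : w v - w u = d <;> simp [h]
  map_smul' c X := by ext u v; by_cases h : w v - w u = d <;> simp [h]

variable {w}

theorem offsetProj_apply (d : ℤ) (X : Matrix n n ℂ) (u v : n) :
    offsetProj w d X u v = if w v - w u = d then X u v else 0 := rfl

theorem offsetProj_mem (d : ℤ) (X : Matrix n n ℂ) : offsetProj w d X ∈ offset w d :=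
  fun _ _ h => if_neg h

theorem offsetProj_of_mem {d : ℤ} {X : Matrix n n ℂ} (h : X ∈ offset w d) :
    offsetProj w d X = X := by
  ext u v
  by_cases hd : w v - w u = d
  · simp [offsetProj_apply, hd]
  · simp [offsetProj_apply, hd, h u v hd]

theorem offsetProj_of_mem_ne {d d' : ℤ} {X : Matrix n n ℂ} (h : X ∈ offset w d) (hd : d ≠ d') :
    offsetProj w d' X = 0 := by
  ext u v
  rw [offsetProj_apply]
  split_ifs with h1
  · exact h u v (by omega)
  · rfl

theorem offset_eq_zero {d : ℤ} {X : Matrix n n ℂ} (h : X ∈ offset w d)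
    (hd : ∀ u v, w v - w u ≠ d) : X = 0 := by
  ext u v
  exact h u v (hd u v)

theorem sum_offsetProj {s : Finset ℤ} (hs : ∀ u v, w v - w u ∈ s) (X : Matrix n n ℂ) :
    ∑ d ∈ s, offsetProj w d X = X := by
  ext u v
  simp [Matrix.sum_apply, offsetProj_apply, hs u v]

variable [Fintype n]

theorem mul_mem_offset {d d' : ℤ} {X Y : Matrix n n ℂ} (hX : X ∈ offset w d)
    (hY : Y ∈ offset w d') : X * Y ∈ offset w (d + d') := by
  intro u v h
  rw [Matrix.mul_apply]
  refine Finset.sum_eq_zero fun i _ => ?_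
  by_cases h1 : w i - w u = d
  · rw [hY i v (by omega), mul_zero]
  · rw [hX u i h1, zero_mul]

theorem lie_mem_offset {d d' : ℤ} {X Y : Matrix n n ℂ} (hX : X ∈ offset w d)
    (hY : Y ∈ offset w d') : ⁅X, Y⁆ ∈ offset w (d + d') := by
  rw [Ring.lie_def]
  exact sub_mem (mul_mem_offset hX hY) (add_comm d d' ▸ mul_mem_offset hY hX)

theorem trace_offset {d : ℤ} {X : Matrix n n ℂ} (hX : X ∈ offset w d) (hd : d ≠ 0) :
    X.trace = 0 :=
  Finset.sum_eq_zero fun u _ => hX u u (by rw [sub_self]; exact hd.symm)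

/-- Matrices of complementary degrees suffice to detect zero with the trace form. -/
theorem trace_mul_offsetProj {d : ℤ} {X : Matrix n n ℂ} (hX : X ∈ offset w d)
    (Y : Matrix n n ℂ) : (X * offsetProj w (-d) Y).trace = (X * Y).trace := by
  simp only [Matrix.trace, Matrix.diag_apply, Matrix.mul_apply]
  refine Finset.sum_congr rfl fun u _ => Finset.sum_congr rfl fun v _ => ?_
  rw [offsetProj_apply]
  split_ifs with h
  · rfl
  · rw [hX u v (by omega), zero_mul, zero_mul]

theorem trace_lie_mul (X Y Z : Matrix n n ℂ) : (⁅X, Y⁆ * Z).trace = (X * ⁅Y, Z⁆).trace := by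
  rw [Ring.lie_def, Ring.lie_def, sub_mul, mul_sub, Matrix.trace_sub, Matrix.trace_sub,
    mul_assoc, mul_assoc, Matrix.trace_mul_comm Y, mul_assoc]

end Offset

/-! ## The principal `sl(2)` in `gl(p)` -/

section PrincipalSl2

variable {p : ℕ}

/-- The weight of an index of a `p × p` matrix. -/
def finWeight (k : Fin p) : ℤ := (k : ℕ)

/-- The iterated commutators `(ad e_-)^t (e_+^j)`. -/
def string (p j t : ℕ) : Matrix (Fin p) (Fin p) ℂ := (fun X => ⁅eMinus p, X⁆)^[t] (ePlus p ^ j)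

theorem M_eq_string (j : ℕ) (m : ℤ) : M p j m = string p j ((j : ℤ) - m).toNat := rfl

theorem string_zero (j : ℕ) : string p j 0 = ePlus p ^ j := rfl

theorem lie_eMinus_string (j t : ℕ) : ⁅eMinus p, string p j t⁆ = string p j (t + 1) :=
  (Function.iterate_succ_apply' _ _ _).symm

theorem eMinus_mem_offset : eMinus p ∈ offset finWeight (-1) := by
  intro k l h
  rw [eMinus, Matrix.of_apply, if_neg]
  intro h'
  simp only [finWeight] at h
  omega

theorem ePlus_mem_offset : ePlus p ∈ offset finWeight 1 := by
  intro k l h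
  rw [ePlus, Matrix.of_apply, if_neg]
  intro h'
  simp only [finWeight] at h
  omega

theorem ePlus_pow_mem_offset (j : ℕ) : ePlus p ^ j ∈ offset finWeight j := by
  induction j with
  | zero =>
    intro k l h
    rw [pow_zero, Matrix.one_apply_ne]
    rintro rfl
    simp at h
  | succ j ih =>
    rw [pow_succ, Nat.cast_succ]
    exact mul_mem_offset ih ePlus_mem_offset

theorem string_mem_offset (j t : ℕ) : string p j t ∈ offset finWeight (j - t : ℤ) := by
  induction t with
  | zero => simpa [string_zero] using ePlus_pow_mem_offset j
  | succ t ih =>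
    rw [← lie_eMinus_string]
    convert lie_mem_offset eMinus_mem_offset ih using 1
    push_cast; ring_nf

/-- The semisimple element of the principal `sl(2)`. -/
def hDiag (p : ℕ) : Matrix (Fin p) (Fin p) ℂ := Matrix.diagonal fun k => (p : ℂ) - 2 * (k : ℕ) - 1

theorem ePlus_mul_eMinus_apply (k l : Fin p) :
    (ePlus p * eMinus p) k l = if k = l then ((k : ℕ) + 1 : ℂ) * (p - (k : ℕ) - 1) else 0 := by
  rw [Matrix.mul_apply]
  by_cases hk : (k : ℕ) + 1 < p
  · rw [Finset.sum_eq_single ⟨(k : ℕ) + 1, hk⟩]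
    · simp [ePlus, eMinus, Fin.ext_iff]
    · intro i _ hi
      rw [ePlus, Matrix.of_apply, if_neg, zero_mul]
      intro h
      exact hi (Fin.ext h)
    · simp
  · have hp : (p : ℂ) = (k : ℕ) + 1 := by
      have := k.2
      exact_mod_cast (by omega : p = (k : ℕ) + 1)
    rw [hp, Finset.sum_eq_zero]
    · simp
    · intro i _
      rw [ePlus, Matrix.of_apply, if_neg, zero_mul]
      have := i.2
      omega

theorem eMinus_mul_ePlus_apply (k l : Fin p) :
    (eMinus p * ePlus p) k l = if k = l then (k : ℂ) * (p - (k : ℕ)) else 0 := by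
  rw [Matrix.mul_apply]
  obtain ⟨k, hk⟩ := k
  cases k with
  | zero =>
    rw [Finset.sum_eq_zero]
    · simp
    · intro i _
      simp [eMinus]
  | succ k =>
    rw [Finset.sum_eq_single ⟨k, by omega⟩]
    · simp only [eMinus, ePlus, Matrix.of_apply, if_true, one_mul, Fin.ext_iff, eq_comm]
      split_ifs
      · push_cast; ring
      · rfl
    · intro i _ hi
      rw [eMinus, Matrix.of_apply, if_neg, zero_mul]
      intro h
      exact hi (Fin.ext (by simpa using h.symm))
    · simp

theorem lie_ePlus_eMinus : ⁅ePlus p, eMinus p⁆ = hDiag p := by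
  ext k l
  rw [Ring.lie_def, Matrix.sub_apply, ePlus_mul_eMinus_apply, eMinus_mul_ePlus_apply, hDiag,
    Matrix.diagonal_apply]
  split_ifs
  · ring
  · simp

theorem lie_hDiag {d : ℤ} {X : Matrix (Fin p) (Fin p) ℂ} (hX : X ∈ offset finWeight d) :
    ⁅hDiag p, X⁆ = (2 * d : ℂ) • X := by
  ext k l
  rw [Ring.lie_def, Matrix.sub_apply, hDiag, Matrix.diagonal_mul, Matrix.mul_diagonal,
    Matrix.smul_apply, smul_eq_mul]
  by_cases h : finWeight l - finWeight k = d
  · rw [← h]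
    simp only [finWeight]
    push_cast; ring
  · rw [hX k l h]; simp

/-- Since `e_+ ^ j` commutes with `e_+`, it is a highest weight vector of weight `2 j`. The
coefficient is the sum of the weights `2 (j - s)` for `0 ≤ s ≤ t`. -/
theorem lie_ePlus_string_succ (j t : ℕ) :
    ⁅ePlus p, string p j (t + 1)⁆ = (((t : ℂ) + 1) * (2 * j - t)) • string p j t := by
  induction t with
  | zero =>
    have h0 : ⁅ePlus p, string p j 0⁆ = 0 := by
      rw [string_zero, Ring.lie_def, (Commute.self_pow (ePlus p) j).eq, sub_self]
    rw [← lie_eMinus_string, leibniz_lie, h0, lie_zero, lie_ePlus_eMinus,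
      lie_hDiag (string_mem_offset j 0)]
    simp
  | succ t ih =>
    rw [← lie_eMinus_string, leibniz_lie, ih, lie_ePlus_eMinus, lie_smul, lie_eMinus_string,
      lie_hDiag (string_mem_offset j (t + 1)), ← add_smul]
    congr 1
    push_cast; ring

/-- The strings consist of eigenvectors of `ad e_- ∘ ad e_+`. -/
theorem lie_lie_string (j t : ℕ) :
    ⁅eMinus p, ⁅ePlus p, string p j t⁆⁆ = ((t : ℂ) * (2 * j + 1 - t)) • string p j t := by
  cases t with
  | zero =>
    rw [string_zero, Ring.lie_def (ePlus p), (Commute.self_pow (ePlus p) j).eq, sub_self]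
    simp
  | succ t =>
    rw [lie_ePlus_string_succ, lie_smul, lie_eMinus_string]
    congr 1
    push_cast; ring

/-- Far enough down the string leaves the range of degrees of a `p × p` matrix. Going back up, the
ladder coefficient `(s + 1) (2 j - s)` is nonzero for `s > 2 j`, so vanishing propagates. -/
theorem string_eq_zero {j t : ℕ} (ht : 2 * j < t) : string p j t = 0 := by
  have key : ∀ d s : ℕ, 2 * j < s → j + p ≤ s + d → string p j s = 0 := by
    intro d
    induction d with
    | zero =>
      intro s _ hs
      refine offset_eq_zero (string_mem_offset j s) fun u v => ?_
      have := u.2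
      simp only [finWeight]
      omega
    | succ d ih =>
      intro s hs hd
      have h := lie_ePlus_string_succ (p := p) j s
      rw [ih (s + 1) (by omega) (by omega), lie_zero] at h
      refine (smul_eq_zero.1 h.symm).resolve_left (mul_ne_zero (by exact_mod_cast s.succ_ne_zero)
        (sub_ne_zero.2 ?_))
      exact_mod_cast hs.ne
  exact key (j + p) t ht (by omega)

theorem ePlus_pow_apply_ne_zero (j : ℕ) (k l : Fin p) (h : (l : ℕ) = k + j) :
    (ePlus p ^ j) k l ≠ 0 := by
  induction j generalizing k with
  | zero =>
    have : k = l := Fin.ext h.symm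
    simp [this]
  | succ j ih =>
    have hk : (k : ℕ) + 1 < p := by have := l.2; omega
    rw [pow_succ', Matrix.mul_apply, Finset.sum_eq_single ⟨(k : ℕ) + 1, hk⟩]
    · refine mul_ne_zero ?_ (ih _ (by simp only; omega))
      rw [ePlus, Matrix.of_apply, if_pos rfl]
      refine mul_ne_zero (by exact_mod_cast (k : ℕ).succ_ne_zero) ?_
      rw [sub_sub, sub_ne_zero]
      exact_mod_cast hk.ne'
    · intro i _ hi
      rw [ePlus, Matrix.of_apply, if_neg, zero_mul]
      intro h
      exact hi (Fin.ext h)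
    · simp

theorem string_ne_zero {j t : ℕ} (hj : j < p) (ht : t ≤ 2 * j) : string p j t ≠ 0 := by
  induction t with
  | zero =>
    intro h
    exact ePlus_pow_apply_ne_zero j ⟨0, by omega⟩ ⟨j, hj⟩ (by simp)
      (by rw [← string_zero, h]; rfl)
  | succ t ih =>
    intro h
    have h1 := lie_ePlus_string_succ (p := p) j t
    rw [h, lie_zero] at h1
    refine ih (by omega) ((smul_eq_zero.1 h1.symm).resolve_left
      (mul_ne_zero (by exact_mod_cast t.succ_ne_zero) (sub_ne_zero.2 ?_)))
    exact_mod_cast (show 2 * j ≠ t by omega)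

/-- The labels `(j, t)`, `j < p`, `t ≤ 2 j`, of the elements of the strings. -/
abbrev SIdx (p : ℕ) : Type := Σ j : Fin p, Fin (2 * (j : ℕ) + 1)

/-- The strings are eigenvectors of one operator with distinct eigenvalues. `T` is the Casimir
operator, with eigenvalue `j (j + 1)`, plus `ad h / 2`, with eigenvalue `j - t`. The sum `(j + 1)^2
- 1 - t` runs through the integers from `j^2` to `j^2 + 2 j`, and these intervals are disjoint for
different `j`. -/
theorem linearIndependent_string :
    LinearIndependent ℂ fun s : SIdx p => string p (s.1 : ℕ) (s.2 : ℕ) := by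
  let T : Module.End ℂ (Matrix (Fin p) (Fin p) ℂ) :=
    (LieAlgebra.ad ℂ _ (eMinus p) : Module.End ℂ (Matrix (Fin p) (Fin p) ℂ)) *
      (LieAlgebra.ad ℂ _ (ePlus p) : Module.End ℂ (Matrix (Fin p) (Fin p) ℂ)) +
    (1 / 4 : ℂ) • (LieAlgebra.ad ℂ _ (hDiag p) : Module.End ℂ (Matrix (Fin p) (Fin p) ℂ)) ^ 2 +
    (LieAlgebra.ad ℂ _ (hDiag p) : Module.End ℂ (Matrix (Fin p) (Fin p) ℂ))
  refine T.eigenvectors_linearIndependent'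
    (fun s : SIdx p => (((s.1 : ℕ) + 1) ^ 2 - 1 - (s.2 : ℕ) : ℂ)) ?_ _ fun s => ?_
  · rintro ⟨⟨j, hj⟩, ⟨t, ht⟩⟩ ⟨⟨j', hj'⟩, ⟨t', ht'⟩⟩ h
    simp only at ht ht'
    have h1 : ((j + 1) ^ 2 + t' : ℂ) = (j' + 1) ^ 2 + t := by linear_combination h
    have h2 : (j + 1) ^ 2 + t' = (j' + 1) ^ 2 + t := by exact_mod_cast h1
    have h3 : j = j' := by
      rcases lt_trichotomy j j' with h | h | h
      · nlinarith
      · exact h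
      · nlinarith
    subst h3
    have h4 : t = t' := by omega
    subst h4
    rfl
  · rw [Module.End.hasEigenvector_iff]
    refine ⟨?_, string_ne_zero s.1.2 (by have := s.2.2; omega)⟩
    rw [Module.End.mem_eigenspace_iff]
    change ⁅eMinus p, ⁅ePlus p, string p _ _⁆⁆ + (1 / 4 : ℂ) • ⁅hDiag p, ⁅hDiag p, string p _ _⁆⁆ +
      ⁅hDiag p, string p _ _⁆ = _
    rw [lie_lie_string, lie_hDiag (string_mem_offset _ _), lie_smul,
      lie_hDiag (string_mem_offset _ _), smul_smul, smul_smul, ← add_smul, ← add_smul]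
    congr 1
    push_cast; ring

/-! ### The trace form on the strings -/

theorem trace_mul_string (X : Matrix (Fin p) (Fin p) ℂ) (Y : Matrix (Fin p) (Fin p) ℂ) (t : ℕ) :
    (X * (fun Z => ⁅eMinus p, Z⁆)^[t] Y).trace =
      (-1) ^ t * ((fun Z => ⁅eMinus p, Z⁆)^[t] X * Y).trace := by
  induction t generalizing Y with
  | zero => simp
  | succ t ih =>
    rw [Function.iterate_succ_apply, ih, Function.iterate_succ_apply', ← trace_lie_mul,
      ← lie_skew, neg_mul, Matrix.trace_neg, pow_succ]
    ring

theorem trace_ePlus_mul_eMinus :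
    (ePlus p * eMinus p).trace = ((p : ℂ) ^ 3 - p) / 6 := by
  have h : ∀ n : ℕ, ∑ k ∈ Finset.range n, ((k : ℂ) + 1) * (p - k - 1) =
      n * (n + 1) * (3 * p - 2 * n - 1) / 6 := by
    intro n
    induction n with
    | zero => simp
    | succ n ih => rw [Finset.sum_range_succ, ih]; push_cast; ring
  simp only [Matrix.trace, Matrix.diag_apply, ePlus_mul_eMinus_apply, if_true]
  rw [Fin.sum_univ_eq_sum_range (fun k : ℕ => ((k : ℂ) + 1) * (p - k - 1)) p, h]
  ring

/-- By degree only `t = j + 1` can contribute. For `j = 1` the string element is `-2 e_-`; for `j ≥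
2` invariance of the trace moves `(ad e_-)^(j+1)` onto `e_+`, which is already killed by the third
power. -/
theorem trace_ePlus_mul_string {j t : ℕ} (ht : 1 ≤ t) (htj : t ≤ 2 * j) :
    (ePlus p * string p j t).trace = if j = 1 ∧ t = 2 then ((p : ℂ) - p ^ 3) / 3 else 0 := by
  by_cases h : t = j + 1
  · subst h
    rcases Nat.lt_or_ge j 2 with hj | hj
    · obtain rfl : j = 1 := by omega
      have h2 : string p 1 2 = (-2 : ℂ) • eMinus p := by
        rw [← lie_eMinus_string, ← lie_eMinus_string, string_zero, pow_one, ← lie_skew (eMinus p) (ePlus p),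
          lie_ePlus_eMinus, lie_neg, ← lie_skew, neg_neg, lie_hDiag eMinus_mem_offset]
        norm_num
      rw [h2, Matrix.mul_smul, Matrix.trace_smul, trace_ePlus_mul_eMinus, if_pos ⟨rfl, rfl⟩]
      rw [smul_eq_mul]; ring
    · rw [if_neg (by omega), string, trace_mul_string]
      have h1 : (fun Z => ⁅eMinus p, Z⁆)^[j + 1] (ePlus p) = 0 := by
        have := string_eq_zero (p := p) (j := 1) (t := j + 1) (by omega)
        rwa [string, pow_one] at this
      rw [h1]; simp
  · rw [if_neg (by omega)]
    exact trace_offset (mul_mem_offset ePlus_mem_offset (string_mem_offset j t)) (by omega)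

/-- For `p ≤ 1` the denominator in `kappa` is zero, hence so is `kappa p`; the constrained space is
zero there and the normalisation plays no role. -/
theorem kappa_mul (hp : 2 ≤ p) : kappa p * (((p : ℂ) - p ^ 3) / 3) = 1 := by
  have h : (p : ℂ) - p ^ 3 ≠ 0 := by
    rw [sub_ne_zero]
    norm_cast
    intro h
    have : p ^ 1 < p ^ 3 := Nat.pow_lt_pow_right hp (by norm_num)
    rw [pow_one] at this
    omega
  rw [kappa, div_mul_div_comm, mul_comm]
  exact div_self (mul_ne_zero h three_ne_zero)

end PrincipalSl2

/-! ## The strings of `gl(Np)` -/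

section BlockStrings

variable {N p : ℕ}

/-- The weight of an index of a matrix of `gl(Np)`. -/
def blockWeight (u : Fin N × Fin p) : ℤ := (u.2 : ℕ)

variable (N p) in
/-- The element `1 ⊗ e_+` of `gl(Np)`. -/
abbrev blockE : gl N p := 1 ⊗ₖ ePlus p

variable (N p) in
/-- The element `1 ⊗ e_-` of `gl(Np)`. -/
abbrev blockF : gl N p := 1 ⊗ₖ eMinus p

theorem lie_one_kronecker (A : Matrix (Fin N) (Fin N) ℂ) (B X : Matrix (Fin p) (Fin p) ℂ) :
    ⁅(1 ⊗ₖ B : gl N p), A ⊗ₖ X⁆ = A ⊗ₖ ⁅B, X⁆ := by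
  rw [Ring.lie_def, Ring.lie_def, ← Matrix.mul_kronecker_mul, ← Matrix.mul_kronecker_mul,
    Matrix.one_mul, Matrix.mul_one]
  ext u v
  simp [mul_sub]

theorem kronecker_mem_offset (A : Matrix (Fin N) (Fin N) ℂ) {d : ℤ}
    {X : Matrix (Fin p) (Fin p) ℂ} (hX : X ∈ offset finWeight d) :
    (A ⊗ₖ X : gl N p) ∈ offset blockWeight d := fun u v h => by
  rw [Matrix.kroneckerMap_apply, hX u.2 v.2 h, mul_zero]

theorem blockE_mem_offset : blockE N p ∈ offset blockWeight 1 :=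
  kronecker_mem_offset _ ePlus_mem_offset

theorem blockF_mem_offset : blockF N p ∈ offset blockWeight (-1) :=
  kronecker_mem_offset _ eMinus_mem_offset

/-- The elements `E^{ab} ⊗ (ad e_-)^t (e_+^j)` of `gl(Np)`. -/
def blockString (a b : Fin N) (j t : ℕ) : gl N p := Matrix.single a b 1 ⊗ₖ string p j t

theorem J_eq_blockString (a b : Fin N) (j : ℕ) (m : ℤ) :
    J N p a b j m = blockString a b j ((j : ℤ) - m).toNat := rfl

theorem blockString_mem_offset (a b : Fin N) (j t : ℕ) :
    (blockString a b j t : gl N p) ∈ offset blockWeight (j - t : ℤ) :=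
  kronecker_mem_offset _ (string_mem_offset j t)

theorem lie_blockF_blockString (a b : Fin N) (j t : ℕ) :
    ⁅blockF N p, (blockString a b j t : gl N p)⁆ = blockString a b j (t + 1) := by
  rw [blockString, lie_one_kronecker, lie_eMinus_string, blockString]

theorem blockString_eq_zero (a b : Fin N) {j t : ℕ} (ht : 2 * j < t) :
    (blockString a b j t : gl N p) = 0 := by
  rw [blockString, string_eq_zero ht, Matrix.kronecker_zero]

theorem lie_lie_blockString (a b : Fin N) (j t : ℕ) :
    ⁅blockF N p, ⁅blockE N p, blockString a b j t⁆⁆ =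
      ((t : ℂ) * (2 * j + 1 - t)) • (blockString a b j t : gl N p) := by
  rw [blockString, lie_one_kronecker, lie_one_kronecker, lie_lie_string, Matrix.kronecker_smul]

variable (N p) in
/-- The labels of the basis `blockBasis` of `gl(Np)`. -/
abbrev BIdx : Type := (Fin N × Fin N) × SIdx p

theorem linearIndependent_blockString : LinearIndependent ℂ fun s : BIdx N p =>
    (blockString s.1.1 s.1.2 (s.2.1 : ℕ) (s.2.2 : ℕ) : gl N p) := by
  rw [Fintype.linearIndependent_iff]
  rintro c hc ⟨⟨a, b⟩, s⟩
  refine Fintype.linearIndependent_iff.1 (linearIndependent_string (p := p))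
    (fun s => c ((a, b), s)) ?_ s
  ext k l
  have h := congrFun (congrFun hc (a, k)) (b, l)
  rw [Matrix.sum_apply, Fintype.sum_prod_type, Finset.sum_eq_single (a, b)] at h
  · simpa [Matrix.sum_apply, blockString] using h
  · rintro ⟨a', b'⟩ _ hab
    refine Finset.sum_eq_zero fun s _ => ?_
    have : ¬(a' = a ∧ b' = b) := fun h => hab (Prod.ext h.1 h.2)
    simp [blockString, this]
  · simp

theorem card_SIdx : Fintype.card (SIdx p) = p * p := by
  rw [Fintype.card_sigma]
  simp only [Fintype.card_fin]
  rw [Fin.sum_univ_eq_sum_range (fun j : ℕ => 2 * j + 1) p]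
  induction p with
  | zero => rfl
  | succ p ih => rw [Finset.sum_range_succ, ih]; ring

variable (N p) in
/-- The basis of `gl(Np)` that consists of the strings. -/
def blockBasis : Module.Basis (BIdx N p) ℂ (gl N p) :=
  letI b := Module.Basis.mk linearIndependent_blockString
    ((linearIndependent_blockString (N := N) (p := p)).span_eq_top_of_card_eq_finrank' (by
      rw [Module.finrank_matrix, Fintype.card_prod, card_SIdx]
      simp only [Fintype.card_prod, Fintype.card_fin, Module.finrank_self]
      ring)).ge
  b

theorem blockBasis_apply (s : BIdx N p) :
    blockBasis N p s = blockString s.1.1 s.1.2 (s.2.1 : ℕ) (s.2.2 : ℕ) := by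
  simp [blockBasis]

/-- The image of `ad (1 ⊗ e_-)` is spanned by the elements of the strings but the first ones. -/
theorem range_ad_blockF : LinearMap.range (LieAlgebra.ad ℂ (gl N p) (blockF N p) :
      gl N p →ₗ[ℂ] gl N p) =
    Submodule.span ℂ {x | ∃ s : BIdx N p, 1 ≤ (s.2.2 : ℕ) ∧ x = blockBasis N p s} := by
  refine le_antisymm ?_ (Submodule.span_le.2 ?_)
  · rw [LinearMap.range_eq_map, ← (blockBasis N p).span_eq, Submodule.map_span, Submodule.span_le]
    rintro _ ⟨_, ⟨⟨⟨a, b⟩, j, t⟩, rfl⟩, rfl⟩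
    rw [blockBasis_apply]
    change ⁅blockF N p, (blockString a b (j : ℕ) (t : ℕ) : gl N p)⁆ ∈ _
    rw [lie_blockF_blockString]
    by_cases h : (t : ℕ) + 1 < 2 * j + 1
    · refine Submodule.subset_span ⟨⟨(a, b), j, ⟨t + 1, h⟩⟩, Nat.le_add_left 1 t, ?_⟩
      rw [blockBasis_apply]
    · rw [blockString_eq_zero a b (by omega)]
      exact Submodule.zero_mem _
  · rintro _ ⟨⟨⟨a, b⟩, j, t, ht⟩, h1, rfl⟩
    refine ⟨blockString a b (j : ℕ) (t - 1), ?_⟩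
    rw [blockBasis_apply]
    change ⁅blockF N p, _⁆ = blockString a b (j : ℕ) t
    rw [lie_blockF_blockString, Nat.sub_add_cancel h1]

/-- A basis element `E^{ab} ⊗ (ad e_-)^t (e_+^j)` of degree `j - t < 0` has `t ≥ 1`, so it is not
the start of its string. -/
theorem offset_le_range_ad_blockF {m : ℤ} (hm : m < 0) :
    offset blockWeight m ≤ LinearMap.range (LieAlgebra.ad ℂ (gl N p) (blockF N p) :
      gl N p →ₗ[ℂ] gl N p) := by
  intro X hX
  rw [range_ad_blockF, ← offsetProj_of_mem hX, ← (blockBasis N p).sum_repr X, map_sum]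
  refine Submodule.sum_mem _ fun s _ => ?_
  rw [map_smul]
  refine Submodule.smul_mem _ _ ?_
  have hs := blockString_mem_offset (p := p) s.1.1 s.1.2 s.2.1 s.2.2
  rw [← blockBasis_apply] at hs
  by_cases h : ((s.2.1 : ℕ) - (s.2.2 : ℕ) : ℤ) = m
  · rw [h] at hs
    rw [offsetProj_of_mem hs]
    exact Submodule.subset_span ⟨s, by omega, rfl⟩
  · rw [offsetProj_of_mem_ne hs h]
    exact Submodule.zero_mem _

/-- On the image of `ad (1 ⊗ e_-)` the operator `ad (1 ⊗ e_-) ∘ ad (1 ⊗ e_+)` is injective. -/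
theorem eq_zero_of_lie_lie_eq_zero {X : gl N p} (hX : X ∈ LinearMap.range
      (LieAlgebra.ad ℂ (gl N p) (blockF N p) : gl N p →ₗ[ℂ] gl N p))
    (h : ⁅blockF N p, ⁅blockE N p, X⁆⁆ = 0) : X = 0 := by
  -- Elements of the image have no component at the start of a string. The remaining eigenvalues `t
  -- (2 j + 1 - t)`, `1 ≤ t ≤ 2 j`, are nonzero.
  have h0 : ∀ s : BIdx N p, (s.2.2 : ℕ) = 0 → (blockBasis N p).repr X s = 0 := by
    intro s hs
    rw [range_ad_blockF] at hX
    refine Submodule.span_induction (p := fun X _ => (blockBasis N p).repr X s = 0) ?_ ?_ ?_ ?_ hX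
    · rintro _ ⟨s', hs', rfl⟩
      rw [Module.Basis.repr_self, Finsupp.single_apply, if_neg]
      rintro rfl
      omega
    · simp
    · intro x y _ _ hx hy
      simp [hx, hy]
    · intro c x _ hx
      simp [hx]
  have h1 : ∑ s, ((blockBasis N p).repr X s * (((s.2.2 : ℕ) : ℂ) * (2 * (s.2.1 : ℕ) + 1 -
      (s.2.2 : ℕ)))) • blockBasis N p s = 0 := by
    rw [← (blockBasis N p).sum_repr X, lie_sum, lie_sum] at h
    rw [← h]
    refine Finset.sum_congr rfl fun s _ => ?_
    rw [lie_smul, lie_smul, blockBasis_apply, lie_lie_blockString, smul_smul]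
  refine (blockBasis N p).ext_elem fun s => ?_
  rw [map_zero, Finsupp.zero_apply]
  by_cases hs : (s.2.2 : ℕ) = 0
  · exact h0 s hs
  · have h2 := Fintype.linearIndependent_iff.1 (blockBasis N p).linearIndependent _ h1 s
    refine (mul_eq_zero.1 h2).resolve_right (mul_ne_zero (by exact_mod_cast hs) ?_)
    rw [sub_ne_zero]
    exact_mod_cast s.2.2.2.ne'

end BlockStrings

/-! ## The constraints are linear and second class -/

section Constraints

variable {N p : ℕ}

/-- The linear functional `x ↦ κ tr (e x)`. -/
def traceFunctional {ι : Type*} [Fintype ι] (κ : ℂ) (e : Matrix ι ι ℂ) : Matrix ι ι ℂ →ₗ[ℂ] ℂ where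
  toFun X := κ * (e * X).trace
  map_add' X Y := by rw [mul_add, Matrix.trace_add, mul_add]
  map_smul' c X := by rw [Matrix.mul_smul, Matrix.trace_smul]; simp only [smul_eq_mul,
    RingHom.id_apply]; ring

theorem traceFunctional_apply {ι : Type*} [Fintype ι] (κ : ℂ) (e X : Matrix ι ι ℂ) :
    traceFunctional κ e X = κ * (e * X).trace := rfl

theorem isLinearConstraint_wConstraint {ι : Type} [Fintype ι] [DecidableEq ι]
    (L : LieSubalgebra ℂ (Matrix ι ι ℂ)) (κ : ℂ) (e f : L) :
    IsLinearConstraint (LinearMap.range (LieAlgebra.ad ℂ L f : L →ₗ[ℂ] L))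
      (traceFunctional κ (e : Matrix ι ι ℂ) ∘ₗ L.toSubmodule.subtype) (wConstraint L κ e f) := by
  let b := Module.finBasis ℂ (LinearMap.range (LieAlgebra.ad ℂ L f : L →ₗ[ℂ] L))
  refine ⟨fun i => b i, b.linearIndependent.map' (Submodule.subtype _) (Submodule.ker_subtype _),
    ?_, fun i => rfl⟩
  have h := congrArg (Submodule.map (Submodule.subtype _)) b.span_eq
  rw [Submodule.map_span, Submodule.map_top, Submodule.range_subtype, ← Set.range_comp] at h
  exact h

/-- This matches the explicit constraints of `W_p(N)` with the form `x = κ tr (e x)`. The factor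
`δ^{ab}` is the trace of `E^{ab}`, and `kappa` is chosen to make the value `1`. -/
theorem traceFunctional_J {α : CIdx N p} :
    traceFunctional (kappa p) (blockE N p) (J N p α.2.2.1 α.2.2.2 α.1 α.2.1) =
      if (α.1 : ℕ) = 1 ∧ (α.2.1 : ℤ) = -1 ∧ α.2.2.1 = α.2.2.2 then 1 else 0 := by
  obtain ⟨⟨j, hj⟩, ⟨m, hm⟩, a, b⟩ := α
  rw [Finset.mem_Ico] at hm
  simp only at hm ⊢
  rw [traceFunctional_apply, J, ← Matrix.mul_kronecker_mul, Matrix.trace_kronecker, Matrix.one_mul,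
    M_eq_string, trace_ePlus_mul_string (by omega) (by omega)]
  by_cases hab : a = b
  · subst hab
    rw [Matrix.trace_single_eq_same, one_mul]
    by_cases h : j = 1 ∧ m = -1
    · obtain ⟨rfl, rfl⟩ := h
      -- The label `j = 1` exists only for `p ≥ 2`, where `kappa` is a genuine inverse.
      rw [if_pos ⟨rfl, rfl⟩, if_pos ⟨rfl, rfl, rfl⟩, kappa_mul (by omega)]
    · rw [if_neg (by omega), if_neg (by tauto), mul_zero]
  · rw [Matrix.trace_single_eq_of_ne _ _ _ hab, zero_mul, mul_zero, if_neg (by tauto)]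

/-- The constraints of `W_p(N)` have the form `x = κ tr (e x)`, for `x` in a basis of
`[f, gl(Np)]`. -/
theorem isLinearConstraint_wpConstraint (N p : ℕ) :
    IsLinearConstraint (LinearMap.range (LieAlgebra.ad ℂ (gl N p) (blockF N p) :
      gl N p →ₗ[ℂ] gl N p)) (traceFunctional (kappa p) (blockE N p)) (wpConstraint N p) := by
  have hm : ∀ α : CIdx N p, -((α.1 : ℕ) : ℤ) ≤ α.2.1 ∧ (α.2.1 : ℤ) < (α.1 : ℕ) := fun α =>
    Finset.mem_Ico.1 α.2.1.2
  -- The label `m` becomes the position `t = j - m` in the string, so `-j ≤ m < j` turns into `1 ≤ t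
  -- ≤ 2 j`.
  let σ : CIdx N p → BIdx N p := fun α => ((α.2.2.1, α.2.2.2), ⟨α.1,
    ⟨(((α.1 : ℕ) : ℤ) - α.2.1).toNat, by have := hm α; omega⟩⟩)
  have hσ : ∀ α : CIdx N p, blockBasis N p (σ α) = J N p α.2.2.1 α.2.2.2 α.1 α.2.1 := fun α => by
    rw [blockBasis_apply, J_eq_blockString]
  refine ⟨fun α => J N p α.2.2.1 α.2.2.2 α.1 α.2.1, ?_, ?_, fun α => ?_⟩
  · simp only [← hσ]
    refine (blockBasis N p).linearIndependent.comp σ ?_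
    rintro ⟨j, ⟨m, h1⟩, a, b⟩ ⟨j', ⟨m', h2⟩, a', b'⟩ h
    simp only [σ, Prod.mk.injEq, Sigma.mk.injEq] at h
    obtain ⟨⟨rfl, rfl⟩, rfl, h⟩ := h
    have h := congrArg Fin.val (eq_of_heq h)
    rw [Finset.mem_Ico] at h1 h2
    simp only at h
    obtain rfl : m = m' := by omega
    rfl
  · rw [range_ad_blockF]
    congr 1
    ext x
    constructor
    · rintro ⟨α, rfl⟩
      refine ⟨σ α, ?_, (hσ α).symm⟩
      have := hm α
      simp only [σ]
      omega
    · rintro ⟨⟨⟨a, b⟩, j, t, ht⟩, h1, rfl⟩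
      simp only at h1
      refine ⟨⟨j, ⟨((j : ℕ) : ℤ) - t, Finset.mem_Ico.2 ⟨by omega, by omega⟩⟩, a, b⟩, ?_⟩
      rw [blockBasis_apply]
      simp [J_eq_blockString]
  · rw [traceFunctional_J, wpConstraint]

/-- The grading by `ad h / 2` is good for Lie algebras that are retracts of `gl(Np)`. -/
theorem isGoodGrading_of_retract {L : Type*} [LieRing L] [LieAlgebra ℂ L] (i : L →ₗ⁅ℂ⁆ gl N p)
    (s : gl N p →ₗ[ℂ] L) (hsi : ∀ x, s (i x) = x) {e f : L} (he : i e = blockE N p)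
    (hf : i f = blockF N p) (hs : ∀ x, s ⁅blockF N p, x⁆ = ⁅f, s x⁆)
    (hw : ∀ m, ∀ x ∈ offset blockWeight m, i (s x) ∈ offset blockWeight m)
    (htr : ∀ x y, (i x * i (s y)).trace = (i x * y).trace) {κ : ℂ} (hκ : κ ≠ 0 ∨ p ≤ 1) :
    IsGoodGrading (LinearMap.range (LieAlgebra.ad ℂ L f : L →ₗ[ℂ] L))
      (traceFunctional κ (blockE N p) ∘ₗ (i : L →ₗ[ℂ] gl N p))
      (fun m => (offset blockWeight m).comap (i : L →ₗ[ℂ] gl N p)) := by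
  have hi : Function.Injective i := Function.LeftInverse.injective hsi
  have hbound : ∀ u v : Fin N × Fin p, blockWeight v - blockWeight u ∈ Finset.Ico (-(p : ℤ)) p := by
    intro u v
    have := u.2.2
    have := v.2.2
    rw [Finset.mem_Ico]
    simp only [blockWeight]
    omega
  refine ⟨⟨p, fun m hm => ?_⟩, ?_, ?_, ?_, ?_, ?_⟩
  · rw [eq_bot_iff]
    rintro x ⟨hx, -⟩
    refine hi ?_
    rw [map_zero]
    refine offset_eq_zero (Submodule.mem_comap.1 hx) fun u v h => ?_
    have := Finset.mem_Ico.1 (hbound u v)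
    omega
  · rintro _ ⟨z, rfl⟩
    rw [← hsi z, ← sum_offsetProj hbound (i z), map_sum, map_sum]
    refine Submodule.sum_mem _ fun d _ => ?_
    refine Submodule.mem_iSup_of_mem (-1 + d) ⟨?_, ⟨_, rfl⟩⟩
    change i ⁅f, _⁆ ∈ offset blockWeight (-1 + d)
    rw [LieHom.map_lie, hf]
    exact lie_mem_offset blockF_mem_offset (hw _ _ (offsetProj_mem d _))
  · intro m n x y hx hy
    change i ⁅x, y⁆ ∈ offset blockWeight (m + n)
    rw [LieHom.map_lie]
    exact lie_mem_offset hx hy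
  · intro m hm x hx
    obtain ⟨z, hz⟩ := offset_le_range_ad_blockF hm (Submodule.mem_comap.1 hx)
    refine ⟨s z, ?_⟩
    change ⁅f, s z⁆ = x
    rw [← hs, ← hsi x]
    exact congrArg s hz
  · intro m hm x hx
    change κ * (blockE N p * i x).trace = 0
    have hx' : i x ∈ offset blockWeight m := hx
    rw [trace_offset (mul_mem_offset blockE_mem_offset hx') (by omega), mul_zero]
  · rintro m y ⟨hy, z, rfl⟩ hxy
    set y := (LieAlgebra.ad ℂ L f : L →ₗ[ℂ] L) z with hy'
    replace hy : i y ∈ offset blockWeight m := hy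
    rcases hκ with hκ | hp
    · have hiy : i y = ⁅blockF N p, i z⁆ := by
        rw [← hf, ← LieHom.map_lie]; rfl
      have hT : i ⁅f, ⁅e, y⁆⁆ = ⁅blockF N p, ⁅blockE N p, i y⁆⁆ := by
        rw [LieHom.map_lie, LieHom.map_lie, hf, he]
      refine hi ?_
      rw [map_zero]
      refine eq_zero_of_lie_lie_eq_zero ⟨i z, hiy.symm⟩ (hT ▸ ?_)
      have hoff : i ⁅f, ⁅e, y⁆⁆ ∈ offset blockWeight m := by
        rw [hT]
        have := lie_mem_offset blockF_mem_offset (lie_mem_offset blockE_mem_offset hy)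
        rwa [show -1 + (1 + m) = m by ring] at this
      -- Test `y` against `x = ⁅f, w⁆`, where `w` is the retraction of the degree `-m` part of `Z`.
      -- Invariance of the trace turns `tr (e ⁅⁅f, w⁆, y⁆)` into the pairing of `⁅f, ⁅e, y⁆⁆` with
      -- `w`, and `htr` replaces `w` by a matrix that need not lie in the image of `i`.
      have key : ∀ Z, (i ⁅f, ⁅e, y⁆⁆ * Z).trace = 0 := by
        intro Z
        have hz' := hw _ _ (offsetProj_mem (w := blockWeight) (-m) Z)
        have h := hxy ⁅f, s (offsetProj blockWeight (-m) Z)⁆ ⟨by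
          change i ⁅f, _⁆ ∈ offset blockWeight (-1 - m)
          rw [LieHom.map_lie, hf]
          exact lie_mem_offset blockF_mem_offset hz', ⟨_, rfl⟩⟩
        replace h := (mul_eq_zero.1 (show κ * (blockE N p * i ⁅_, y⁆).trace = 0 from h)).resolve_left
          hκ
        rw [← trace_mul_offsetProj hoff, ← htr, hT, ← lie_skew, neg_mul,
          Matrix.trace_neg, neg_eq_zero, trace_lie_mul, trace_lie_mul, ← lie_skew, mul_neg, Matrix.trace_neg,
          neg_eq_zero, ← h, LieHom.map_lie, LieHom.map_lie, hf]
      ext u v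
      have := key (Matrix.single v u 1)
      rwa [Matrix.trace_mul_single, MulOpposite.smul_eq_mul_unop, MulOpposite.unop_op,
        mul_one] at this
    -- For `p ≤ 1` the nilpotent `f` is zero, so the constrained space is trivial and `κ` does not
    -- matter.
    · have hF : eMinus p = 0 := by
        ext k l
        have := k.2
        rw [eMinus, Matrix.of_apply, if_neg (by omega)]
        rfl
      have hf0 : f = 0 := hi (by rw [hf, blockF, hF, Matrix.kronecker_zero, map_zero])
      rw [hy', hf0]
      simp

theorem kappa_ne_zero_or (p : ℕ) : kappa p ≠ 0 ∨ p ≤ 1 := by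
  rcases Nat.lt_or_ge 1 p with hp | hp
  · exact Or.inl (left_ne_zero_of_mul_eq_one (kappa_mul hp))
  · exact Or.inr hp

/-- The constraints of `W_p(N)` are second class. -/
theorem isSecondClass_wpConstraint (N p : ℕ) :
    IsSecondClass (liePoisson (gl N p)) (wpConstraint N p) := by
  have h := isGoodGrading_of_retract (N := N) (p := p) (LieHom.id : gl N p →ₗ⁅ℂ⁆ gl N p)
    LinearMap.id (fun _ => rfl) (e := blockE N p) (f := blockF N p) rfl rfl (fun _ => rfl)
    (fun _ _ h => h) (fun _ _ => rfl) (kappa_ne_zero_or p)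
  exact h.isSecondClass (isLinearConstraint_wpConstraint N p)

end Constraints

/-! ## Folding -/

section Folding

variable {N : ℕ} {θ₀ : ℤˣ} (θ : Signs N θ₀) {p : ℕ}

theorem mem_glTau {X : gl N p} : X ∈ glTau θ p ↔ tau θ p X = X := Iff.rfl

theorem tau_apply (X : gl N p) (u v : Fin N × Fin p) :
    tau θ p X u v = -(θ.val u.1 * θ.val v.1 * (-1) ^ ((u.2 : ℕ) + (v.2 : ℕ)) *
      X (v.1.rev, v.2.rev) (u.1.rev, u.2.rev)) := rfl

theorem tau_mem_offset {m : ℤ} {X : gl N p} (hX : X ∈ offset blockWeight m) :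
    tau θ p X ∈ offset blockWeight m := by
  intro u v h
  rw [tau_apply, hX, mul_zero, neg_zero]
  have := u.2.2
  have := v.2.2
  simp only [blockWeight, Fin.val_rev] at h ⊢
  omega

/-- `τ` is minus a signed transposition along the antidiagonal. The two minus signs cancel, every
other sign occurs squared, and the indices are merely permuted. -/
theorem trace_tau_mul_tau (X Y : gl N p) : (tau θ p X * tau θ p Y).trace = (X * Y).trace := by
  simp only [Matrix.trace, Matrix.diag_apply, Matrix.mul_apply]
  rw [Finset.sum_comm]
  have h := Equiv.sum_comp (M := ℂ) (Equiv.prodCongr (Fin.revPerm (n := N)) (Fin.revPerm (n := p)))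
  rw [← h]
  refine Finset.sum_congr rfl fun v _ => ?_
  rw [← h]
  refine Finset.sum_congr rfl fun u _ => ?_
  have sgn : ∀ k : ℕ, ((-1 : ℂ)) ^ k * (-1) ^ k = 1 := by
    intro k
    rw [← pow_add, ← two_mul, pow_mul]; simp
  simp only [tau_apply, Equiv.prodCongr_apply, Prod.map, Fin.revPerm_apply, Fin.rev_rev]
  have h1 := θ.sq u.1.rev
  have h2 := θ.sq v.1.rev
  have h3 := sgn ((u.2.rev : ℕ) + (v.2.rev : ℕ))
  rw [add_comm (v.2.rev : ℕ)]
  linear_combination (X v u * Y u v) * (θ.val u.1.rev * θ.val u.1.rev * θ.val v.1.rev *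
    θ.val v.1.rev * h3 + θ.val v.1.rev * θ.val v.1.rev * h1 + h2)

variable (p) in
/-- The projection of `gl(Np)` onto `gl(Np)^τ` as a linear map. -/
def symmetrizeₗ : gl N p →ₗ[ℂ] glTau θ p where
  toFun := symmetrize θ p
  map_add' X Y := Subtype.ext (by
    change (1 / 2 : ℂ) • (X + Y + tau θ p (X + Y)) = (1 / 2 : ℂ) • (X + tau θ p X) +
      (1 / 2 : ℂ) • (Y + tau θ p Y)
    rw [map_add]
    module)
  map_smul' c X := Subtype.ext (by
    change (1 / 2 : ℂ) • (c • X + tau θ p (c • X)) = c • (1 / 2 : ℂ) • (X + tau θ p X)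
    rw [map_smul]
    module)

theorem coe_symmetrize (x : gl N p) :
    (symmetrize θ p x : gl N p) = (1 / 2 : ℂ) • (x + tau θ p x) := rfl

theorem symmetrize_coe (x : glTau θ p) : symmetrize θ p (x : gl N p) = x := by
  refine Subtype.ext ?_
  rw [coe_symmetrize, (mem_glTau θ).1 x.2]
  module

theorem symmetrize_tau (x : gl N p) : symmetrize θ p (tau θ p x) = symmetrize θ p x := by
  refine Subtype.ext ?_
  rw [coe_symmetrize, coe_symmetrize, tau_tau, add_comm]

/-- The projection is not a Lie homomorphism, but it is equivariant under `gl(Np)^τ`, since `τ`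
fixes `y`. -/
theorem symmetrize_lie (y : glTau θ p) (x : gl N p) :
    symmetrize θ p ⁅(y : gl N p), x⁆ = ⁅y, symmetrize θ p x⁆ := by
  refine Subtype.ext ?_
  rw [LieSubalgebra.coe_bracket, coe_symmetrize, coe_symmetrize, LieHom.map_lie,
    (mem_glTau θ).1 y.2, lie_smul, lie_add]

theorem symmetrize_mem_offset (m : ℤ) (x : gl N p) (hx : x ∈ offset blockWeight m) :
    (symmetrize θ p x : gl N p) ∈ offset blockWeight m :=
  Submodule.smul_mem _ _ (add_mem hx (tau_mem_offset θ hx))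

/-- Orthogonality of the projection for the trace form: `τ` preserves the form and fixes `x`. It
makes the constrained values agree before and after folding. -/
theorem trace_mul_symmetrize (x : glTau θ p) (y : gl N p) :
    ((x : gl N p) * (symmetrize θ p y : gl N p)).trace = ((x : gl N p) * y).trace := by
  have h := trace_tau_mul_tau θ (x : gl N p) y
  rw [(mem_glTau θ).1 x.2] at h
  rw [coe_symmetrize, Matrix.mul_smul, mul_add, Matrix.trace_smul, Matrix.trace_add, h, smul_eq_mul]
  ring

variable (p)

/-- The subspace of constrained elements of `gl(Np)`. -/
abbrev glConstrained (N p : ℕ) : Submodule ℂ (gl N p) :=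
  LinearMap.range (LieAlgebra.ad ℂ (gl N p) (blockF N p) : gl N p →ₗ[ℂ] gl N p)

/-- The subspace of constrained elements of `gl(Np)^τ`. -/
abbrev tauConstrained : Submodule ℂ (glTau θ p) :=
  LinearMap.range (LieAlgebra.ad ℂ (glTau θ p) (glF θ p) : glTau θ p →ₗ[ℂ] glTau θ p)

/-- The constrained values on `gl(Np)^τ`. -/
abbrev tauFunctional (κ : ℂ) : glTau θ p →ₗ[ℂ] ℂ :=
  traceFunctional κ (blockE N p) ∘ₗ ((glTau θ p).incl : glTau θ p →ₗ[ℂ] gl N p)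

/-- The constraints of `W(gl(Np)^τ, [N.sl(p)]^τ)`. -/
abbrev tauConstraint := wConstraint (glTau θ p) (kappa p) (glE θ p) (glF θ p)

variable {p}

theorem isGoodGrading_glTau {κ : ℂ} (hκ : κ ≠ 0 ∨ p ≤ 1) :
    IsGoodGrading (tauConstrained θ p) (tauFunctional θ p κ)
      (fun m => (offset blockWeight m).comap ((glTau θ p).incl : glTau θ p →ₗ[ℂ] gl N p)) :=
  isGoodGrading_of_retract (glTau θ p).incl (symmetrizeₗ θ p) (symmetrize_coe θ)
    (e := glE θ p) (f := glF θ p) rfl rfl (symmetrize_lie θ (glF θ p))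
    (symmetrize_mem_offset θ) (trace_mul_symmetrize θ) hκ

theorem isLinearConstraint_tauConstraint :
    IsLinearConstraint (tauConstrained θ p) (tauFunctional θ p (kappa p)) (tauConstraint θ p) :=
  isLinearConstraint_wConstraint (glTau θ p) (kappa p) (glE θ p) (glF θ p)

theorem isSecondClass_tauConstraint :
    IsSecondClass (liePoisson (glTau θ p)) (tauConstraint θ p) :=
  (isGoodGrading_glTau θ (kappa_ne_zero_or p)).isSecondClass (isLinearConstraint_tauConstraint θ)

theorem coe_mem_glConstrained {x : glTau θ p} (hx : x ∈ tauConstrained θ p) :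
    (x : gl N p) ∈ glConstrained N p := by
  obtain ⟨z, rfl⟩ := hx
  exact ⟨z, rfl⟩

theorem symmetrize_mem_tauConstrained {x : gl N p} (hx : x ∈ glConstrained N p) :
    symmetrize θ p x ∈ tauConstrained θ p := by
  obtain ⟨z, rfl⟩ := hx
  exact ⟨symmetrize θ p z, (symmetrize_lie θ (glF θ p) z).symm⟩

theorem tauFunctional_symmetrize (κ : ℂ) (x : gl N p) :
    tauFunctional θ p κ (symmetrize θ p x) = traceFunctional κ (blockE N p) x :=
  congrArg (κ * ·) (trace_mul_symmetrize θ (glE θ p) x)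

/-! ### The involution of the polynomials and of `W_p(N)` -/

theorem symTau_eq : symTau θ p = symMap (tau θ p : gl N p →ₗ[ℂ] gl N p) := rfl

theorem symTau_symTau (F : SymmetricAlgebra ℂ (gl N p)) : symTau θ p (symTau θ p F) = F := by
  have h : (symTau θ p).comp (symTau θ p) = AlgHom.id ℂ _ := by
    refine SymmetricAlgebra.algHom_ext (LinearMap.ext fun x => ?_)
    simp [symTau_eq, tau_tau]
  exact congrArg (fun f : SymmetricAlgebra ℂ (gl N p) →ₐ[ℂ] _ => f F) h

theorem wTau_impose (F : SymmetricAlgebra ℂ (gl N p)) :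
    wTau θ p (impose _ F) = impose (wpConstraint N p) (symTau θ p F) := rfl

theorem wTau_wTau (F : Wp N p) : wTau θ p (wTau θ p F) = F := by
  obtain ⟨F, rfl⟩ := Ideal.Quotient.mkₐ_surjective ℂ _ F
  rw [wTau_impose, wTau_impose, symTau_symTau]

theorem wTau_wpMk (x : gl N p) : wTau θ p (wpMk N p x) = wpMk N p (tau θ p x) := by
  rw [wpMk, wTau_impose, symTau_eq, symMap_ι]
  rfl

/-- Elements of `W_p(N)` in the same orbit of `τ` have the same class in the coset. -/
theorem mk_wTau (F : Wp N p) :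
    Ideal.Quotient.mk (foldIdeal θ p) (wTau θ p F) = Ideal.Quotient.mk (foldIdeal θ p) F := by
  have hb : ∀ s : BIdx N p, Ideal.Quotient.mk (foldIdeal θ p) (wpMk N p (tau θ p
      (blockBasis N p s))) = Ideal.Quotient.mk (foldIdeal θ p) (wpMk N p (blockBasis N p s)) := by
    rintro ⟨⟨a, b⟩, j, t, ht⟩
    rw [← wTau_wpMk]
    -- The starts of the strings are the `W_j^{ab}`, identified with their images under `τ` by
    -- definition of the ideal; all other basis elements are constrained to scalars, which `τ`
    -- fixes.
    rcases Nat.eq_zero_or_pos t with rfl | h1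
    · rw [blockBasis_apply, eq_comm, Ideal.Quotient.eq]
      refine Ideal.subset_span ⟨a, b, j, ?_⟩
      simp only [wGen, J_eq_blockString, sub_self, Int.toNat_zero]
    · have h2 : blockBasis N p ⟨(a, b), j, t, ht⟩ ∈ glConstrained N p := by
        rw [glConstrained, range_ad_blockF]
        exact Submodule.subset_span ⟨⟨(a, b), j, t, ht⟩, h1, rfl⟩
      rw [wpMk, (isLinearConstraint_wpConstraint N p).impose_eq h2, AlgHom.commutes]
  have h : ((Ideal.Quotient.mkₐ ℂ (foldIdeal θ p)).comp (wTau θ p)).comp (impose _) =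
      (Ideal.Quotient.mkₐ ℂ (foldIdeal θ p)).comp (impose _) := by
    refine SymmetricAlgebra.algHom_ext ((blockBasis N p).ext fun s => ?_)
    exact (congrArg _ (wTau_wpMk θ (blockBasis N p s))).trans (hb s)
  obtain ⟨F, rfl⟩ := Ideal.Quotient.mkₐ_surjective ℂ _ F
  exact congrArg (fun f : SymmetricAlgebra ℂ (gl N p) →ₐ[ℂ] _ => f F) h

/-- Since `τ` acts trivially on the coset, averaging a representative over `τ` does not change its
class. A restricted bracket is therefore determined on all pairs of classes. -/
theorem exists_invariant (x : FoldedWp θ p) :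
    ∃ F : Wp N p, wTau θ p F = F ∧ Ideal.Quotient.mk (foldIdeal θ p) F = x := by
  obtain ⟨F, rfl⟩ := Ideal.Quotient.mk_surjective x
  refine ⟨(1 / 2 : ℂ) • (F + wTau θ p F), ?_, ?_⟩
  · rw [map_smul, map_add, wTau_wTau, add_comm]
  · rw [← Ideal.Quotient.mkₐ_eq_mk ℂ, map_smul, map_add, Ideal.Quotient.mkₐ_eq_mk, mk_wTau,
      ← two_smul ℂ, smul_smul]
    norm_num

theorem isRestrictedDirac_unique {B B' : PoissonBracket (FoldedWp θ p)}
    (hB : IsRestrictedDirac θ p B) (hB' : IsRestrictedDirac θ p B') : B' = B := by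
  refine PoissonBracket.ext (LinearMap.ext fun x => LinearMap.ext fun y => ?_)
  obtain ⟨F, hF, rfl⟩ := exists_invariant θ x
  obtain ⟨G, hG, rfl⟩ := exists_invariant θ y
  rw [hB F G hF hG, hB' F G hF hG]

/-- Elements of `W_p(N)` that are fixed by `τ` have first class lifts that are fixed by `τ`. -/
theorem exists_invariant_firstClass {x : Wp N p} (hx : wTau θ p x = x) :
    ∃ F : SymmetricAlgebra ℂ (gl N p), impose (wpConstraint N p) F = x ∧ symTau θ p F = F ∧
      ∀ α, impose (wpConstraint N p) ((liePoisson (gl N p)).br F (wpConstraint N p α)) = 0 := by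
  obtain ⟨F, rfl, hF⟩ := exists_firstClass (isSecondClass_wpConstraint N p) x
  -- `τ` respects the Poisson bracket and the constraint ideal, so it preserves first class
  -- elements, and the average of `F` and its image is again first class.
  have hF' : ∀ α, impose (wpConstraint N p)
      ((liePoisson (gl N p)).br (symTau θ p F) (wpConstraint N p α)) = 0 := by
    intro α
    rw [← symTau_symTau θ (wpConstraint N p α), liePoisson_br, symTau_eq, ← symMap_ham, ← symTau_eq,
      ← wTau_impose, ← liePoisson_br, impose_br_eq_zero hF (symTau_constraint θ p α), map_zero]
  refine ⟨(1 / 2 : ℂ) • (F + symTau θ p F), ?_, ?_, fun α => ?_⟩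
  · rw [map_smul, map_add, ← wTau_impose, hx, ← two_smul ℂ, smul_smul]
    norm_num
  · rw [map_smul, map_add, symTau_symTau, add_comm]
  · rw [map_smul, map_add, LinearMap.smul_apply, LinearMap.add_apply, map_smul, map_add, hF, hF',
      add_zero, smul_zero]

/-! ### The restriction of polynomials to `gl(Np)^τ` -/

variable (p) in
/-- The restriction of polynomials, induced by the projection of `gl(Np)` onto `gl(Np)^τ`. -/
def foldSym : SymmetricAlgebra ℂ (gl N p) →ₐ[ℂ] SymmetricAlgebra ℂ (glTau θ p) :=
  symMap (symmetrizeₗ θ p)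

theorem foldSym_ι (x : gl N p) : foldSym θ p (SymmetricAlgebra.ι ℂ _ x) =
    SymmetricAlgebra.ι ℂ _ (symmetrize θ p x) := symMap_ι _ _

theorem foldSym_symTau (F : SymmetricAlgebra ℂ (gl N p)) :
    foldSym θ p (symTau θ p F) = foldSym θ p F := by
  have h : (foldSym θ p).comp (symTau θ p) = foldSym θ p := by
    refine SymmetricAlgebra.algHom_ext (LinearMap.ext fun x => ?_)
    simp [symTau_eq, foldSym_ι, symmetrize_tau]
  exact congrArg (fun f : SymmetricAlgebra ℂ (gl N p) →ₐ[ℂ] _ => f F) h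

/-- Both sides are derivations along `foldSym` in `G`, so generators suffice. A generator is the sum
of a fixed part, for which the projection is equivariant, and an anti-invariant part `b`, for which
both sides vanish. -/
theorem foldSym_ham {F : SymmetricAlgebra ℂ (gl N p)} (hF : symTau θ p F = F)
    (G : SymmetricAlgebra ℂ (gl N p)) :
    foldSym θ p (ham F G) = ham (foldSym θ p F) (foldSym θ p G) := by
  refine map_derivation (fun x => ?_) G
  have hx : x = symmetrize θ p x + (1 / 2 : ℂ) • (x - tau θ p x) := by
    rw [coe_symmetrize]
    module
  set b := (1 / 2 : ℂ) • (x - tau θ p x) with hb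
  have hb' : tau θ p b = -b := by
    rw [hb, map_smul, map_sub, tau_tau, ← smul_neg, neg_sub]
  -- As `F` is invariant and `b` anti-invariant, the bracket is anti-invariant; `foldSym` identifies
  -- it with its negative.
  have h1 : foldSym θ p (adDer b F) = 0 := by
    have h2 : symTau θ p (adDer b F) = -adDer b F := by
      have h3 : adDer (-b) F = -adDer b F := by
        have h := congrArg (fun D : Derivation ℂ _ _ => D F) (adDer_smul (-1 : ℂ) b)
        simpa using h
      have h4 := symMap_adDer (f := (tau θ p : gl N p →ₗ[ℂ] gl N p)) (x := b) (x' := tau θ p b)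
        (fun y => (tau θ p).map_lie b y) F
      rw [← symTau_eq, hF, hb', h3] at h4
      exact h4
    have h5 := foldSym_symTau θ (adDer b F)
    rw [h2, map_neg] at h5
    have h6 : (2 : ℂ) • foldSym θ p (adDer b F) = 0 := by
      rw [two_smul]
      nth_rewrite 1 [← h5]
      exact neg_add_cancel _
    exact (smul_eq_zero.1 h6).resolve_left two_ne_zero
  have h2 : foldSym θ p (adDer (symmetrize θ p x : gl N p) F) =
      adDer (symmetrize θ p x) (foldSym θ p F) :=
    symMap_adDer (fun y => symmetrize_lie θ (symmetrize θ p x) y) F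
  rw [foldSym_ι, ham_ι, ham_ι, ← h2, map_neg]
  nth_rewrite 1 [hx]
  rw [adDer_add, Derivation.add_apply, map_add, h1, add_zero]

/-- The homomorphism from `W_p(N)` to `W(gl(Np)^τ, [N.sl(p)]^τ)`. -/
def foldHom : Wp N p →ₐ[ℂ] Reduced (tauConstraint θ p) :=
  Ideal.Quotient.liftₐ _ ((impose (tauConstraint θ p)).comp (foldSym θ p))
    ((isLinearConstraint_wpConstraint N p).le_ker _ fun x hx => by
      rw [AlgHom.comp_apply, foldSym_ι, (isLinearConstraint_tauConstraint θ).impose_eq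
        (symmetrize_mem_tauConstrained θ hx), tauFunctional_symmetrize])

theorem foldHom_impose (F : SymmetricAlgebra ℂ (gl N p)) :
    foldHom θ (impose _ F) = impose (tauConstraint θ p) (foldSym θ p F) := rfl

theorem foldHom_wpMk (x : gl N p) : foldHom θ (wpMk N p x) =
    impose (tauConstraint θ p) (SymmetricAlgebra.ι ℂ _ (symmetrize θ p x)) := by
  rw [wpMk, foldHom_impose, foldSym_ι]

/-- Invariance of one argument suffices: it provides an invariant first class lift of `F`, and both
Dirac brackets against that lift are ordinary brackets. -/
theorem foldHom_br {F G : Wp N p} (hF : wTau θ p F = F) :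
    foldHom θ ((wpBracket N p).br F G) =
      (wBracket (glTau θ p) (kappa p) (glE θ p) (glF θ p)).br (foldHom θ F) (foldHom θ G) := by
  obtain ⟨F, rfl, hF', hF⟩ := exists_invariant_firstClass θ hF
  refine map_diracBracket (isSecondClass_wpConstraint N p) (isSecondClass_tauConstraint θ)
    (foldSym θ p) (foldHom θ) (foldHom_impose θ) ?_ hF (foldSym_ham θ hF') G
  obtain ⟨b, -, hb, hφ⟩ := isLinearConstraint_tauConstraint (p := p) θ
  intro β
  have hβ : b β ∈ tauConstrained θ p := hb ▸ Submodule.subset_span ⟨β, rfl⟩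
  refine ⟨_, (isLinearConstraint_wpConstraint N p).mem (coe_mem_glConstrained θ hβ), ?_⟩
  rw [hφ, map_sub, foldSym_ι, symmetrize_coe, AlgHom.commutes]
  rfl

/-- The homomorphism from the coset to `W(gl(Np)^τ, [N.sl(p)]^τ)`. -/
def foldToW : FoldedWp θ p →ₐ[ℂ] Reduced (tauConstraint θ p) :=
  Ideal.Quotient.liftₐ _ (foldHom θ) (by
    suffices foldIdeal θ p ≤ RingHom.ker (foldHom θ) from fun a ha => this ha
    refine Ideal.span_le.2 ?_
    rintro _ ⟨a, b, j, rfl⟩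
    change foldHom θ _ = 0
    rw [wGen, wTau_wpMk, map_sub, foldHom_wpMk, foldHom_wpMk, symmetrize_tau, sub_self])

theorem foldToW_mk (F : Wp N p) :
    foldToW θ (Ideal.Quotient.mk (foldIdeal θ p) F) = foldHom θ F := rfl

/-- The homomorphism from `W(gl(Np)^τ, [N.sl(p)]^τ)` to the coset. -/
def wToFold : Reduced (tauConstraint θ p) →ₐ[ℂ] FoldedWp θ p :=
  Ideal.Quotient.liftₐ _ (((Ideal.Quotient.mkₐ ℂ (foldIdeal θ p)).comp (impose _)).comp
      (symMap ((glTau θ p).incl : glTau θ p →ₗ[ℂ] gl N p)))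
    ((isLinearConstraint_tauConstraint θ).le_ker _ fun x hx => by
      rw [AlgHom.comp_apply, AlgHom.comp_apply, symMap_ι]
      change Ideal.Quotient.mkₐ ℂ (foldIdeal θ p) (impose _ (SymmetricAlgebra.ι ℂ _ (x : gl N p))) =
        _
      rw [(isLinearConstraint_wpConstraint N p).impose_eq (coe_mem_glConstrained θ hx),
        AlgHom.commutes]
      rfl)

theorem wToFold_impose_ι (x : glTau θ p) :
    wToFold θ (impose _ (SymmetricAlgebra.ι ℂ _ x)) =
      Ideal.Quotient.mk (foldIdeal θ p) (wpMk N p x) := by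
  change Ideal.Quotient.mkₐ ℂ (foldIdeal θ p) (impose _ (symMap _ _)) = _
  rw [symMap_ι]
  rfl

theorem foldToW_wToFold (a : Reduced (tauConstraint θ p)) : foldToW θ (wToFold θ a) = a := by
  refine reduced_algHom_ext (f := (foldToW θ).comp (wToFold θ)) (g := AlgHom.id ℂ _)
    (fun x => ?_) a
  refine (congrArg (foldToW θ) (wToFold_impose_ι θ x)).trans
    ((foldToW_mk θ _).trans ((foldHom_wpMk θ _).trans ?_))
  rw [symmetrize_coe]
  rfl

theorem mk_wpMk_symmetrize (x : gl N p) :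
    Ideal.Quotient.mk (foldIdeal θ p) (wpMk N p (symmetrize θ p x)) =
      Ideal.Quotient.mk (foldIdeal θ p) (wpMk N p x) := by
  have h : wpMk N p (symmetrize θ p x) = (1 / 2 : ℂ) • (wpMk N p x + wTau θ p (wpMk N p x)) := by
    rw [wTau_wpMk, coe_symmetrize, wpMk, map_smul, map_smul, map_add, map_add]
    rfl
  rw [h, ← Ideal.Quotient.mkₐ_eq_mk ℂ, map_smul, map_add, Ideal.Quotient.mkₐ_eq_mk, mk_wTau,
    ← two_smul ℂ, smul_smul]
  norm_num

theorem wToFold_foldToW (a : FoldedWp θ p) : wToFold θ (foldToW θ a) = a := by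
  obtain ⟨a, rfl⟩ := Ideal.Quotient.mk_surjective a
  refine reduced_algHom_ext (f := (wToFold θ).comp (foldHom θ))
    (g := Ideal.Quotient.mkₐ ℂ (foldIdeal θ p)) (fun x => ?_) a
  rw [AlgHom.comp_apply]
  exact (congrArg _ (foldHom_wpMk θ x)).trans
    ((wToFold_impose_ι θ _).trans (mk_wpMk_symmetrize θ x))

/-- The coset `W_p(N)^τ` is isomorphic to `W(gl(Np)^τ, [N.sl(p)]^τ)`. -/
def foldEquiv : FoldedWp θ p ≃ₐ[ℂ] Reduced (tauConstraint θ p) :=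
  { foldToW θ with
    invFun := wToFold θ
    left_inv := wToFold_foldToW θ
    right_inv := foldToW_wToFold θ }

theorem foldEquiv_mk (F : Wp N p) :
    foldEquiv θ (Ideal.Quotient.mk (foldIdeal θ p) F) = foldHom θ F := rfl

variable (p) in
/-- The restriction of the Dirac bracket of `W_p(N)` to the coset. -/
def foldBracket : PoissonBracket (FoldedWp θ p) :=
  (wBracket (glTau θ p) (kappa p) (glE θ p) (glF θ p)).comap (foldEquiv θ)

theorem foldEquiv_mk_br {F G : Wp N p} (hF : wTau θ p F = F) :
    foldEquiv θ (Ideal.Quotient.mk (foldIdeal θ p) ((wpBracket N p).br F G)) =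
      (wBracket (glTau θ p) (kappa p) (glE θ p) (glF θ p)).br
        (foldEquiv θ (Ideal.Quotient.mk (foldIdeal θ p) F))
        (foldEquiv θ (Ideal.Quotient.mk (foldIdeal θ p) G)) := by
  rw [foldEquiv_mk]
  exact foldHom_br θ hF

theorem foldBracket_br (x y : FoldedWp θ p) : (foldBracket θ p).br x y = (foldEquiv θ).symm
    ((wBracket (glTau θ p) (kappa p) (glE θ p) (glF θ p)).br (foldEquiv θ x) (foldEquiv θ y)) :=
  PoissonBracket.comap_br _ _ _ _

/-- `foldBracket` is defined by transport, which gives the Poisson axioms at once. That it restricts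
the Dirac bracket is the compatibility `foldHom_br`. -/
theorem isRestrictedDirac_foldBracket : IsRestrictedDirac θ p (foldBracket θ p) := by
  intro F G hF hG
  refine (foldBracket_br θ _ _).trans ?_
  refine (congrArg (foldEquiv θ).symm (foldEquiv_mk_br θ hF (G := G)).symm).trans ?_
  exact AlgEquiv.symm_apply_apply _ _

end Folding

/-! ## Transport of reductions along isomorphisms of Lie algebras -/

section Transport

variable {L L' : Type*} [LieRing L] [LieAlgebra ℂ L] [LieRing L'] [LieAlgebra ℂ L']
  {V : Submodule ℂ L} {χ : L →ₗ[ℂ] ℂ} {V' : Submodule ℂ L'} {χ' : L' →ₗ[ℂ] ℂ}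
  {ι κ : Type*} {φ : ι → SymmetricAlgebra ℂ L} {ψ : κ → SymmetricAlgebra ℂ L'}

/-- The homomorphism of reduced algebras induced by a homomorphism of Lie algebras. -/
def reducedMap (Φ : L →ₗ⁅ℂ⁆ L') (hφ : IsLinearConstraint V χ φ) (hψ : IsLinearConstraint V' χ' ψ)
    (hΦ : ∀ x ∈ V, Φ x ∈ V' ∧ χ' (Φ x) = χ x) : Reduced φ →ₐ[ℂ] Reduced ψ :=
  Ideal.Quotient.liftₐ _ ((impose ψ).comp (symMap (Φ : L →ₗ[ℂ] L'))) (hφ.le_ker _ fun x hx => by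
    rw [AlgHom.comp_apply, symMap_ι]
    exact (hψ.impose_eq (hΦ x hx).1).trans (congrArg _ (hΦ x hx).2))

theorem reducedMap_impose (Φ : L →ₗ⁅ℂ⁆ L') (hφ : IsLinearConstraint V χ φ)
    (hψ : IsLinearConstraint V' χ' ψ) (hΦ : ∀ x ∈ V, Φ x ∈ V' ∧ χ' (Φ x) = χ x)
    (F : SymmetricAlgebra ℂ L) : reducedMap Φ hφ hψ hΦ (impose φ F) =
      impose ψ (symMap (Φ : L →ₗ[ℂ] L') F) := rfl

theorem reducedMap_impose_ι (Φ : L →ₗ⁅ℂ⁆ L') (hφ : IsLinearConstraint V χ φ)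
    (hψ : IsLinearConstraint V' χ' ψ) (hΦ : ∀ x ∈ V, Φ x ∈ V' ∧ χ' (Φ x) = χ x) (x : L) :
    reducedMap Φ hφ hψ hΦ (impose φ (SymmetricAlgebra.ι ℂ L x)) =
      impose ψ (SymmetricAlgebra.ι ℂ L' (Φ x)) := by
  rw [reducedMap_impose, symMap_ι]
  rfl

/-- An isomorphism of Lie algebras that matches the constrained subspaces and the values on them
identifies the reductions. Functionals need to agree on `V` only, and bases need not correspond. -/
theorem exists_poissonIso_of_lieEquiv [Fintype ι] [DecidableEq ι] [Fintype κ] [DecidableEq κ]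
    (Φ : L ≃ₗ⁅ℂ⁆ L') (hφ : IsLinearConstraint V χ φ)
    (hψ : IsLinearConstraint (V.map (Φ : L →ₗ[ℂ] L')) χ' ψ) (hχ : ∀ x ∈ V, χ' (Φ x) = χ x)
    (hφ₂ : IsSecondClass (liePoisson L) φ) (hψ₂ : IsSecondClass (liePoisson L') ψ) :
    ∃ Ψ : Reduced φ ≃ₐ[ℂ] Reduced ψ, IsPoissonIso (diracBracket (liePoisson L) φ)
      (diracBracket (liePoisson L') ψ) Ψ := by
  have h1 : ∀ x ∈ V, (Φ : L →ₗ⁅ℂ⁆ L') x ∈ V.map (Φ : L →ₗ[ℂ] L') ∧ χ' ((Φ : L →ₗ⁅ℂ⁆ L') x) = χ x :=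
    fun x hx => ⟨⟨x, hx, rfl⟩, hχ x hx⟩
  have h2 : ∀ y ∈ V.map (Φ : L →ₗ[ℂ] L'), (Φ.symm : L' →ₗ⁅ℂ⁆ L) y ∈ V ∧
      χ ((Φ.symm : L' →ₗ⁅ℂ⁆ L) y) = χ' y := by
    rintro _ ⟨x, hx, rfl⟩
    have : (Φ.symm : L' →ₗ⁅ℂ⁆ L) ((Φ : L →ₗ[ℂ] L') x) = x := Φ.symm_apply_apply x
    rw [this]
    exact ⟨hx, (hχ x hx).symm⟩
  let f := reducedMap (Φ : L →ₗ⁅ℂ⁆ L') hφ hψ h1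
  let g := reducedMap (Φ.symm : L' →ₗ⁅ℂ⁆ L) hψ hφ h2
  have hgf : ∀ a, g (f a) = a := reduced_algHom_ext (f := g.comp f) (g := AlgHom.id ℂ _) fun x => by
    rw [AlgHom.comp_apply]
    simp only [f, g]
    rw [reducedMap_impose_ι, reducedMap_impose_ι]
    exact congrArg (fun x => impose φ (SymmetricAlgebra.ι ℂ L x)) (Φ.symm_apply_apply x)
  have hfg : ∀ a, f (g a) = a := reduced_algHom_ext (f := f.comp g) (g := AlgHom.id ℂ _) fun x => by
    rw [AlgHom.comp_apply]
    simp only [f, g]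
    rw [reducedMap_impose_ι, reducedMap_impose_ι]
    exact congrArg (fun x => impose ψ (SymmetricAlgebra.ι ℂ L' x)) (Φ.apply_symm_apply x)
  refine ⟨{ f with invFun := g, left_inv := hgf, right_inv := hfg }, fun x y => ?_⟩
  obtain ⟨F, rfl, hF⟩ := exists_firstClass hφ₂ x
  refine map_diracBracket hφ₂ hψ₂ (symMap ((Φ : L →ₗ⁅ℂ⁆ L') : L →ₗ[ℂ] L')) f (fun _ => rfl) ?_ hF
    (symMap_ham _ F) y
  obtain ⟨b, -, hb, hψ'⟩ := hψ
  intro β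
  obtain ⟨x, hx, hxb⟩ : b β ∈ V.map (Φ : L →ₗ[ℂ] L') := hb ▸ Submodule.subset_span ⟨β, rfl⟩
  have hxb : Φ x = b β := hxb
  refine ⟨_, hφ.mem hx, ?_⟩
  rw [hψ', map_sub, symMap_ι, AlgHom.commutes, ← hxb, hχ x hx]
  rfl

end Transport

/-! ## The scaling automorphisms of `gl(Np)^τ` -/

section Scaling

variable {n : Type*} [Fintype n] [DecidableEq n] (w : n → ℤ)

/-- The automorphism of the matrices that scales `offset w d` by `c ^ d`. -/
def scaling (c : ℂ) (hc : c ≠ 0) : Matrix n n ℂ →ₗ⁅ℂ⁆ Matrix n n ℂ where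
  toFun X := Matrix.of fun u v => c ^ (w v - w u) * X u v
  map_add' X Y := by ext u v; simp [mul_add]
  map_smul' r X := by ext u v; simp only [Matrix.of_apply, Matrix.smul_apply, smul_eq_mul,
    RingHom.id_apply]; ring
  map_lie' := by
    have key : ∀ X Y : Matrix n n ℂ, (Matrix.of fun u v => c ^ (w v - w u) * (X * Y) u v) =
        (Matrix.of fun u v => c ^ (w v - w u) * X u v) *
          (Matrix.of fun u v => c ^ (w v - w u) * Y u v) := by
      intro X Y
      ext u v
      simp only [Matrix.of_apply, Matrix.mul_apply, Finset.mul_sum]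
      refine Finset.sum_congr rfl fun x _ => ?_
      rw [show w v - w u = (w x - w u) + (w v - w x) by ring, zpow_add₀ hc]
      ring
    intro X Y
    simp only [Ring.lie_def, ← key]
    ext u v
    simp [mul_sub]

variable {w}

theorem scaling_apply {c : ℂ} (hc : c ≠ 0) (X : Matrix n n ℂ) (u v : n) :
    scaling w c hc X u v = c ^ (w v - w u) * X u v := rfl

theorem scaling_scaling_inv {c : ℂ} (hc : c ≠ 0) (X : Matrix n n ℂ) :
    scaling w c hc (scaling w c⁻¹ (inv_ne_zero hc) X) = X := by
  ext u v
  rw [scaling_apply, scaling_apply, ← mul_assoc, ← mul_zpow, mul_inv_cancel₀ hc, one_zpow, one_mul]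

theorem scaling_inv_scaling {c : ℂ} (hc : c ≠ 0) (X : Matrix n n ℂ) :
    scaling w c⁻¹ (inv_ne_zero hc) (scaling w c hc X) = X := by
  ext u v
  rw [scaling_apply, scaling_apply, ← mul_assoc, ← mul_zpow, inv_mul_cancel₀ hc, one_zpow, one_mul]

theorem scaling_of_mem_offset {c : ℂ} (hc : c ≠ 0) {d : ℤ} {X : Matrix n n ℂ}
    (hX : X ∈ offset w d) : scaling w c hc X = c ^ d • X := by
  ext u v
  rw [scaling_apply, Matrix.smul_apply, smul_eq_mul]
  by_cases h : w v - w u = d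
  · rw [h]
  · rw [hX u v h, mul_zero, mul_zero]

/-- The scaling is conjugation by the diagonal matrix with entries `c ^ w u`. -/
theorem trace_scaling_mul_scaling {c : ℂ} (hc : c ≠ 0) (X Y : Matrix n n ℂ) :
    (scaling w c hc X * scaling w c hc Y).trace = (X * Y).trace := by
  simp only [Matrix.trace, Matrix.diag_apply, Matrix.mul_apply, scaling_apply]
  refine Finset.sum_congr rfl fun u _ => Finset.sum_congr rfl fun v _ => ?_
  have h : c ^ (w v - w u) * c ^ (w u - w v) = 1 := by
    rw [← zpow_add₀ hc, sub_add_sub_cancel, sub_self, zpow_zero]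
  linear_combination X u v * Y v u * h

variable {N : ℕ} {θ₀ : ℤˣ} (θ : Signs N θ₀) {p : ℕ}

/-- Reversing and exchanging the two indices of an entry leaves its degree unchanged, so scaling
commutes with `τ`. -/
theorem scaling_mem_glTau {c : ℂ} (hc : c ≠ 0) {X : gl N p} (hX : X ∈ glTau θ p) :
    scaling blockWeight c hc X ∈ glTau θ p := by
  rw [mem_glTau] at hX ⊢
  ext u v
  have h : blockWeight (u.1.rev, u.2.rev) - blockWeight (v.1.rev, v.2.rev) =
      blockWeight v - blockWeight u := by
    have := u.2.2
    have := v.2.2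
    simp only [blockWeight, Fin.val_rev]
    omega
  have hX' := congrFun (congrFun hX u) v
  rw [tau_apply] at hX'
  rw [tau_apply, scaling_apply, scaling_apply, h, ← hX']
  ring

/-- The automorphism of `gl(Np)^τ` that scales the elements of degree `d` by `c ^ d`. -/
def tauScaling (c : ℂ) (hc : c ≠ 0) : glTau θ p ≃ₗ⁅ℂ⁆ glTau θ p where
  toFun x := ⟨scaling blockWeight c hc x, scaling_mem_glTau θ hc x.2⟩
  map_add' x y := Subtype.ext (map_add (scaling blockWeight c hc) (x : gl N p) y)
  map_smul' r x := Subtype.ext (map_smul (scaling blockWeight c hc) r (x : gl N p))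
  map_lie' {x y} := Subtype.ext (LieHom.map_lie (scaling blockWeight c hc) (x : gl N p) y)
  invFun x := ⟨scaling blockWeight c⁻¹ (inv_ne_zero hc) x, scaling_mem_glTau θ _ x.2⟩
  left_inv x := Subtype.ext (scaling_inv_scaling hc (x : gl N p))
  right_inv x := Subtype.ext (scaling_scaling_inv hc (x : gl N p))

theorem coe_tauScaling {c : ℂ} (hc : c ≠ 0) (x : glTau θ p) :
    (tauScaling θ c hc x : gl N p) = scaling blockWeight c hc (x : gl N p) := rfl

theorem tauScaling_glF {c : ℂ} (hc : c ≠ 0) : tauScaling θ c hc (glF θ p) = c⁻¹ • glF θ p := by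
  refine Subtype.ext ((scaling_of_mem_offset hc blockF_mem_offset).trans ?_)
  rw [zpow_neg_one]
  rfl

theorem trace_blockE_mul_scaling {c : ℂ} (hc : c ≠ 0) (X : gl N p) :
    (blockE N p * scaling blockWeight c hc X).trace = c⁻¹ * (blockE N p * X).trace := by
  rw [← trace_scaling_mul_scaling (w := blockWeight) hc (blockE N p) X,
    scaling_of_mem_offset hc blockE_mem_offset, zpow_one, Matrix.smul_mul, Matrix.trace_smul,
    smul_eq_mul, inv_mul_cancel_left₀ hc]

theorem map_range_ad {L L' : Type*} [LieRing L] [LieAlgebra ℂ L] [LieRing L'] [LieAlgebra ℂ L']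
    (Φ : L ≃ₗ⁅ℂ⁆ L') {f : L} {f' : L'} {c : ℂ} (hc : c ≠ 0) (hf : Φ f = c • f') :
    (LinearMap.range (LieAlgebra.ad ℂ L f : L →ₗ[ℂ] L)).map (Φ : L →ₗ[ℂ] L') =
      LinearMap.range (LieAlgebra.ad ℂ L' f' : L' →ₗ[ℂ] L') := by
  ext y
  constructor
  · rintro ⟨_, ⟨z, rfl⟩, rfl⟩
    refine ⟨c • Φ z, ?_⟩
    change ⁅f', c • Φ z⁆ = Φ ⁅f, z⁆
    rw [LieEquiv.map_lie, hf, lie_smul, smul_lie]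
  · rintro ⟨z, rfl⟩
    refine ⟨⁅f, c⁻¹ • Φ.symm z⁆, ⟨_, rfl⟩, ?_⟩
    change Φ ⁅f, c⁻¹ • Φ.symm z⁆ = ⁅f', z⁆
    rw [LieEquiv.map_lie, hf, map_smul, LieEquiv.apply_symm_apply, lie_smul, smul_lie, smul_smul,
      inv_mul_cancel₀ hc, one_smul]

/-- An isomorphism of `gl(Np)^τ` with a matrix Lie algebra that preserves the trace form and the
nilpotents identifies the coset with the reduction of the matrix Lie algebra. -/
theorem isWAlgebra_foldBracket {ι : Type} [Fintype ι] [DecidableEq ι]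
    {L : LieSubalgebra ℂ (Matrix ι ι ℂ)} {e f : L} (Φ : glTau θ p ≃ₗ⁅ℂ⁆ L)
    (he : Φ (glE θ p) = e) (hf : Φ (glF θ p) = f)
    (htr : ∀ x y : glTau θ p, ((Φ x : Matrix ι ι ℂ) * (Φ y : Matrix ι ι ℂ)).trace =
      ((x : gl N p) * (y : gl N p)).trace) :
    IsWAlgebra (foldBracket θ p) L e f := by
  -- The scaling by `c` multiplies `x ↦ tr (e x)` by `c⁻¹`, so `c = 1 / κ` turns the form normalised
  -- by `1` on `L` into the one normalised by `kappa p`. For `p ≤ 1` there is nothing to rescale.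
  obtain ⟨c, hc, hcκ⟩ : ∃ c : ℂ, c ≠ 0 ∧ (c⁻¹ = kappa p ∨ p ≤ 1) := by
    rcases kappa_ne_zero_or p with h | h
    · exact ⟨(kappa p)⁻¹, inv_ne_zero h, Or.inl (inv_inv _)⟩
    · exact ⟨1, one_ne_zero, Or.inr h⟩
  let Φ' : glTau θ p ≃ₗ⁅ℂ⁆ L := (tauScaling θ c hc).trans Φ
  have hΦ' : ∀ x, Φ' x = Φ (tauScaling θ c hc x) := fun x => rfl
  have hV : (tauConstrained θ p).map (Φ' : glTau θ p →ₗ[ℂ] L) =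
      LinearMap.range (LieAlgebra.ad ℂ L f : L →ₗ[ℂ] L) :=
    map_range_ad Φ' (inv_ne_zero hc) (by rw [hΦ', tauScaling_glF, map_smul, hf])
  have hχ : ∀ x ∈ tauConstrained θ p, (traceFunctional 1 (e : Matrix ι ι ℂ) ∘ₗ
      L.toSubmodule.subtype) (Φ' x) = tauFunctional θ p (kappa p) x := by
    intro x hx
    have h1 : (traceFunctional 1 (e : Matrix ι ι ℂ) ∘ₗ L.toSubmodule.subtype) (Φ' x) =
        c⁻¹ * (blockE N p * (x : gl N p)).trace := by
      change 1 * ((e : Matrix ι ι ℂ) * (Φ (tauScaling θ c hc x) : Matrix ι ι ℂ)).trace = _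
      rw [one_mul, ← he, htr, coe_tauScaling]
      exact trace_blockE_mul_scaling hc _
    rw [h1]
    rcases hcκ with h | hp
    · rw [h]
      rfl
    · have hx0 : x = 0 := by
        have hF : glF θ p = 0 := by
          refine Subtype.ext ?_
          change (1 : Matrix (Fin N) (Fin N) ℂ) ⊗ₖ eMinus p = 0
          have hF : eMinus p = 0 := by
            ext k l
            have := k.2
            rw [eMinus, Matrix.of_apply, if_neg (by omega)]
            rfl
          rw [hF, Matrix.kronecker_zero]
        obtain ⟨z, rfl⟩ := hx
        rw [hF]
        simp
      rw [hx0, map_zero, ZeroMemClass.coe_zero, mul_zero, Matrix.trace_zero, mul_zero]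
  have hlin := (isLinearConstraint_wConstraint L 1 e f).of_eq hV.symm
  -- The good grading is carried over to `L`, so the target constraints are second class without a
  -- separate study of the target algebra.
  have h₂ := ((isGoodGrading_glTau θ (kappa_ne_zero_or p)).map Φ' hχ).isSecondClass hlin
  obtain ⟨Ψ, hΨ⟩ := exists_poissonIso_of_lieEquiv Φ' (isLinearConstraint_tauConstraint θ) hlin hχ
    (isSecondClass_tauConstraint θ) h₂
  exact ⟨h₂, (foldEquiv θ).trans Ψ, (PoissonBracket.isPoissonIso_comap _ _).trans hΨ⟩

end Scaling

/-! ## The subalgebra `N.sl(p)` -/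

section NSl

variable {N p : ℕ}

theorem span_string : Submodule.span ℂ
    (Set.range fun s : SIdx p => string p (s.1 : ℕ) (s.2 : ℕ)) = ⊤ :=
  (linearIndependent_string (p := p)).span_eq_top_of_card_eq_finrank' (by
    rw [Module.finrank_matrix, card_SIdx]
    simp)

theorem trace_string {j : ℕ} (hj : 1 ≤ j) (t : ℕ) : (string p j t).trace = 0 := by
  cases t with
  | zero => exact trace_offset (string_mem_offset j 0) (by omega)
  | succ t =>
    rw [← lie_eMinus_string]
    exact LieAlgebra.matrix_trace_commutator_zero _ _ _ _

/-- `P` inserts the traceless part of a matrix into block `a`. It sends the identity to zero and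
every other string element to a generator of `N.sl(p)`, and the strings span. -/
theorem single_kronecker_mem_nSl (a : Fin N) {Y : Matrix (Fin p) (Fin p) ℂ} (hY : Y.trace = 0) :
    (Matrix.single a a 1 ⊗ₖ Y : gl N p) ∈ nSl N p := by
  let P : Matrix (Fin p) (Fin p) ℂ →ₗ[ℂ] gl N p :=
    { toFun := fun X => Matrix.single a a 1 ⊗ₖ (X - (X.trace * (p : ℂ)⁻¹) • 1)
      map_add' := fun X Y => by
        rw [← Matrix.kronecker_add, Matrix.trace_add, add_mul, add_smul, add_sub_add_comm]
      map_smul' := fun c X => by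
        rw [← Matrix.kronecker_smul, Matrix.trace_smul, smul_sub, smul_smul, smul_eq_mul, mul_assoc,
          RingHom.id_apply] }
  have hP : ∀ X : Matrix (Fin p) (Fin p) ℂ, P X =
      Matrix.single a a 1 ⊗ₖ (X - (X.trace * (p : ℂ)⁻¹) • 1) := fun X => rfl
  have hle : (⊤ : Submodule ℂ (Matrix (Fin p) (Fin p) ℂ)) ≤ (nSl N p).toSubmodule.comap P := by
    rw [← span_string, Submodule.span_le]
    rintro _ ⟨⟨⟨j, hj⟩, ⟨t, ht⟩⟩, rfl⟩
    simp only at ht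
    change P (string p j t) ∈ nSl N p
    rw [hP]
    rcases Nat.eq_zero_or_pos j with rfl | h1
    · obtain rfl : t = 0 := by omega
      have hp : (p : ℂ) ≠ 0 := by exact_mod_cast hj.ne'
      rw [string_zero, pow_zero, Matrix.trace_one, Fintype.card_fin, mul_inv_cancel₀ hp,
        one_smul, sub_self, Matrix.kronecker_zero]
      exact zero_mem _
    · rw [trace_string h1, zero_mul, zero_smul, sub_zero]
      refine LieSubalgebra.subset_lieSpan ⟨a, j, (j : ℤ) - t, h1, hj, by omega, by omega, ?_⟩
      rw [J_eq_blockString, sub_sub_cancel, Int.toNat_natCast, blockString]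
  have h := hle (Submodule.mem_top (x := Y))
  change P Y ∈ nSl N p at h
  rwa [hP, hY, zero_mul, zero_smul, sub_zero] at h

/-- The projection to the `a`-th summand. -/
def blockProj (a : Fin N) : gl N p := Matrix.single a a 1 ⊗ₖ 1

theorem blockProj_mul_apply (a : Fin N) (X : gl N p) (u v : Fin N × Fin p) :
    ((blockProj a : gl N p) * X) u v = if u.1 = a then X u v else 0 := by
  rw [Matrix.mul_apply, Finset.sum_eq_single u]
  · by_cases h : u.1 = a
    · simp [blockProj, h]
    · simp [blockProj, h, Ne.symm h]
  · intro w _ hw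
    by_cases h : u.2 = w.2
    · have h' : u.1 ≠ w.1 := fun h' => hw (Prod.ext h' h).symm
      rw [blockProj, Matrix.kroneckerMap_apply, Matrix.single_apply, if_neg, zero_mul, zero_mul]
      rintro ⟨rfl, h2⟩
      exact h' h2
    · simp [blockProj, h]
  · simp

theorem mul_blockProj_apply (a : Fin N) (X : gl N p) (u v : Fin N × Fin p) :
    (X * (blockProj a : gl N p)) u v = if v.1 = a then X u v else 0 := by
  rw [Matrix.mul_apply, Finset.sum_eq_single v]
  · by_cases h : v.1 = a
    · simp [blockProj, h]
    · simp [blockProj, h, Ne.symm h]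
  · intro w _ hw
    by_cases h : w.2 = v.2
    · have h' : w.1 ≠ v.1 := fun h' => hw (Prod.ext h' h)
      rw [blockProj, Matrix.kroneckerMap_apply, Matrix.single_apply, if_neg, zero_mul, mul_zero]
      rintro ⟨rfl, h2⟩
      exact h' h2
    · simp [blockProj, h]
  · simp

/-- Block diagonal matrices form the centraliser of the block projections, which makes closure under
the bracket evident. -/
theorem lie_blockProj_eq_zero_iff (X : gl N p) :
    (∀ a, ⁅(blockProj a : gl N p), X⁆ = 0) ↔ ∀ u v : Fin N × Fin p, u.1 ≠ v.1 → X u v = 0 := by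
  constructor
  · intro h u v huv
    have h1 := congrFun (congrFun (h u.1) u) v
    rw [Ring.lie_def, Matrix.sub_apply, blockProj_mul_apply, mul_blockProj_apply, if_pos rfl,
      if_neg huv.symm, sub_zero] at h1
    exact h1
  · intro h a
    ext u v
    rw [Ring.lie_def, Matrix.sub_apply, blockProj_mul_apply, mul_blockProj_apply]
    by_cases huv : u.1 = v.1
    · rw [huv, sub_self]
      rfl
    · rw [h u v huv]
      simp

theorem trace_blockProj_mul (a : Fin N) (X : gl N p) :
    ((blockProj a : gl N p) * X).trace = ∑ k, X (a, k) (a, k) := by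
  rw [Matrix.trace, Fintype.sum_prod_type, Finset.sum_eq_single a]
  · simp [blockProj_mul_apply]
  · intro b _ hb
    simp [blockProj_mul_apply, hb]
  · simp

/-- The subalgebra `N.sl(p)` consists of the block diagonal matrices with traceless blocks. -/
theorem mem_nSl_iff (X : gl N p) : X ∈ nSl N p ↔
    (∀ u v : Fin N × Fin p, u.1 ≠ v.1 → X u v = 0) ∧ ∀ a, ∑ k, X (a, k) (a, k) = 0 := by
  constructor
  · intro hX
    -- The block traces are `tr (P_a X)`; closure under the bracket is `tr (P_a ⁅X, Y⁆) = tr (⁅P_a,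
    -- X⁆ Y) = 0`.
    let K : LieSubalgebra ℂ (gl N p) :=
      { carrier := {X | (∀ a, ⁅(blockProj a : gl N p), X⁆ = 0) ∧
          ∀ a, ((blockProj a : gl N p) * X).trace = 0}
        add_mem' := fun {X Y} hX hY => ⟨fun a => by rw [lie_add, hX.1, hY.1, add_zero], fun a => by
          rw [mul_add, Matrix.trace_add, hX.2, hY.2, add_zero]⟩
        zero_mem' := ⟨fun a => lie_zero _, fun a => by rw [mul_zero, Matrix.trace_zero]⟩
        smul_mem' := fun c X hX => ⟨fun a => by rw [lie_smul, hX.1, smul_zero], fun a => by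
          rw [Matrix.mul_smul, Matrix.trace_smul, hX.2, smul_zero]⟩
        lie_mem' := fun {X Y} hX hY => ⟨fun a => by
          rw [leibniz_lie, hX.1, hY.1, lie_zero, zero_lie, add_zero], fun a => by
          rw [← trace_lie_mul, hX.1, zero_mul, Matrix.trace_zero]⟩ }
    have hK : nSl N p ≤ K := by
      rw [nSl, LieSubalgebra.lieSpan_le]
      rintro _ ⟨a, j, m, h1, -, -, -, rfl⟩
      rw [J_eq_blockString]
      refine ⟨(lie_blockProj_eq_zero_iff _).2 fun u v huv => ?_, fun b => ?_⟩
      · rw [blockString, Matrix.kroneckerMap_apply, Matrix.single_apply, if_neg, zero_mul]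
        rintro ⟨rfl, h⟩
        exact huv h
      · rw [blockProj, blockString, ← Matrix.mul_kronecker_mul, Matrix.trace_kronecker,
          Matrix.one_mul, trace_string h1, mul_zero]
    obtain ⟨h1, h2⟩ := hK hX
    exact ⟨(lie_blockProj_eq_zero_iff X).1 h1, fun a => by rw [← trace_blockProj_mul, h2]⟩
  · rintro ⟨h1, h2⟩
    have hX : X = ∑ a, Matrix.single a a 1 ⊗ₖ (Matrix.of fun k l => X (a, k) (a, l)) := by
      ext ⟨a, k⟩ ⟨b, l⟩
      rw [Matrix.sum_apply, Finset.sum_eq_single a]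
      · by_cases h : a = b
        · simp [h]
        · simp [h, h1 (a, k) (b, l) h]
      · intro c _ hc
        simp [hc]
      · simp
    rw [hX]
    exact sum_mem fun a _ => single_kronecker_mem_nSl a (h2 a)

end NSl

/-! ## Signed permutations of the matrix entries -/

section SignedReindex

variable {ι κ : Type*} [Fintype ι] [Fintype κ] [DecidableEq ι] [DecidableEq κ]

/-- The isomorphism of matrix Lie algebras given by a bijection of the indices and signs. -/
def signedReindex (σ : ι ≃ κ) (c : ι → ℂ) (hc : ∀ i, c i * c i = 1) :
    Matrix κ κ ℂ ≃ₗ⁅ℂ⁆ Matrix ι ι ℂ where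
  toFun X := Matrix.of fun i j => c i * c j * X (σ i) (σ j)
  map_add' X Y := by ext i j; simp [mul_add]
  map_smul' r X := by ext i j; simp only [Matrix.of_apply, Matrix.smul_apply, smul_eq_mul,
    RingHom.id_apply]; ring
  map_lie' := by
    have key : ∀ X Y : Matrix κ κ ℂ, (Matrix.of fun i j => c i * c j * (X * Y) (σ i) (σ j)) =
        (Matrix.of fun i j => c i * c j * X (σ i) (σ j)) *
          (Matrix.of fun i j => c i * c j * Y (σ i) (σ j)) := by
      intro X Y
      ext i j
      simp only [Matrix.of_apply, Matrix.mul_apply, Finset.mul_sum]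
      rw [← Equiv.sum_comp σ]
      refine Finset.sum_congr rfl fun x _ => ?_
      linear_combination (-(c i * c j * X (σ i) (σ x) * Y (σ x) (σ j))) * hc x
    intro X Y
    simp only [Ring.lie_def, ← key]
    ext i j
    simp [mul_sub]
  invFun Y := Matrix.of fun u v => c (σ.symm u) * c (σ.symm v) * Y (σ.symm u) (σ.symm v)
  left_inv X := by
    ext u v
    simp only [Matrix.of_apply, Equiv.apply_symm_apply]
    linear_combination X u v * (c (σ.symm u) * c (σ.symm u) * hc (σ.symm v) + hc (σ.symm u))
  right_inv Y := by
    ext i j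
    simp only [Matrix.of_apply, Equiv.symm_apply_apply]
    linear_combination Y i j * (c i * c i * hc j + hc i)

variable {σ : ι ≃ κ} {c : ι → ℂ} (hc : ∀ i, c i * c i = 1)

theorem signedReindex_apply (X : Matrix κ κ ℂ) (i j : ι) :
    signedReindex σ c hc X i j = c i * c j * X (σ i) (σ j) := rfl

theorem signedReindex_symm_apply (Y : Matrix ι ι ℂ) (i j : ι) :
    (signedReindex σ c hc).symm Y (σ i) (σ j) = c i * c j * Y i j := by
  change c (σ.symm (σ i)) * c (σ.symm (σ j)) * Y (σ.symm (σ i)) (σ.symm (σ j)) = _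
  simp only [Equiv.symm_apply_apply]

theorem trace_signedReindex_mul (X Y : Matrix κ κ ℂ) :
    (signedReindex σ c hc X * signedReindex σ c hc Y).trace = (X * Y).trace := by
  simp only [Matrix.trace, Matrix.diag_apply, Matrix.mul_apply, signedReindex_apply]
  rw [← Equiv.sum_comp σ]
  refine Finset.sum_congr rfl fun i _ => ?_
  rw [← Equiv.sum_comp σ]
  refine Finset.sum_congr rfl fun j _ => ?_
  linear_combination (X (σ i) (σ j) * Y (σ j) (σ i)) * (c i * c i * hc j + hc i)

/-- The bilinear form that pairs the basis vectors `i` and `ρ i` with value `s i`. -/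
def pairingForm (ρ : ι → ι) (s : ι → ℂ) : Matrix ι ι ℂ :=
  Matrix.of fun i j => if j = ρ i then s i else 0

/-- The forms `JD`, `J`, `antiDiag` and `oddForm` are all of this shape, so one entrywise criterion
serves every target. -/
theorem isSkewAdjoint_pairingForm {ρ : ι → ι} (hρ : ∀ i, ρ (ρ i) = i) {s : ι → ℂ}
    (hs : ∀ i, s i * s i = 1) (Y : Matrix ι ι ℂ) :
    (pairingForm ρ s).IsSkewAdjoint Y ↔
      ∀ i j, Y i j = -(s (ρ i) * s (ρ j) * Y (ρ j) (ρ i)) := by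
  have hρ' : ∀ i j, j = ρ i ↔ i = ρ j := fun i j =>
    ⟨fun h => by rw [h, hρ], fun h => by rw [h, hρ]⟩
  have h1 : ∀ i j, (Y.transpose * pairingForm ρ s) i j = Y (ρ j) i * s (ρ j) := by
    intro i j
    simp [Matrix.mul_apply, pairingForm, hρ' _ j]
  have h2 : ∀ i j, (pairingForm ρ s * -Y) i j = -(s i * Y (ρ i) j) := by
    intro i j
    simp [Matrix.mul_apply, pairingForm]
  unfold Matrix.IsSkewAdjoint Matrix.IsAdjointPair
  rw [← Matrix.ext_iff]
  simp only [h1, h2]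
  constructor
  · intro h i j
    have h3 := h (ρ i) j
    rw [hρ] at h3
    linear_combination (s (ρ i)) * h3 - Y i j * hs (ρ i)
  · intro h i j
    have h3 := h (ρ i) j
    rw [hρ] at h3
    linear_combination (s i) * h3 - (Y (ρ j) i * s (ρ j)) * hs i

end SignedReindex

/-! ### The bilinear form preserved by the folded algebra -/

section FoldedTargets

variable {N p : ℕ} {θ₀ : ℤˣ} (θ : Signs N θ₀)

/-- The signs of the bilinear form that is preserved by `gl(Np)^τ`. -/
def formSign (u : Fin N × Fin p) : ℂ := θ.val u.1 * (-1) ^ (u.2 : ℕ)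

theorem neg_one_pow_mul_self (k : ℕ) : ((-1 : ℂ)) ^ k * (-1) ^ k = 1 := by
  rw [← pow_add, ← two_mul, pow_mul]; simp

theorem formSign_mul_self (u : Fin N × Fin p) : formSign θ u * formSign θ u = 1 := by
  have h := neg_one_pow_mul_self (u.2 : ℕ)
  rw [formSign]
  linear_combination (θ.val u.1 * θ.val u.1) * h + θ.sq u.1

/-- This is the entrywise condition of skew-adjointness for the form pairing `u` with its reversal
with sign `formSign θ u`; passing to reversed indices does not change the product of two signs. -/
theorem mem_glTau_iff (X : gl N p) : X ∈ glTau θ p ↔ ∀ u v, X u v =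
    -(formSign θ u * formSign θ v * X (v.1.rev, v.2.rev) (u.1.rev, u.2.rev)) := by
  rw [mem_glTau, ← Matrix.ext_iff]
  refine forall_congr' fun u => forall_congr' fun v => ?_
  rw [tau_apply, eq_comm, formSign, formSign, pow_add]
  refine Eq.congr_right ?_
  ring

/-- The signed permutations that carry the form preserved by `gl(Np)^τ` to a given form. -/
structure FormEquiv {ι : Type} [Fintype ι] [DecidableEq ι] (σ : ι ≃ Fin N × Fin p) (c : ι → ℂ)
    (ρ : ι → ι) (s : ι → ℂ) (ε : ℂ) : Prop where
  c_sq : ∀ i, c i * c i = 1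
  s_sq : ∀ i, s i * s i = 1
  ε_sq : ε * ε = 1
  invol : ∀ i, ρ (ρ i) = i
  rev : ∀ i, σ (ρ i) = ((σ i).1.rev, (σ i).2.rev)
  sign : ∀ i, c i * c (ρ i) * s (ρ i) = ε * formSign θ (σ i)

variable {θ} {ι : Type} [Fintype ι] [DecidableEq ι] {σ : ι ≃ Fin N × Fin p} {c : ι → ℂ}
  {ρ : ι → ι} {s : ι → ℂ} {ε : ℂ}

/-- The signs enter the skew-adjointness condition in pairs, so the global factor `ε` cancels:
proportional forms have the same Lie algebra. -/
theorem FormEquiv.mem_iff (h : FormEquiv θ σ c ρ s ε) (X : gl N p) :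
    X ∈ glTau θ p ↔ signedReindex σ c h.c_sq X ∈
      skewAdjointMatricesLieSubalgebra (pairingForm ρ s) := by
  rw [mem_skewAdjointMatricesLieSubalgebra, mem_skewAdjointMatricesSubmodule,
    isSkewAdjoint_pairingForm h.invol h.s_sq, mem_glTau_iff]
  have key : ∀ i j, (signedReindex σ c h.c_sq X i j =
      -(s (ρ i) * s (ρ j) * signedReindex σ c h.c_sq X (ρ j) (ρ i))) ↔ X (σ i) (σ j) =
      -(formSign θ (σ i) * formSign θ (σ j) * X ((σ j).1.rev, (σ j).2.rev)
        ((σ i).1.rev, (σ i).2.rev)) := by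
    intro i j
    rw [signedReindex_apply, signedReindex_apply, h.rev, h.rev]
    have h1 := h.sign i
    have h2 := h.sign j
    have h3 : formSign θ (σ i) * formSign θ (σ j) =
        (c i * c (ρ i) * s (ρ i)) * (c j * c (ρ j) * s (ρ j)) := by
      rw [h1, h2]
      linear_combination (-formSign θ (σ i) * formSign θ (σ j)) * h.ε_sq
    rw [h3]
    have hi := h.c_sq i
    have hj := h.c_sq j
    constructor
    · intro h4
      linear_combination (c i * c j) * h4 - X (σ i) (σ j) * (c i * c i * hj + hi)
    · intro h4
      rw [h4]
      linear_combination (-(s (ρ i) * s (ρ j) * c (ρ i) * c (ρ j) *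
        X ((σ j).1.rev, (σ j).2.rev) ((σ i).1.rev, (σ i).2.rev))) * (c i * c i * hj + hi)
  simp only [key]
  exact ⟨fun h i j => h _ _, fun h u v => by simpa using h (σ.symm u) (σ.symm v)⟩

/-- The isomorphism of `gl(Np)^τ` with the Lie algebra of a form. -/
def FormEquiv.lieEquiv (h : FormEquiv θ σ c ρ s ε) {S : Matrix ι ι ℂ} (hS : S = pairingForm ρ s) :
    glTau θ p ≃ₗ⁅ℂ⁆ skewAdjointMatricesLieSubalgebra S where
  toFun x := ⟨signedReindex σ c h.c_sq x, hS ▸ (h.mem_iff x).1 x.2⟩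
  map_add' x y := Subtype.ext (map_add (signedReindex σ c h.c_sq) (x : gl N p) y)
  map_smul' r x := Subtype.ext (map_smul (signedReindex σ c h.c_sq) r (x : gl N p))
  map_lie' {x y} := Subtype.ext (LieEquiv.map_lie (signedReindex σ c h.c_sq) (x : gl N p) y)
  invFun y := ⟨(signedReindex σ c h.c_sq).symm y, by
    rw [h.mem_iff, LieEquiv.apply_symm_apply]
    exact hS ▸ y.2⟩
  left_inv x := Subtype.ext ((signedReindex σ c h.c_sq).symm_apply_apply (x : gl N p))
  right_inv y := Subtype.ext ((signedReindex σ c h.c_sq).apply_symm_apply (y : Matrix ι ι ℂ))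

/-- Identification of `gl(Np)^τ` with the Lie algebra of a form. -/
theorem FormEquiv.foldsTo (h : FormEquiv θ σ c ρ s ε) {S : Matrix ι ι ℂ}
    (hS : S = pairingForm ρ s) {H : LieSubalgebra ℂ (Matrix ι ι ℂ)}
    {e f : skewAdjointMatricesLieSubalgebra S}
    (he : signedReindex σ c h.c_sq (blockE N p) = e)
    (hf : signedReindex σ c h.c_sq (blockF N p) = f)
    (h₁ : ∀ X ∈ glTau θ p, X ∈ nSl N p → signedReindex σ c h.c_sq X ∈ H)
    (h₂ : H ≤ (nSl N p).map (signedReindex σ c h.c_sq : gl N p →ₗ⁅ℂ⁆ Matrix ι ι ℂ)) :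
    FoldsTo θ p (skewAdjointMatricesLieSubalgebra S) H e f ∧
      IsWAlgebra (foldBracket θ p) (skewAdjointMatricesLieSubalgebra S) e f := by
  have he' : h.lieEquiv hS (glE θ p) = e := Subtype.ext he
  have hf' : h.lieEquiv hS (glF θ p) = f := Subtype.ext hf
  refine ⟨⟨h.lieEquiv hS, fun x => ⟨h₁ x x.2, fun hx => ?_⟩, he', hf'⟩,
    isWAlgebra_foldBracket θ (h.lieEquiv hS) he' hf' fun x y => trace_signedReindex_mul _ _ _⟩
  obtain ⟨y, hy, hyx⟩ := h₂ hx
  have : y = (x : gl N p) := (signedReindex σ c h.c_sq).injective hyx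
  exact this ▸ hy

end FoldedTargets

/-! ## Identification of the folded algebras -/

section Identification

open Matrix LieAlgebra

variable {N n p : ℕ} {θ₀ : ℤˣ} (θ : Signs N θ₀)

theorem neg_one_pow_val_mul_rev (k : Fin p) :
    ((-1 : ℂ)) ^ (k : ℕ) * (-1) ^ (k.rev : ℕ) = (-1) ^ (p - 1) := by
  rw [← pow_add, Fin.val_rev]
  congr 1
  have := k.2
  omega

/-- The symmetry type of the form: symmetric if the right side is `1`, alternating if it is `-1`. -/
theorem formSign_mul_rev (u : Fin N × Fin p) :
    formSign θ u * formSign θ (u.1.rev, u.2.rev) = ((θ₀ : ℤ) : ℂ) * (-1) ^ (p - 1) := by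
  have h1 : θ.val u.1 * θ.val u.1.rev = ((θ₀ : ℤ) : ℂ) := by
    unfold Signs.val
    rw [← Int.cast_mul, ← Units.val_mul, θ.2 u.1]
  rw [formSign, formSign, ← h1, ← neg_one_pow_val_mul_rev u.2]
  ring

/-- The blocks at `a` and at its reversal determine each other by negative transposition, up to a
signed reversal of the inner indices. This is the source of the shape `diag(X, -Xᵗ)`. -/
theorem glTau_apply_rev {X : gl N p} (hX : X ∈ glTau θ p) (a : Fin N) (k l : Fin p) :
    (-1 : ℂ) ^ (k : ℕ) * (-1) ^ (l : ℕ) * X (a.rev, k.rev) (a.rev, l.rev) =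
      -X (a, l) (a, k) := by
  rw [(mem_glTau_iff θ X).1 hX (a, l) (a, k), formSign, formSign]
  linear_combination (-((-1 : ℂ) ^ (k : ℕ) * (-1) ^ (l : ℕ) * X (a.rev, k.rev) (a.rev, l.rev))) *
    θ.sq a

theorem blockE_apply_of_ne {B : Matrix (Fin p) (Fin p) ℂ} (u v : Fin N × Fin p) (h : u.1 ≠ v.1) :
    ((1 : Matrix (Fin N) (Fin N) ℂ) ⊗ₖ B) u v = 0 := by
  rw [kroneckerMap_apply, one_apply_ne h, zero_mul]

/-- The first `n` of at least `2 n` indices. -/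
def lowIndex (h : 2 * n ≤ N) (b : Fin n) : Fin N := ⟨b, by have := b.2; omega⟩

/-- The two indices paired by the form that belong to the same element of `Fin n`. -/
def pairIndex (h : 2 * n ≤ N) : (Fin p × Fin n) ⊕ (Fin p × Fin n) → Fin N × Fin p :=
  Sum.elim (fun i => (lowIndex h i.2, i.1)) fun i => ((lowIndex h i.2).rev, i.1.rev)

theorem lowIndex_injective (h : 2 * n ≤ N) : Function.Injective (lowIndex h) := by
  intro b b' hb
  simp only [lowIndex, Fin.mk.injEq] at hb
  exact Fin.ext hb

theorem lowIndex_ne_rev (h : 2 * n ≤ N) (b b' : Fin n) : lowIndex h b ≠ (lowIndex h b').rev := by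
  intro hb
  have hb := congrArg Fin.val hb
  simp only [lowIndex, Fin.val_rev] at hb
  have := b.2
  have := b'.2
  omega

theorem pairIndex_injective (h : 2 * n ≤ N) :
    Function.Injective (pairIndex h : (Fin p × Fin n) ⊕ (Fin p × Fin n) → Fin N × Fin p) := by
  rintro (⟨k, b⟩ | ⟨k, b⟩) (⟨l, b'⟩ | ⟨l, b'⟩) hi <;>
    simp only [pairIndex, Sum.elim_inl, Sum.elim_inr, Prod.mk.injEq, Fin.rev_inj] at hi
  · rw [lowIndex_injective h hi.1, hi.2]
  · exact absurd hi.1 (lowIndex_ne_rev h b b')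
  · exact absurd hi.1.symm (lowIndex_ne_rev h b' b)
  · rw [lowIndex_injective h hi.1, hi.2]

theorem pairIndex_swap (h : 2 * n ≤ N) (i : (Fin p × Fin n) ⊕ (Fin p × Fin n)) :
    pairIndex h i.swap = ((pairIndex h i).1.rev, (pairIndex h i).2.rev) := by
  rcases i with ⟨k, b⟩ | ⟨k, b⟩ <;> simp [pairIndex]

/-- The signs that make a signed permutation out of `pairIndex`. -/
def pairSign (h : 2 * n ≤ N) (ε : ℂ) : (Fin p × Fin n) ⊕ (Fin p × Fin n) → ℂ :=
  Sum.elim (fun _ => 1) fun i => ε * formSign θ (lowIndex h i.2, i.1)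

theorem pairSign_mul_self (h : 2 * n ≤ N) {ε : ℂ} (hε : ε * ε = 1)
    (i : (Fin p × Fin n) ⊕ (Fin p × Fin n)) : pairSign θ h ε i * pairSign θ h ε i = 1 := by
  rcases i with i | i
  · simp [pairSign]
  · have h1 := formSign_mul_self θ (lowIndex h i.2, i.1)
    simp only [pairSign, Sum.elim_inr]
    linear_combination ε * ε * h1 + hε

/-- The assumption on `η` is guarded by an element of `Fin p`: for `p = 0` the truncated exponent `p
- 1` is `0` and gives the wrong parity, but then there are no indices to check. -/
theorem pairSign_mul_swap (h : 2 * n ≤ N) {ε η : ℂ}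
    (hη : Fin p → ((θ₀ : ℤ) : ℂ) * (-1) ^ (p - 1) = η) (i : (Fin p × Fin n) ⊕ (Fin p × Fin n)) :
    pairSign θ h ε i * pairSign θ h ε i.swap * Sum.elim (fun _ => η) (fun _ => 1) i.swap =
      ε * formSign θ (pairIndex h i) := by
  rcases i with ⟨k, b⟩ | ⟨k, b⟩
  · simp [pairSign, pairIndex]
  · have h1 := formSign_mul_rev θ (lowIndex h b, k)
    have h2 := formSign_mul_self θ (lowIndex h b, k)
    rw [hη k] at h1
    simp only [pairSign, pairIndex, Sum.swap_inr, Sum.elim_inl, Sum.elim_inr, mul_one]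
    rw [← h1]
    linear_combination ε * formSign θ ((lowIndex h b).rev, k.rev) * h2

theorem dbl_inl_inl (x : Fin n → Matrix (Fin p) (Fin p) ℂ) (i j : Fin p × Fin n) :
    dbl x (Sum.inl i) (Sum.inl j) = if i.2 = j.2 then x i.2 i.1 j.1 else 0 :=
  blockDiagonal_apply x i j

theorem dbl_inr_inr (x : Fin n → Matrix (Fin p) (Fin p) ℂ) (i j : Fin p × Fin n) :
    dbl x (Sum.inr i) (Sum.inr j) = -if j.2 = i.2 then x j.2 j.1 i.1 else 0 :=
  congrArg Neg.neg (blockDiagonal_apply x j i)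

/-- A block diagonal element of `gl(Np)^τ` has the form `diag(X, -Xᵗ)`. -/
theorem pairSign_mul_apply (h : 2 * n ≤ N) {ε : ℂ} (hε : ε * ε = 1) {X : gl N p}
    (hX : X ∈ glTau θ p) (hX' : ∀ u v : Fin N × Fin p, u.1 ≠ v.1 → X u v = 0)
    (i j : (Fin p × Fin n) ⊕ (Fin p × Fin n)) :
    pairSign θ h ε i * pairSign θ h ε j * X (pairIndex h i) (pairIndex h j) =
      dbl (fun b => Matrix.of fun k l => X (lowIndex h b, k) (lowIndex h b, l)) i j := by
  rcases i with ⟨k, b⟩ | ⟨k, b⟩ <;> rcases j with ⟨l, b'⟩ | ⟨l, b'⟩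
  · by_cases hb : b = b'
    · subst hb
      simp [pairSign, pairIndex, dbl_inl_inl]
    · rw [hX' _ _ fun h1 => hb (lowIndex_injective h h1), mul_zero, dbl_inl_inl, if_neg hb]
  · rw [hX' _ _ (lowIndex_ne_rev h b b'), mul_zero]
    simp [dbl]
  · rw [hX' _ _ (lowIndex_ne_rev h b' b).symm, mul_zero]
    simp [dbl]
  · by_cases hb : b = b'
    · subst hb
      have h1 := glTau_apply_rev θ hX (lowIndex h b) k l
      have h2 := θ.sq (lowIndex h b)
      simp only [pairSign, pairIndex, dbl_inr_inr, Sum.elim_inr, if_true, of_apply, formSign]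
      linear_combination (ε * ε * θ.val (lowIndex h b) * θ.val (lowIndex h b)) * h1 -
        X (lowIndex h b, l) (lowIndex h b, k) * (ε * ε * h2 + hε)
    · rw [hX' _ _ fun h1 => hb (lowIndex_injective h (Fin.rev_injective h1)), mul_zero,
        dbl_inr_inr, if_neg (Ne.symm hb), neg_zero]

theorem dbl_apply_of_ne (h : 2 * n ≤ N) (x : Fin n → Matrix (Fin p) (Fin p) ℂ)
    {i j : (Fin p × Fin n) ⊕ (Fin p × Fin n)} (hij : (pairIndex h i).1 ≠ (pairIndex h j).1) :
    dbl x i j = 0 := by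
  rcases i with ⟨k, b⟩ | ⟨k, b⟩ <;> rcases j with ⟨l, b'⟩ | ⟨l, b'⟩
  · rw [dbl_inl_inl, if_neg fun h1 => hij (congrArg (lowIndex h) h1)]
  · simp [dbl]
  · simp [dbl]
  · rw [dbl_inr_inr, if_neg fun h1 => hij (congrArg (fun b => (lowIndex h b).rev) h1.symm), neg_zero]

/-- The diagonal blocks of a matrix that corresponds to `dbl x` are traceless if the `x i` are. -/
theorem sum_diag_pairIndex (h : 2 * n ≤ N) {Y : gl N p} {x : Fin n → Matrix (Fin p) (Fin p) ℂ}
    (hx : ∀ i, (x i).trace = 0) (hY : ∀ i, Y (pairIndex h i) (pairIndex h i) = dbl x i i)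
    {a : Fin N} (ha : (a : ℕ) < n ∨ N < a + n + 1) : ∑ k, Y (a, k) (a, k) = 0 := by
  have hinl : ∀ b, ∑ k, dbl x (Sum.inl (k, b)) (Sum.inl (k, b)) = 0 := fun b => by
    simpa [dbl_inl_inl, Matrix.trace] using hx b
  have hinr : ∀ b, ∑ k, dbl x (Sum.inr (k, b)) (Sum.inr (k, b)) = 0 := fun b => by
    simpa [dbl_inr_inr, Matrix.trace] using hx b
  rcases ha with ha | ha
  · rw [← hinl ⟨a, ha⟩]
    exact Finset.sum_congr rfl fun k _ => hY (Sum.inl (k, ⟨a, ha⟩))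
  -- In the upper half the block is the `-xᵗ` part, with inner index reversed. A middle index,
  -- present for odd `N`, is excluded by `ha`.
  · have hb : (a.rev : ℕ) < n := by rw [Fin.val_rev]; omega
    have hb' : (lowIndex h ⟨a.rev, hb⟩).rev = a := by
      rw [lowIndex, Fin.eta, Fin.rev_rev]
    rw [← hinr ⟨a.rev, hb⟩, ← Equiv.sum_comp Fin.revPerm]
    refine Finset.sum_congr rfl fun k _ => ?_
    rw [← hY (Sum.inr (k, ⟨a.rev, hb⟩)), pairIndex, Sum.elim_inr, hb']
    rfl

/-! ### `N = 2n` -/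

section Even

variable {θ₀ : ℤˣ} (θ : Signs (2 * n) θ₀)

/-- The bijection of the indices for even `N`. -/
def evenIndex (n p : ℕ) : ((Fin p × Fin n) ⊕ (Fin p × Fin n)) ≃ Fin (2 * n) × Fin p :=
  Equiv.ofBijective (pairIndex le_rfl) ((Fintype.bijective_iff_injective_and_card _).2
    ⟨pairIndex_injective le_rfl, by
      simp only [Fintype.card_sum, Fintype.card_prod, Fintype.card_fin]; ring⟩)

theorem evenIndex_apply (i : (Fin p × Fin n) ⊕ (Fin p × Fin n)) :
    evenIndex n p i = pairIndex le_rfl i := rfl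

theorem formEquiv_even {η : ℂ} (hη : Fin p → ((θ₀ : ℤ) : ℂ) * (-1) ^ (p - 1) = η) (hη' : η * η = 1) :
    FormEquiv θ (evenIndex n p) (pairSign θ le_rfl 1) Sum.swap
      (Sum.elim (fun _ => η) fun _ => 1) 1 where
  c_sq := pairSign_mul_self θ le_rfl (mul_one 1)
  s_sq i := by
    rcases i with i | i
    · exact hη'
    · simp
  ε_sq := mul_one 1
  invol := Sum.swap_swap
  rev := pairIndex_swap le_rfl
  sign := pairSign_mul_swap θ le_rfl hη

theorem signedReindex_even {η : ℂ} (h : FormEquiv θ (evenIndex n p) (pairSign θ le_rfl 1) Sum.swap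
      (Sum.elim (fun _ => η) fun _ => 1) 1) {X : gl (2 * n) p} (hX : X ∈ glTau θ p)
    (hX' : ∀ u v : Fin (2 * n) × Fin p, u.1 ≠ v.1 → X u v = 0) :
    signedReindex (evenIndex n p) (pairSign θ le_rfl 1) h.c_sq X =
      dbl fun b => Matrix.of fun k l => X (lowIndex le_rfl b, k) (lowIndex le_rfl b, l) := by
  ext i j
  exact pairSign_mul_apply θ le_rfl (mul_one 1) hX hX' i j

theorem signedReindex_even_kronecker {η : ℂ}
    (h : FormEquiv θ (evenIndex n p) (pairSign θ le_rfl 1) Sum.swap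
      (Sum.elim (fun _ => η) fun _ => 1) 1) {B : Matrix (Fin p) (Fin p) ℂ} (hB : flip p B = -B) :
    signedReindex (evenIndex n p) (pairSign θ le_rfl 1) h.c_sq (1 ⊗ₖ B) = dbl fun _ => B := by
  rw [signedReindex_even θ h (one_kronecker_mem θ p hB) blockE_apply_of_ne]
  congr 1
  ext b k l
  simp

/-- The identification of the folded algebras for even `N`. -/
theorem foldsTo_even {η : ℂ} (hη : Fin p → ((θ₀ : ℤ) : ℂ) * (-1) ^ (p - 1) = η) (hη' : η * η = 1)
    {S : Matrix ((Fin p × Fin n) ⊕ (Fin p × Fin n)) ((Fin p × Fin n) ⊕ (Fin p × Fin n)) ℂ}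
    (hS : S = pairingForm Sum.swap (Sum.elim (fun _ => η) fun _ => 1))
    {e f : skewAdjointMatricesLieSubalgebra S} (he : e.1 = dbl fun _ => ePlus p)
    (hf : f.1 = dbl fun _ => eMinus p) :
    FoldsTo θ p (skewAdjointMatricesLieSubalgebra S) (nSlEven n p) e f ∧
      IsWAlgebra (foldBracket θ p) (skewAdjointMatricesLieSubalgebra S) e f := by
  have h := formEquiv_even (p := p) θ hη hη'
  refine h.foldsTo hS ?_ ?_ ?_ ?_
  · rw [he]
    exact signedReindex_even_kronecker θ h flip_ePlus
  · rw [hf]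
    exact signedReindex_even_kronecker θ h flip_eMinus
  · intro X hX hX'
    rw [mem_nSl_iff] at hX'
    rw [signedReindex_even θ h hX hX'.1]
    refine LieSubalgebra.subset_lieSpan ⟨_, ?_, rfl⟩
    exact fun b => hX'.2 (lowIndex le_rfl b)
  · rw [nSlEven, LieSubalgebra.lieSpan_le]
    rintro _ ⟨x, hx, rfl⟩
    refine ⟨(signedReindex (evenIndex n p) _ h.c_sq).symm (dbl x), ?_,
      LieEquiv.apply_symm_apply _ _⟩
    change _ ∈ nSl (2 * n) p
    rw [mem_nSl_iff]
    constructor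
    · intro u v huv
      obtain ⟨i, rfl⟩ := (evenIndex n p).surjective u
      obtain ⟨j, rfl⟩ := (evenIndex n p).surjective v
      rw [signedReindex_symm_apply, dbl_apply_of_ne le_rfl x huv, mul_zero]
    · intro a
      refine sum_diag_pairIndex le_rfl hx (fun i => ?_) (by omega)
      rw [← evenIndex_apply, signedReindex_symm_apply, h.c_sq, one_mul]

end Even

/-! ### `N = 2n + 1` -/

section OddCase

variable {θ₀ : ℤˣ} (θ : Signs (2 * n + 1) θ₀)

/-- The index that is fixed by the reversal. -/
def midIndex (n : ℕ) : Fin (2 * n + 1) := ⟨n, by omega⟩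

theorem rev_midIndex : (midIndex n).rev = midIndex n := by
  ext
  simp only [midIndex, Fin.val_rev]
  omega

theorem lowIndex_ne_midIndex (b : Fin n) : lowIndex (Nat.le_succ _) b ≠ midIndex n := by
  intro h
  have := congrArg Fin.val h
  simp only [lowIndex, midIndex] at this
  omega

theorem pairIndex_ne_midIndex (i : (Fin p × Fin n) ⊕ (Fin p × Fin n)) :
    (pairIndex (Nat.le_succ (2 * n)) i).1 ≠ midIndex n := by
  rcases i with ⟨k, b⟩ | ⟨k, b⟩
  · exact lowIndex_ne_midIndex b
  · intro h
    refine lowIndex_ne_midIndex b (Fin.rev_injective ?_)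
    rw [rev_midIndex]
    exact h

/-- The bijection of the indices for odd `N`. -/
def oddIndex (n p : ℕ) :
    (Fin p ⊕ ((Fin p × Fin n) ⊕ (Fin p × Fin n))) ≃ Fin (2 * n + 1) × Fin p :=
  Equiv.ofBijective (Sum.elim (fun k => (midIndex n, k)) (pairIndex (Nat.le_succ _)))
    ((Fintype.bijective_iff_injective_and_card _).2 ⟨by
      refine Function.Injective.sumElim ?_ (pairIndex_injective _) fun k i h => ?_
      · exact fun k l h => congrArg Prod.snd h
      · exact pairIndex_ne_midIndex i (congrArg Prod.fst h).symm, by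
      simp only [Fintype.card_sum, Fintype.card_prod, Fintype.card_fin]; ring⟩)

theorem oddIndex_inl (k : Fin p) : oddIndex n p (Sum.inl k) = (midIndex n, k) := rfl

theorem oddIndex_inr (i : (Fin p × Fin n) ⊕ (Fin p × Fin n)) :
    oddIndex n p (Sum.inr i) = pairIndex (Nat.le_succ _) i := rfl

/-- The signs that make a signed permutation out of `oddIndex`. -/
def oddSign : Fin p ⊕ ((Fin p × Fin n) ⊕ (Fin p × Fin n)) → ℂ :=
  Sum.elim (fun _ => 1) (pairSign θ (Nat.le_succ _) (θ.val (midIndex n)))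

/-- The pairing of the indices given by `oddForm`. -/
def oddPairing : Fin p ⊕ ((Fin p × Fin n) ⊕ (Fin p × Fin n)) →
    Fin p ⊕ ((Fin p × Fin n) ⊕ (Fin p × Fin n)) := Sum.map Fin.rev Sum.swap

theorem oddForm_eq_pairingForm : oddForm n p =
    pairingForm oddPairing (Sum.elim (fun k : Fin p => (-1) ^ (k : ℕ))
      (Sum.elim (fun _ => 1) fun _ => 1)) := by
  ext (k | i | i) (l | j | j) <;>
    simp [oddForm, pairingForm, oddPairing, antiDiag, Orthogonal.JD, one_apply, eq_comm]

theorem isSkewAdjoint_antiDiag_iff (Y : Matrix (Fin p) (Fin p) ℂ) :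
    (antiDiag p).IsSkewAdjoint Y ↔ ∀ k l, Y k l =
      -((-1) ^ (k.rev : ℕ) * (-1) ^ (l.rev : ℕ) * Y l.rev k.rev) :=
  isSkewAdjoint_pairingForm Fin.rev_rev (fun k => neg_one_pow_mul_self (k : ℕ)) Y

/-- On the diagonal the signs square to `1`, so reversing the indices gives `tr Y = -tr Y`.
Tracelessness of the middle block thus comes for free. -/
theorem trace_of_isSkewAdjoint_antiDiag {Y : Matrix (Fin p) (Fin p) ℂ}
    (hY : (antiDiag p).IsSkewAdjoint Y) : Y.trace = 0 := by
  rw [isSkewAdjoint_antiDiag_iff] at hY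
  have h : Y.trace = -Y.trace := by
    refine (Finset.sum_congr rfl fun k _ => (diag_apply Y k).trans (hY k k)).trans ?_
    simp only [neg_one_pow_mul_self, one_mul, Finset.sum_neg_distrib, Matrix.trace, diag_apply]
    rw [neg_inj]
    exact Equiv.sum_comp Fin.revPerm fun k => Y k k
  exact self_eq_neg.1 h

/-- The middle index is its own reversal, so `θ₀` is a square; this leaves only the orthogonal case
for odd `N` and `p`. -/
theorem signs_odd_eq_one {θ₀ : ℤˣ} (θ : Signs (2 * n + 1) θ₀) : ((θ₀ : ℤ) : ℂ) = 1 := by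
  have h := θ.2 (midIndex n)
  rw [rev_midIndex, Int.units_mul_self] at h
  rw [← h]
  simp

/-- On the middle block the preserved form is `θ^{n+1}` times `antiDiag`, a sign that no signed
permutation by `1`s removes. It is taken as the global factor `ε`, and `pairSign` compensates on the
other blocks. Oddness of `p` makes `(-1)^k` invariant under reversal of `k`. -/
theorem formEquiv_odd (hp : Odd p) : FormEquiv θ (oddIndex n p) (oddSign θ) oddPairing
    (Sum.elim (fun k : Fin p => (-1) ^ (k : ℕ)) (Sum.elim (fun _ => 1) fun _ => 1))
    (θ.val (midIndex n)) where
  c_sq i := by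
    rcases i with k | i
    · simp [oddSign]
    · exact pairSign_mul_self θ _ (θ.sq _) i
  s_sq i := by
    rcases i with k | i | i
    · exact neg_one_pow_mul_self (k : ℕ)
    · simp
    · simp
  ε_sq := θ.sq _
  invol i := by rcases i with k | i | i <;> simp [oddPairing]
  rev i := by
    rcases i with k | i
    · rw [oddIndex_inl, rev_midIndex]
      rfl
    · exact pairIndex_swap _ i
  sign i := by
    have h1 : ((-1 : ℂ)) ^ (p - 1) = 1 := Even.neg_one_pow (Nat.Odd.sub_odd hp odd_one)
    rcases i with k | i
    · have h2 := neg_one_pow_val_mul_rev k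
      have h3 := neg_one_pow_mul_self (k : ℕ)
      have h4 := θ.sq (midIndex n)
      rw [h1] at h2
      rw [oddIndex_inl, formSign]
      simp only [oddSign, oddPairing, Sum.map_inl, Sum.elim_inl, one_mul]
      linear_combination (-1 : ℂ) ^ (k : ℕ) * h2 - (-1 : ℂ) ^ (k.rev : ℕ) * h3 -
        (-1 : ℂ) ^ (k : ℕ) * h4
    · exact pairSign_mul_swap θ _ (fun _ => by rw [h1, signs_odd_eq_one θ, one_mul]) i

theorem signedReindex_odd (hp : Odd p) {X : gl (2 * n + 1) p} (hX : X ∈ glTau θ p)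
    (hX' : ∀ u v : Fin (2 * n + 1) × Fin p, u.1 ≠ v.1 → X u v = 0) :
    signedReindex (oddIndex n p) (oddSign θ) (formEquiv_odd θ hp).c_sq X =
      fromBlocks (Matrix.of fun k l => X (midIndex n, k) (midIndex n, l)) 0 0
        (dbl fun b => Matrix.of fun k l => X (lowIndex (Nat.le_succ _) b, k)
          (lowIndex (Nat.le_succ _) b, l)) := by
  ext (k | i) (l | j)
  · rw [signedReindex_apply, oddIndex_inl, oddIndex_inl]
    simp [oddSign]
  · rw [signedReindex_apply, oddIndex_inl, oddIndex_inr,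
      hX' _ _ (pairIndex_ne_midIndex j).symm, mul_zero]
    rfl
  · rw [signedReindex_apply, oddIndex_inl, oddIndex_inr,
      hX' _ _ (pairIndex_ne_midIndex i), mul_zero]
    rfl
  · exact pairSign_mul_apply θ _ (θ.sq _) hX hX' i j

theorem signedReindex_odd_kronecker (hp : Odd p) {B : Matrix (Fin p) (Fin p) ℂ}
    (hB : flip p B = -B) :
    signedReindex (oddIndex n p) (oddSign θ) (formEquiv_odd θ hp).c_sq (1 ⊗ₖ B) =
      fromBlocks B 0 0 (dbl fun _ => B) := by
  rw [signedReindex_odd θ hp (one_kronecker_mem θ p hB) blockE_apply_of_ne]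
  congr 2
  · ext k l
    simp
  · ext b k l
    simp

/-- The identification of the folded algebras for odd `N`. -/
theorem foldsTo_odd (hp : Odd p) :
    FoldsTo θ p (soOdd n p) (nSlOdd n p) (soOddE n p) (soOddF n p) ∧
      IsWAlgebra (foldBracket θ p) (soOdd n p) (soOddE n p) (soOddF n p) := by
  have h := formEquiv_odd (p := p) θ hp
  refine h.foldsTo oddForm_eq_pairingForm (signedReindex_odd_kronecker θ hp flip_ePlus)
    (signedReindex_odd_kronecker θ hp flip_eMinus) ?_ ?_
  · intro X hX hX'
    rw [mem_nSl_iff] at hX'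
    rw [signedReindex_odd θ hp hX hX'.1]
    refine LieSubalgebra.subset_lieSpan ⟨_, _, isSkewAdjoint_antiDiag ?_, ?_, rfl⟩
    · ext k l
      have h1 := glTau_apply_rev θ hX (midIndex n) l k
      rw [rev_midIndex] at h1
      refine Eq.trans ?_ h1
      simp only [flip, of_apply, pow_add]
      ring
    · exact fun b => hX'.2 (lowIndex (Nat.le_succ _) b)
  · rw [nSlOdd, LieSubalgebra.lieSpan_le]
    rintro _ ⟨y, x, hy, hx, rfl⟩
    refine ⟨(signedReindex (oddIndex n p) _ h.c_sq).symm (fromBlocks y 0 0 (dbl x)), ?_,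
      LieEquiv.apply_symm_apply _ _⟩
    change _ ∈ nSl (2 * n + 1) p
    rw [mem_nSl_iff]
    constructor
    · intro u v huv
      obtain ⟨i, rfl⟩ := (oddIndex n p).surjective u
      obtain ⟨j, rfl⟩ := (oddIndex n p).surjective v
      rw [signedReindex_symm_apply]
      rcases i with k | i <;> rcases j with l | j
      · exact absurd rfl huv
      · simp
      · simp
      · rw [fromBlocks_apply₂₂, dbl_apply_of_ne _ x huv, mul_zero]
    · intro a
      by_cases ha : a = midIndex n
      · rw [ha, ← trace_of_isSkewAdjoint_antiDiag hy]
        refine Finset.sum_congr rfl fun k _ => ?_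
        rw [← oddIndex_inl, signedReindex_symm_apply, h.c_sq, one_mul]
        rfl
      · have ha' : (a : ℕ) ≠ n := fun h => ha (Fin.ext h)
        refine sum_diag_pairIndex (Nat.le_succ _) hx (fun i => ?_) (by omega)
        rw [← oddIndex_inr, signedReindex_symm_apply, h.c_sq, one_mul]
        rfl

end OddCase

/-! ### The standard forms of the even case -/

theorem jd_eq_pairingForm (ι : Type) [DecidableEq ι] : Orthogonal.JD ι ℂ =
    pairingForm Sum.swap (Sum.elim (fun _ => 1) fun _ => 1) := by
  ext (i | i) (j | j) <;> simp [pairingForm, Orthogonal.JD, one_apply, eq_comm]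

theorem j_eq_pairingForm (ι : Type) [DecidableEq ι] : Matrix.J ι ℂ =
    pairingForm Sum.swap (Sum.elim (fun _ => -1) fun _ => 1) := by
  ext (i | i) (j | j)
  · simp [pairingForm, Matrix.J]
  · simp only [pairingForm, Matrix.J, fromBlocks_apply₁₂, of_apply,
      Sum.swap_inl, Sum.inr.injEq, Sum.elim_inl, eq_comm (a := j)]
    split_ifs with h <;> simp [h]
  · simp [pairingForm, Matrix.J, one_apply, eq_comm]
  · simp [pairingForm, Matrix.J]

/-- The sign of the bilinear form for even `N`. -/
theorem mul_neg_one_pow_pred {θ₀ η : ℤˣ} (h : θ₀ = η ∧ Odd p ∨ θ₀ = -η ∧ Even p) (k : Fin p) :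
    ((θ₀ : ℤ) : ℂ) * (-1) ^ (p - 1) = ((η : ℤ) : ℂ) := by
  rcases h with ⟨rfl, h⟩ | ⟨rfl, h⟩
  · rw [Even.neg_one_pow (Nat.Odd.sub_odd h odd_one), mul_one]
  -- The index `k` guarantees `p > 0`, so that `p - 1` is really odd.
  · rw [Odd.neg_one_pow (Nat.Even.sub_odd (Nat.succ_le_of_lt k.pos) h odd_one)]
    simp

end Identification

end FoldedW

end

/-! ### The proposition -/

theorem mainTheorem4 (N p : ℕ) (θ₀ : ℤˣ) (θ : FoldedW.Signs N θ₀) :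
    -- the constraints of `W_p(N)` and those of `W(gl(Np)^τ, [N.sl(p)]^τ)` are second class
    FoldedW.IsSecondClass (FoldedW.liePoisson (FoldedW.gl N p)) (FoldedW.wpConstraint N p) ∧
    FoldedW.IsSecondClass (FoldedW.liePoisson (FoldedW.glTau θ p))
      (FoldedW.wConstraint (FoldedW.glTau θ p) (FoldedW.kappa p)
        (FoldedW.glE θ p) (FoldedW.glF θ p)) ∧
    -- the Dirac bracket restricts to the coset
    ∃ B : FoldedW.PoissonBracket (FoldedW.FoldedWp θ p),
      (FoldedW.IsRestrictedDirac θ p B ∧ ∀ B', FoldedW.IsRestrictedDirac θ p B' → B' = B) ∧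
      -- the coset is the Hamiltonian reduction of `gl(Np)^τ`
      (∃ Ψ : FoldedW.FoldedWp θ p ≃ₐ[ℂ] FoldedW.WAlg (FoldedW.glTau θ p) (FoldedW.kappa p)
          (FoldedW.glE θ p) (FoldedW.glF θ p),
        (∀ x : FoldedW.gl N p, Ψ (Ideal.Quotient.mk _ (FoldedW.wpMk N p x)) =
          FoldedW.wMk (FoldedW.glTau θ p) (FoldedW.kappa p) (FoldedW.glE θ p) (FoldedW.glF θ p)
            (FoldedW.symmetrize θ p x)) ∧
        FoldedW.IsPoissonIso B (FoldedW.wBracket (FoldedW.glTau θ p) (FoldedW.kappa p)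
          (FoldedW.glE θ p) (FoldedW.glF θ p)) Ψ) ∧
      -- `N = 2n + 1`, `p = 2k + 1`
      (∀ n k : ℕ, N = 2 * n + 1 → p = 2 * k + 1 →
        FoldedW.FoldsTo θ p (FoldedW.soOdd n p) (FoldedW.nSlOdd n p)
          (FoldedW.soOddE n p) (FoldedW.soOddF n p) ∧
        FoldedW.IsWAlgebra B (FoldedW.soOdd n p) (FoldedW.soOddE n p) (FoldedW.soOddF n p)) ∧
      -- `N = 2n` and `θ₀ (-1)^(p-1) = -1`
      (∀ n : ℕ, N = 2 * n → (θ₀ = -1 ∧ Odd p ∨ θ₀ = 1 ∧ Even p) →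
        FoldedW.FoldsTo θ p (FoldedW.spEven n p) (FoldedW.nSlEven n p)
          (FoldedW.spEvenE n p) (FoldedW.spEvenF n p) ∧
        FoldedW.IsWAlgebra B (FoldedW.spEven n p) (FoldedW.spEvenE n p)
          (FoldedW.spEvenF n p)) ∧
      -- `N = 2n` and `θ₀ (-1)^(p-1) = 1`
      (∀ n : ℕ, N = 2 * n → (θ₀ = 1 ∧ Odd p ∨ θ₀ = -1 ∧ Even p) →
        FoldedW.FoldsTo θ p (FoldedW.soEven n p) (FoldedW.nSlEven n p)
          (FoldedW.soEvenE n p) (FoldedW.soEvenF n p) ∧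
        FoldedW.IsWAlgebra B (FoldedW.soEven n p) (FoldedW.soEvenE n p)
          (FoldedW.soEvenF n p)) := by
  open FoldedW in
  refine ⟨isSecondClass_wpConstraint N p, isSecondClass_tauConstraint θ, foldBracket θ p,
    ⟨isRestrictedDirac_foldBracket θ, fun B' h =>
      isRestrictedDirac_unique θ (isRestrictedDirac_foldBracket θ) h⟩,
    ⟨foldEquiv θ, fun x => (foldEquiv_mk θ _).trans (foldHom_wpMk θ x),
      PoissonBracket.isPoissonIso_comap _ _⟩, ?_, ?_, ?_⟩
  · rintro n k rfl hp
    exact foldsTo_odd θ ⟨k, hp⟩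
  · rintro n rfl h
    have hη := mul_neg_one_pow_pred (p := p) (η := -1) (by rwa [neg_neg])
    refine foldsTo_even θ (η := -1) (fun k => (hη k).trans (by simp)) (by norm_num)
      (j_eq_pairingForm _) rfl rfl
  · rintro n rfl h
    have hη := mul_neg_one_pow_pred (p := p) (η := 1) h
    refine foldsTo_even θ (η := 1) (fun k => (hη k).trans (by simp)) (one_mul 1)
      (jd_eq_pairingForm _) rfl rfl
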